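/- Let $\Sigma$ be a finite totally ordered alphabet and let $\mu$ (the source) be a probability distribution on the infinite words $w_1w_2\cdots$ over $\Sigma$. For $w\in\Sigma^k$ let $p_w$ be the $\mu$-probability that a word begins with $w$, and assume $$\sum_{k=0}^{\infty}\Big(\sum_{w\in\Sigma^k}p_w^2\Big)^{1/2}<\infty .$$ Let i.i.d. keys with distribution $\mu$ arrive at the successive arrival times of a unit-rate Poisson process $N=(N(t))_{t\ge 0}$ that is independent of the keys. Let $S_n$ be the number of symbol comparisons used by QuickSort to sort the first $n$ keys in lexicographic order. Here the pivot is always the first key to have arrived, recursively in each sublist; every other key of the (sub)list is compared once with the pivot, and the keys smaller than the pivot and the remaining keys are then sorted separately. Two words are compared symbol by symbol from left to right until they differ, so that a comparison of two distinct words costs one plus the length of their longest common prefix. (Under the assumption on $\mu$, the keys are almost surely distinct.) Let $S(t)=S_{N(t)}$. Then $S(t)$ has finite second moment for every $t\ge 0$, and there is a square-integrable random variable $Y$ such that $$\frac{S(t)-\mathbf{E}\,S(t)}{t}\longrightarrow Y\quad\text{in } L^2\text{ as } t\to\infty ,$$ and the limit $Y$ is nondegenerate: it is not almost surely equal to $0$.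 More precisely, $\operatorname{Var} Y\ge 7-\tfrac23\pi^2>0$, and consequently $\operatorname{Var} S(t)=\Theta(t^2)$ as $t\to\infty$. -/

import Mathlib

open MeasureTheory ProbabilityTheory Filter Asymptotics
open scoped NNReal ENNReal Topology

namespace QuickSymb

/-- Total cost of running QuickSort on a list: the first key of the list is the pivot, it is
compared once with every other key (comparing `x` with `y` costs `cost x y`), and the sublist of
keys smaller than the pivot and the sublist of the other keys, both in their original order, are
then sorted recursively in the same way. -/
def quickSortCost {α : Type*} [LinearOrder α] (cost : α → α → ℕ) : List α → ℕ
  | [] => 0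
  | x :: l =>
      (l.map fun y => cost y x).sum
        + quickSortCost cost (l.filter fun y => y < x)
        + quickSortCost cost (l.filter fun y => ¬ y < x)
termination_by l => l.length
decreasing_by
  all_goals
    simp only [List.length_cons, List.length_unattach]
    exact Nat.lt_succ_of_le ((List.length_filter_le _ _).trans (by simp))

/-- The number of symbol comparisons made when two infinite words are compared from left to right
until a difference is found: one more than the (zero-based) index of the first difference. It is
meaningful for distinct words; the value at `v = w` is a convention and concerns only a null event
for the sources considered, whose keys are almost surely distinct. -/
noncomputable def symbolComparisons {A : Type*} (v w : Lex (ℕ → A)) : ℕ :=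
  PiNat.firstDiff (ofLex v) (ofLex w) + 1

/-- `S_n`: the number of symbol comparisons used by QuickSort to sort the first `n` keys of the
sequence `x` of words, where words are ordered lexicographically. -/
noncomputable def symbolCount {A : Type*} [LinearOrder A] (x : ℕ → ℕ → A) (n : ℕ) : ℕ :=
  quickSortCost symbolComparisons ((List.range n).map fun i => toLex (x i))

/-- The fundamental probability `p_w` of the prefix `w` of length `k`: the probability that a word
drawn from the source `μ` starts with `w`. -/
noncomputable def prefixProb {A : Type*} [MeasurableSpace A] (μ : Measure (ℕ → A)) {k : ℕ}
    (w : Fin k → A) : ℝ :=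
  μ.real {x | ∀ i : Fin k, x i = w i}

/-- The condition `∑ₖ (∑_{w ∈ Aᵏ} p_w²)^{1/2} < ∞` on the source. -/
def SummableSource {A : Type*} [Fintype A] [MeasurableSpace A] (μ : Measure (ℕ → A)) : Prop :=
  Summable fun k : ℕ => Real.sqrt (∑ w : Fin k → A, prefixProb μ w ^ 2)

/-- `N` is a Poisson (counting) process with unit rate. Since the paths are almost surely
nondecreasing, the subtraction of natural numbers in the increments is almost surely the true
one. -/
structure IsUnitPoissonProcess {Ω : Type*} [MeasurableSpace Ω] (N : ℝ≥0 → Ω → ℕ)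
    (P : Measure Ω) : Prop where
  measurable : ∀ t, Measurable (N t)
  zero : ∀ᵐ ω ∂P, N 0 ω = 0
  mono : ∀ᵐ ω ∂P, Monotone fun t => N t ω
  rightCont : ∀ᵐ ω ∂P, ∀ t, ContinuousWithinAt (fun s => N s ω) (Set.Ici t) t
  indep : HasIndepIncrements N P
  law : ∀ s t : ℝ≥0, s ≤ t → P.map (fun ω => N t ω - N s ω) = poissonMeasure (t - s)

/-- `S(t) = S_{N(t)}`: the number of symbol comparisons required by QuickSort to sort the keys
generated through epoch `t`. -/
noncomputable def symbolCountAt {Ω A : Type*} [LinearOrder A] (X : ℕ → Ω → ℕ → A)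
    (N : ℝ≥0 → Ω → ℕ) (t : ℝ≥0) (ω : Ω) : ℝ :=
  (symbolCount (fun i => X i ω) (N t ω) : ℝ)

/-- `Y(t) = (S(t) - E S(t)) / t`. -/
noncomputable def normalizedCount {Ω A : Type*} [LinearOrder A] [MeasurableSpace Ω]
    (P : Measure Ω) (X : ℕ → Ω → ℕ → A) (N : ℝ≥0 → Ω → ℕ) (t : ℝ≥0) (ω : Ω) : ℝ :=
  (symbolCountAt X N t ω - ∫ ω', symbolCountAt X N t ω' ∂P) / (t : ℝ)

end QuickSymb

/-! The symbols in position k of two keys are compared exactly when the keys are compared and share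
their first k symbols. Hence S(t) is the sum over all words w of K_w, the number of key comparisons
between keys with prefix w. These keys form an interval in lexicographic order, so K_w is the number
of comparisons QuickSort makes on them alone, in order of arrival (`quickSortCost_indicator`,
`eventually_sum_levelCount`).

Given the set of keys, the order of arrival is uniform. Split K_w into its conditional mean
`keyMean` (N_w), where N_w is the number of keys with prefix w, and the deviation `keyDev`. For
distinct w of one length the deviations are orthogonal, with second moment at most 40 (p_w t)²; the
N_w are independent Poisson variables of mean p_w t, and a Poisson Poincaré inequality gives Var
`keyMean` (N_w) ≤ 4 (p_w t)². So the centred level k has L² norm at most 9 t (∑ p_w²)^{1/2}. After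
division by t this is summable in k uniformly in t, and it suffices to prove convergence at each
level.

At a fixed level the increment of `keyMean` is 2(H_{n+1} - 1), whose square is o(n), so the
conditional means contribute o(t). The ratio `keyDev` / (n + 1) is a martingale as keys arrive,
since a last key falls into a uniformly chosen gap of the search tree. Its variance `ratioVar` is
bounded, so it converges in L², while (N_w + 1)/t is close to p_w.

For the lower bound, given the set of keys, the total key count is nonnegatively correlated with
every K_w: conditioning on the pivot reduces this to Chebyshev's sum inequality for two convex
tolls. Therefore E(S(t) - c)² ≥ E `keyVar` (N(t)) for every c, and `keyVar` n / (n + 1)² increases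
to 7 - 2π²/3. -/

namespace QuickSymb

/-! ### Averages over the orderings of a finite set. -/

section OrderAvg

variable {α β : Type*} [LinearOrder α] [LinearOrder β]

/-- Auxiliary recursion for `orderAvg`. -/
noncomputable def orderAvgAux : ℕ → Finset α → (List α → ℝ) →ₗ[ℝ] ℝ
  | 0, _ => LinearMap.proj []
  | n + 1, s => ((n + 1 : ℕ) : ℝ)⁻¹ •
      ∑ x ∈ s, (orderAvgAux n (s.erase x)).comp (LinearMap.funLeft ℝ ℝ (List.cons x))

/-- The average of a functional over all orderings of a finite set. -/
noncomputable def orderAvg (s : Finset α) : (List α → ℝ) →ₗ[ℝ] ℝ := orderAvgAux s.card s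

theorem orderAvg_empty (Φ : List α → ℝ) : orderAvg ∅ Φ = Φ [] := rfl

theorem orderAvg_eq {s : Finset α} (hs : s.Nonempty) (Φ : List α → ℝ) :
    orderAvg s Φ = (s.card : ℝ)⁻¹ * ∑ x ∈ s, orderAvg (s.erase x) (fun l => Φ (x :: l)) := by
  obtain ⟨n, hn⟩ : ∃ n, s.card = n + 1 := ⟨s.card - 1, by have := hs.card_pos; omega⟩
  rw [orderAvg, hn, orderAvgAux, LinearMap.smul_apply, LinearMap.sum_apply, smul_eq_mul]
  congr 1
  refine Finset.sum_congr rfl fun x hx => ?_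
  rw [orderAvg, Finset.card_erase_of_mem hx, hn]
  rfl

theorem card_mul_orderAvg (s : Finset α) (hs : s.Nonempty) (Φ : List α → ℝ) :
    (s.card : ℝ) * orderAvg s Φ = ∑ x ∈ s, orderAvg (s.erase x) (fun l => Φ (x :: l)) := by
  have : (s.card : ℝ) ≠ 0 := by exact_mod_cast hs.card_pos.ne'
  rw [orderAvg_eq hs]; field_simp

/-- Induction on a finite set, removing an arbitrary element. -/
theorem erase_induction {C : Finset α → Prop} (h0 : C ∅)
    (h1 : ∀ s : Finset α, s.Nonempty → (∀ x ∈ s, C (s.erase x)) → C s) (s : Finset α) : C s := by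
  induction s using Finset.strongInduction with
  | H s ih =>
    rcases s.eq_empty_or_nonempty with rfl | hs
    · exact h0
    · exact h1 s hs fun x hx => ih _ (Finset.erase_ssubset hx)

/-- The list `l` is an ordering of the finite set `s`. -/
def IsOrdering (s : Finset α) (l : List α) : Prop := l.Nodup ∧ l.toFinset = s

theorem IsOrdering.length {s : Finset α} {l : List α} (h : IsOrdering s l) :
    l.length = s.card := by
  rw [← h.2, List.toFinset_card_of_nodup h.1]

theorem IsOrdering.mem {s : Finset α} {l : List α} (h : IsOrdering s l) {x : α} :
    x ∈ l ↔ x ∈ s := by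
  rw [← h.2, List.mem_toFinset]

theorem IsOrdering.cons {s : Finset α} {x : α} (hx : x ∈ s) {l : List α}
    (h : IsOrdering (s.erase x) l) : IsOrdering s (x :: l) := by
  refine ⟨List.nodup_cons.2 ⟨fun hm => ?_, h.1⟩, ?_⟩
  · simpa using h.mem.1 hm
  · rw [List.toFinset_cons, h.2, Finset.insert_erase hx]

theorem IsOrdering.filter {s : Finset α} {l : List α} (h : IsOrdering s l) (p : α → Prop)
    [DecidablePred p] : IsOrdering (s.filter p) (l.filter p) := by
  refine ⟨h.1.filter _, ?_⟩
  rw [← h.2]; ext; simp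

theorem orderAvg_mono {s : Finset α} {Φ Ψ : List α → ℝ}
    (h : ∀ l, IsOrdering s l → Φ l ≤ Ψ l) : orderAvg s Φ ≤ orderAvg s Ψ := by
  induction s using erase_induction generalizing Φ Ψ with
  | h0 => exact h [] ⟨List.nodup_nil, rfl⟩
  | h1 s hs ih =>
    rw [orderAvg_eq hs, orderAvg_eq hs]
    gcongr with x hx
    exact ih x hx fun l hl => h _ (hl.cons hx)

theorem orderAvg_congr {s : Finset α} {Φ Ψ : List α → ℝ}
    (h : ∀ l, IsOrdering s l → Φ l = Ψ l) : orderAvg s Φ = orderAvg s Ψ :=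
  le_antisymm (orderAvg_mono fun l hl => (h l hl).le) (orderAvg_mono fun l hl => (h l hl).ge)

theorem orderAvg_const (s : Finset α) (c : ℝ) : orderAvg s (fun _ => c) = c := by
  induction s using erase_induction with
  | h0 => rfl
  | h1 s hs ih =>
    have : (s.card : ℝ) ≠ 0 := by exact_mod_cast hs.card_pos.ne'
    rw [orderAvg_eq hs, Finset.sum_congr rfl ih, Finset.sum_const, nsmul_eq_mul]
    field_simp

theorem orderAvg_nonneg {s : Finset α} {Φ : List α → ℝ}
    (h : ∀ l, IsOrdering s l → 0 ≤ Φ l) : 0 ≤ orderAvg s Φ := by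
  rw [← orderAvg_const s 0]; exact orderAvg_mono h

theorem orderAvg_add (s : Finset α) (Φ Ψ : List α → ℝ) :
    orderAvg s (fun l => Φ l + Ψ l) = orderAvg s Φ + orderAvg s Ψ := (orderAvg s).map_add Φ Ψ

theorem orderAvg_sub (s : Finset α) (Φ Ψ : List α → ℝ) :
    orderAvg s (fun l => Φ l - Ψ l) = orderAvg s Φ - orderAvg s Ψ := (orderAvg s).map_sub Φ Ψ

theorem orderAvg_const_mul (s : Finset α) (c : ℝ) (Φ : List α → ℝ) :
    orderAvg s (fun l => c * Φ l) = c * orderAvg s Φ := (orderAvg s).map_smul c Φ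

theorem orderAvg_sum {ι : Type*} (s : Finset α) (t : Finset ι) (Φ : ι → List α → ℝ) :
    orderAvg s (fun l => ∑ i ∈ t, Φ i l) = ∑ i ∈ t, orderAvg s (Φ i) := by
  rw [← map_sum]; congr 1; ext l; simp

/-- A uniform ordering induces independent uniform orderings on disjoint subsets. Condition on the
first element: it lies in `p`, in `q` or in neither, and the weights of the three cases add up to
`s.card`. -/
theorem orderAvg_filter_mul_filter (s : Finset α) (p q : α → Prop) [DecidablePred p]
    [DecidablePred q] (hpq : ∀ x, p x → ¬ q x) (Ψ Θ : List α → ℝ) :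
    orderAvg s (fun l => Ψ (l.filter p) * Θ (l.filter q)) =
      orderAvg (s.filter p) Ψ * orderAvg (s.filter q) Θ := by
  induction s using erase_induction generalizing Ψ Θ with
  | h0 => rfl
  | h1 s hs ih =>
    have hs0 : (s.card : ℝ) ≠ 0 := by exact_mod_cast hs.card_pos.ne'
    apply mul_left_cancel₀ hs0
    rw [card_mul_orderAvg s hs]
    have key : ∀ x ∈ s, orderAvg (s.erase x)
          (fun l => Ψ ((x :: l).filter p) * Θ ((x :: l).filter q)) =
        (if p x then orderAvg ((s.filter p).erase x) (fun l => Ψ (x :: l)) *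
            orderAvg (s.filter q) Θ else 0) +
        (if q x then orderAvg (s.filter p) Ψ *
            orderAvg ((s.filter q).erase x) (fun l => Θ (x :: l)) else 0) +
        (if p x ∨ q x then 0 else orderAvg (s.filter p) Ψ * orderAvg (s.filter q) Θ) := by
      intro x hx
      by_cases hp : p x
      · have hq := hpq x hp
        have h := ih x hx (fun l => Ψ (x :: l)) Θ
        rw [Finset.filter_erase, Finset.filter_erase,
          Finset.erase_eq_of_notMem (s := s.filter q) (by simp [hq])] at h
        simpa [hp, hq] using h
      · by_cases hq : q x
        · have h := ih x hx Ψ (fun l => Θ (x :: l))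
          rw [Finset.filter_erase, Finset.filter_erase,
            Finset.erase_eq_of_notMem (s := s.filter p) (by simp [hp])] at h
          simpa [hp, hq] using h
        · have h := ih x hx Ψ Θ
          rw [Finset.filter_erase, Finset.filter_erase,
            Finset.erase_eq_of_notMem (s := s.filter q) (by simp [hq]),
            Finset.erase_eq_of_notMem (s := s.filter p) (by simp [hp])] at h
          simpa [hp, hq] using h
    rw [Finset.sum_congr rfl key, Finset.sum_add_distrib, Finset.sum_add_distrib,
      ← Finset.sum_filter, ← Finset.sum_filter, ← Finset.sum_mul, ← Finset.mul_sum]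
    have h1 : ∀ (r : α → Prop) [DecidablePred r] (Ξ : List α → ℝ),
        ∑ x ∈ s.filter r, orderAvg ((s.filter r).erase x) (fun l => Ξ (x :: l)) =
          ((s.filter r).card : ℝ) * orderAvg (s.filter r) Ξ := by
      intro r _ Ξ
      rcases (s.filter r).eq_empty_or_nonempty with h | h
      · simp [h]
      · rw [card_mul_orderAvg _ h]
    rw [h1 p, h1 q]
    have h2 : (s.card : ℝ) = (s.filter p).card + (s.filter q).card +
        ∑ x ∈ s, (if p x ∨ q x then (0 : ℝ) else 1) := by
      rw [Finset.card_filter, Finset.card_filter, Finset.card_eq_sum_ones]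
      push_cast
      rw [← Finset.sum_add_distrib, ← Finset.sum_add_distrib]
      refine Finset.sum_congr rfl fun x _ => ?_
      have := hpq x
      by_cases hp : p x <;> by_cases hq : q x <;> simp_all
    have h3 : ∑ x ∈ s, (if p x ∨ q x then (0 : ℝ)
          else orderAvg (s.filter p) Ψ * orderAvg (s.filter q) Θ) =
        (∑ x ∈ s, (if p x ∨ q x then (0 : ℝ) else 1)) *
          (orderAvg (s.filter p) Ψ * orderAvg (s.filter q) Θ) := by
      rw [Finset.sum_mul]
      refine Finset.sum_congr rfl fun x _ => ?_
      split_ifs <;> simp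
    rw [h3, h2]
    ring

theorem orderAvg_filter (s : Finset α) (p : α → Prop) [DecidablePred p] (Ψ : List α → ℝ) :
    orderAvg s (fun l => Ψ (l.filter p)) = orderAvg (s.filter p) Ψ := by
  have := orderAvg_filter_mul_filter s p (fun _ => False) (by simp) Ψ (fun _ => 1)
  simpa [orderAvg_const] using this

/-- A uniform ordering can be built from its last element as well as from its first: expand at both
ends and exchange the two sums. This gives access to the arrival of a new key. -/
theorem orderAvg_eq_append {s : Finset α} (hs : s.Nonempty) (Φ : List α → ℝ) :
    orderAvg s Φ = (s.card : ℝ)⁻¹ * ∑ x ∈ s, orderAvg (s.erase x) (fun l => Φ (l ++ [x])) := by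
  induction s using erase_induction generalizing Φ with
  | h0 => simp at hs
  | h1 s _ ih =>
    rcases hs.exists_eq_singleton_or_nontrivial.symm with h | ⟨a, rfl⟩
    · have hne : ∀ x ∈ s, (s.erase x).Nonempty := fun x hx => h.erase_nonempty
      rw [orderAvg_eq hs]
      congr 1
      have h1 : ∀ x ∈ s, orderAvg (s.erase x) (fun l => Φ (x :: l)) =
          (((s.card - 1 : ℕ) : ℝ))⁻¹ * ∑ y ∈ s.erase x,
            orderAvg ((s.erase x).erase y) (fun l => Φ (x :: (l ++ [y]))) := fun x hx => by
        rw [ih x hx (hne x hx), Finset.card_erase_of_mem hx]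
      have h2 : ∀ y ∈ s, orderAvg (s.erase y) (fun l => Φ (l ++ [y])) =
          (((s.card - 1 : ℕ) : ℝ))⁻¹ * ∑ x ∈ s.erase y,
            orderAvg ((s.erase y).erase x) (fun l => Φ (x :: (l ++ [y]))) := fun y hy => by
        rw [orderAvg_eq (hne y hy), Finset.card_erase_of_mem hy]
        rfl
      rw [Finset.sum_congr rfl h1, Finset.sum_congr rfl h2, ← Finset.mul_sum, ← Finset.mul_sum]
      congr 1
      rw [Finset.sum_comm' (t' := s) (s' := fun y => s.erase y)]
      · refine Finset.sum_congr rfl fun y _ => Finset.sum_congr rfl fun x _ => ?_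
        rw [Finset.erase_right_comm]
      · intro x y; simp only [Finset.mem_erase]; tauto
    · rw [orderAvg_eq (by simp)]
      simp [orderAvg_empty]

theorem orderAvg_image (s : Finset α) (f : α → β) (hf : Set.InjOn f s) (Φ : List β → ℝ) :
    orderAvg (s.image f) Φ = orderAvg s (fun l => Φ (l.map f)) := by
  induction s using erase_induction generalizing Φ with
  | h0 => rfl
  | h1 s hs ih =>
    rw [orderAvg_eq (hs.image f), orderAvg_eq hs, Finset.card_image_of_injOn hf,
      Finset.sum_image hf]
    congr 1
    refine Finset.sum_congr rfl fun x hx => ?_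
    have : (s.image f).erase (f x) = (s.erase x).image f := by
      ext z
      simp only [Finset.mem_erase, Finset.mem_image]
      constructor
      · rintro ⟨h, y, hy, rfl⟩
        exact ⟨y, ⟨fun e => h (by rw [e]), hy⟩, rfl⟩
      · rintro ⟨y, ⟨h, hy⟩, rfl⟩
        exact ⟨fun e => h (hf hy hx e), y, hy, rfl⟩
    rw [this, ih x hx (hf.mono (by simp))]
    rfl

/-- Links `orderAvg` with permutations of indices, the form in which exchangeability is available.
Permutations are sorted by their value at 0. -/
theorem sum_perm_ofFn {n : ℕ} (x : Fin n → α) (hx : Function.Injective x) (Φ : List α → ℝ) :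
    ∑ σ : Equiv.Perm (Fin n), Φ (List.ofFn fun i => x (σ i)) =
      (n.factorial : ℝ) * orderAvg (Finset.univ.image x) Φ := by
  induction n generalizing Φ with
  | zero => simp [orderAvg_empty]
  | succ n ih =>
    have hcard : (Finset.univ.image x).card = n + 1 := by
      rw [Finset.card_image_of_injective _ hx]; simp
    have hne : (Finset.univ.image x).Nonempty := by simp
    rw [← Equiv.sum_comp Equiv.Perm.decomposeFin.symm, Fintype.sum_prod_type]
    have h1 : ∀ i : Fin (n + 1), ∑ τ : Equiv.Perm (Fin n),
          Φ (List.ofFn fun j => x (Equiv.Perm.decomposeFin.symm (i, τ) j)) =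
        (n.factorial : ℝ) *
          orderAvg ((Finset.univ.image x).erase (x i)) (fun l => Φ (x i :: l)) := by
      intro i
      have h2 := ih (fun j => x (Equiv.swap 0 i j.succ))
        (hx.comp ((Equiv.swap 0 i).injective.comp (Fin.succ_injective n))) (fun l => Φ (x i :: l))
      have h3 : Finset.univ.image (fun j : Fin n => x (Equiv.swap 0 i j.succ)) =
          (Finset.univ.image x).erase (x i) := by
        apply Finset.eq_of_subset_of_card_le
        · intro z
          simp only [Finset.mem_image, Finset.mem_univ, true_and, Finset.mem_erase]
          rintro ⟨j, rfl⟩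
          refine ⟨fun e => ?_, _, rfl⟩
          have := hx e
          rw [Equiv.swap_apply_eq_iff] at this
          simp at this
        · rw [Finset.card_erase_of_mem (by simp), hcard, Finset.card_image_of_injective]
          · simp
          · exact hx.comp ((Equiv.swap 0 i).injective.comp (Fin.succ_injective n))
      rw [h3] at h2
      rw [← h2]
      refine Finset.sum_congr rfl fun τ _ => ?_
      rw [List.ofFn_succ]
      simp
    rw [Finset.sum_congr rfl fun i _ => h1 i, ← Finset.mul_sum, orderAvg_eq hne, hcard,
      Finset.sum_image (fun _ _ _ _ h => hx h), Nat.factorial_succ]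
    push_cast
    have : (n + 1 : ℝ) ≠ 0 := by positivity
    field_simp

end OrderAvg

/-! ### Combinatorics of QuickSort and of the binary search tree. -/

section QuickSort

variable {α β ι : Type*} [LinearOrder α] [LinearOrder β]

theorem quickSortCost_nil (c : α → α → ℕ) : quickSortCost c [] = 0 := by
  rw [quickSortCost]

theorem quickSortCost_cons (c : α → α → ℕ) (x : α) (l : List α) :
    quickSortCost c (x :: l) = (l.map fun y => c y x).sum
        + quickSortCost c (l.filter fun y => y < x)
        + quickSortCost c (l.filter fun y => ¬ y < x) := by
  rw [quickSortCost]

/-- Induction along the recursive calls of QuickSort. -/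
theorem quickSort_induction {C : List α → Prop} (h0 : C [])
    (h1 : ∀ x l, C (l.filter fun y => y < x) → C (l.filter fun y => ¬ y < x) → C (x :: l))
    (l : List α) : C l := by
  induction hn : l.length using Nat.strong_induction_on generalizing l with
  | _ n ih =>
    subst hn
    match l with
    | [] => exact h0
    | x :: l =>
      refine h1 x l (ih _ ?_ _ rfl) (ih _ ?_ _ rfl)
      · exact Nat.lt_succ_of_le (List.length_filter_le _ _)
      · exact Nat.lt_succ_of_le (List.length_filter_le _ _)

/-- The number of key comparisons made by QuickSort. -/
noncomputable def keyCount (l : List α) : ℕ := quickSortCost (fun _ _ => 1) l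

theorem keyCount_nil : keyCount ([] : List α) = 0 := quickSortCost_nil _

theorem keyCount_cons (x : α) (l : List α) :
    keyCount (x :: l) = l.length + keyCount (l.filter fun y => y < x)
        + keyCount (l.filter fun y => ¬ y < x) := by
  rw [keyCount, quickSortCost_cons]; simp [keyCount]

theorem quickSortCost_congr {c c' : α → α → ℕ} {l : List α} (hl : l.Nodup)
    (h : ∀ x ∈ l, ∀ y ∈ l, x ≠ y → c x y = c' x y) : quickSortCost c l = quickSortCost c' l := by
  induction l using quickSort_induction with
  | h0 => rw [quickSortCost_nil, quickSortCost_nil]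
  | h1 x l ih1 ih2 =>
    rw [List.nodup_cons] at hl
    rw [quickSortCost_cons, quickSortCost_cons,
      ih1 (hl.2.filter _) fun a ha b hb hab => h a
        (List.mem_cons_of_mem _ (List.mem_of_mem_filter ha)) b
        (List.mem_cons_of_mem _ (List.mem_of_mem_filter hb)) hab,
      ih2 (hl.2.filter _) fun a ha b hb hab => h a
        (List.mem_cons_of_mem _ (List.mem_of_mem_filter ha)) b
        (List.mem_cons_of_mem _ (List.mem_of_mem_filter hb)) hab]
    congr 3
    refine List.map_congr_left fun a ha => ?_
    exact h a (List.mem_cons_of_mem _ ha) x List.mem_cons_self fun e => hl.1 (e ▸ ha)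

theorem quickSortCost_sum (t : Finset ι) (c : ι → α → α → ℕ) (l : List α) :
    quickSortCost (fun x y => ∑ i ∈ t, c i x y) l = ∑ i ∈ t, quickSortCost (c i) l := by
  induction l using quickSort_induction with
  | h0 => simp [quickSortCost_nil]
  | h1 x l ih1 ih2 =>
    simp only [quickSortCost_cons]
    rw [ih1, ih2, Finset.sum_add_distrib, Finset.sum_add_distrib]
    congr 2
    clear ih1 ih2
    induction l with
    | nil => simp
    | cons a l ih => simp only [List.map_cons, List.sum_cons, ih, Finset.sum_add_distrib]

/-- A predicate whose solution set is order convex. -/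
def ConvexPred (p : α → Prop) : Prop := ∀ a b c, p a → p b → a ≤ c → c ≤ b → p c

/-- A pivot outside an interval has the whole interval on one side and does not separate its
elements. -/
theorem filter_lt_or_filter_not_lt {p : α → Prop} [DecidablePred p] (hp : ConvexPred p) {x : α}
    (hx : ¬ p x) (l : List α) :
    ((l.filter fun y => y < x).filter p = l.filter p ∧
      (l.filter fun y => ¬ y < x).filter p = []) ∨
    ((l.filter fun y => y < x).filter p = [] ∧
      (l.filter fun y => ¬ y < x).filter p = l.filter p) := by
  by_cases h : ∃ a, p a ∧ a < x
  · left
    obtain ⟨a, ha, hax⟩ := h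
    have hlt : ∀ b, p b → b < x := fun b hb => by
      by_contra hbx
      exact hx (hp a b x ha hb hax.le (not_lt.1 hbx))
    constructor
    · rw [List.filter_filter]
      refine List.filter_congr fun b _ => ?_
      have := hlt b
      by_cases hb : p b <;> simp_all
    · rw [List.filter_filter, List.filter_eq_nil_iff]
      intro b _
      have := hlt b
      by_cases hb : p b <;> simp_all
  · right
    push Not at h
    constructor
    · rw [List.filter_filter, List.filter_eq_nil_iff]
      intro b _
      have := h b
      by_cases hb : p b <;> simp_all
    · rw [List.filter_filter]
      refine List.filter_congr fun b _ => ?_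
      have := h b
      by_cases hb : p b <;> simp_all

/-- Pivots inside the interval act as pivots of the filtered list; pivots outside neither split the
interval nor cost anything. -/
theorem quickSortCost_indicator {p : α → Prop} [DecidablePred p] (hp : ConvexPred p)
    (l : List α) :
    quickSortCost (fun x y => if p x ∧ p y then 1 else 0) l = keyCount (l.filter p) := by
  induction l using quickSort_induction with
  | h0 => rw [quickSortCost_nil]; exact keyCount_nil.symm
  | h1 x l ih1 ih2 =>
    rw [quickSortCost_cons, ih1, ih2]
    by_cases hx : p x
    · rw [List.filter_cons_of_pos (by simpa using hx), keyCount_cons]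
      simp only [List.filter_filter, hx, and_true]
      congr 1
      · congr 1
        · clear ih1 ih2
          induction l with
          | nil => rfl
          | cons a l ih => by_cases ha : p a <;> simp [ha, ih, add_comm]
        · simp only [Bool.and_comm]
      · simp only [Bool.and_comm]
    · rw [List.filter_cons_of_neg (by simpa using hx)]
      have h0 : (l.map fun y => if p y ∧ p x then 1 else 0).sum = 0 := by
        simp [hx]
      rw [h0]
      rcases filter_lt_or_filter_not_lt hp hx l with ⟨h1, h2⟩ | ⟨h1, h2⟩ <;>
        rw [h1, h2] <;> simp [keyCount_nil]

theorem filter_map_comp {γ : Type*} (x : ι → γ) (l : List ι) (p : γ → Prop) [DecidablePred p] :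
    (l.map x).filter p = (l.filter fun i => p (x i)).map x := by
  rw [List.filter_map]; rfl

/-- QuickSort sees keys only through their order relations. This serves both to transport patterns
and to prove measurability. -/
theorem keyCount_map_congr (x : ι → α) (y : ι → β) (l : List ι)
    (h : ∀ i ∈ l, ∀ j ∈ l, x i < x j ↔ y i < y j) :
    keyCount (l.map x) = keyCount (l.map y) := by
  induction hn : l.length using Nat.strong_induction_on generalizing l with
  | _ n ih =>
    subst hn
    match l with
    | [] => simp [keyCount_nil]
    | a :: l =>
      rw [List.map_cons, List.map_cons, keyCount_cons, keyCount_cons, filter_map_comp,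
        filter_map_comp, filter_map_comp, filter_map_comp]
      have e1 : (l.filter fun i => y i < y a) = l.filter fun i => x i < x a :=
        List.filter_congr fun i hi => by
          simp only [h i (List.mem_cons_of_mem _ hi) a List.mem_cons_self]
      have e2 : (l.filter fun i => ¬ y i < y a) = l.filter fun i => ¬ x i < x a :=
        List.filter_congr fun i hi => by
          simp only [h i (List.mem_cons_of_mem _ hi) a List.mem_cons_self]
      rw [e1, e2, ih _ _ (l.filter fun i => x i < x a) _ rfl,
        ih _ _ (l.filter fun i => ¬ x i < x a) _ rfl]
      · simp
      · exact Nat.lt_succ_of_le (List.length_filter_le _ _)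
      · intro i hi j hj
        exact h i (List.mem_cons_of_mem _ (List.mem_of_mem_filter hi)) j
          (List.mem_cons_of_mem _ (List.mem_of_mem_filter hj))
      · exact Nat.lt_succ_of_le (List.length_filter_le _ _)
      · intro i hi j hj
        exact h i (List.mem_cons_of_mem _ (List.mem_of_mem_filter hi)) j
          (List.mem_cons_of_mem _ (List.mem_of_mem_filter hj))

/-- The depth of the external node number `r` (from the left) of the binary search tree built
from the list. -/
def gapDepth : List α → ℕ → ℕ
  | [], _ => 0
  | x :: l, r =>
    let m := (l.filter fun y => y < x).length
    1 + if r ≤ m then gapDepth (l.filter fun y => y < x) r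
      else gapDepth (l.filter fun y => ¬ y < x) (r - m - 1)
termination_by l => l.length
decreasing_by
  all_goals
    simp only [List.length_cons, List.length_unattach]
    exact Nat.lt_succ_of_le ((List.length_filter_le _ _).trans (by simp))

theorem gapDepth_nil (r : ℕ) : gapDepth ([] : List α) r = 0 := by rw [gapDepth]

theorem gapDepth_cons (x : α) (l : List α) (r : ℕ) : gapDepth (x :: l) r =
    1 + if r ≤ (l.filter fun y => y < x).length then gapDepth (l.filter fun y => y < x) r
      else gapDepth (l.filter fun y => ¬ y < x) (r - (l.filter fun y => y < x).length - 1) := by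
  rw [gapDepth]

theorem gapDepth_map_congr (x : ι → α) (y : ι → β) (l : List ι) (r : ℕ)
    (h : ∀ i ∈ l, ∀ j ∈ l, x i < x j ↔ y i < y j) :
    gapDepth (l.map x) r = gapDepth (l.map y) r := by
  induction hn : l.length using Nat.strong_induction_on generalizing l r with
  | _ n ih =>
    subst hn
    match l with
    | [] => simp [gapDepth_nil]
    | a :: l =>
      rw [List.map_cons, List.map_cons, gapDepth_cons, gapDepth_cons, filter_map_comp,
        filter_map_comp, filter_map_comp, filter_map_comp]
      have e1 : (l.filter fun i => y i < y a) = l.filter fun i => x i < x a :=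
        List.filter_congr fun i hi => by
          simp only [h i (List.mem_cons_of_mem _ hi) a List.mem_cons_self]
      have e2 : (l.filter fun i => ¬ y i < y a) = l.filter fun i => ¬ x i < x a :=
        List.filter_congr fun i hi => by
          simp only [h i (List.mem_cons_of_mem _ hi) a List.mem_cons_self]
      rw [e1, e2, ih _ _ (l.filter fun i => x i < x a) _ _ rfl,
        ih _ _ (l.filter fun i => ¬ x i < x a) _ _ rfl]
      · simp
      · exact Nat.lt_succ_of_le (List.length_filter_le _ _)
      · intro i hi j hj
        exact h i (List.mem_cons_of_mem _ (List.mem_of_mem_filter hi)) j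
          (List.mem_cons_of_mem _ (List.mem_of_mem_filter hj))
      · exact Nat.lt_succ_of_le (List.length_filter_le _ _)
      · intro i hi j hj
        exact h i (List.mem_cons_of_mem _ (List.mem_of_mem_filter hi)) j
          (List.mem_cons_of_mem _ (List.mem_of_mem_filter hj))

theorem length_filter_add_length_filter_not (l : List α) (x : α) :
    (l.filter fun y => y < x).length + (l.filter fun y => ¬ y < x).length = l.length := by
  have := List.length_eq_length_filter_add (l := l) (fun y => decide (y < x))
  rw [this]; simp only [decide_not]

/-- A key arriving last is compared exactly with the pivots on the path to the external node where
it lands, and the index of that node is the rank of the key. -/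
theorem keyCount_append_singleton (l : List α) (x : α) (hx : x ∉ l) :
    keyCount (l ++ [x]) = keyCount l + gapDepth l (l.filter fun y => y < x).length := by
  induction l using quickSort_induction with
  | h0 => simp [keyCount_cons, keyCount_nil, gapDepth_nil]
  | h1 a l ih1 ih2 =>
    have hxl : x ∉ l := fun h => hx (List.mem_cons_of_mem _ h)
    have hxa : x ≠ a := fun h => hx (h ▸ List.mem_cons_self)
    have ih1 := ih1 fun h => hxl (List.mem_of_mem_filter h)
    have ih2 := ih2 fun h => hxl (List.mem_of_mem_filter h)
    rw [List.cons_append, keyCount_cons, keyCount_cons, gapDepth_cons, List.filter_append,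
      List.filter_append, List.length_append]
    rcases lt_or_gt_of_ne hxa with h | h
    · have e1 : ((a :: l).filter fun y => y < x) = (l.filter fun y => y < a).filter
          fun y => y < x := by
        rw [List.filter_cons_of_neg (by simpa using h.le), List.filter_filter]
        refine List.filter_congr fun b _ => ?_
        by_cases hb : b < x
        · simp [hb, hb.trans h]
        · simp [hb]
      rw [e1, if_pos (List.length_filter_le _ _)]
      simp only [List.filter_cons, List.filter_nil, h, decide_true, if_true, not_true, decide_false,
        Bool.false_eq_true, if_false, List.append_nil, List.length_singleton]
      rw [ih1]
      ring
    · have e1 : ((a :: l).filter fun y => y < x).length = (l.filter fun y => y < a).length + 1 +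
          ((l.filter fun y => ¬ y < a).filter fun y => y < x).length := by
        rw [List.filter_cons_of_pos (by simpa using h), List.length_cons,
          ← length_filter_add_length_filter_not _ a, List.filter_filter, List.filter_filter,
          List.filter_filter]
        have : (l.filter fun b => decide (b < a) && decide (b < x)) = l.filter fun b => b < a :=
          List.filter_congr fun b _ => by
            by_cases hb : b < a
            · simp [hb, hb.trans h]
            · simp [hb]
        rw [this]
        simp only [Bool.and_comm]
        ring
      rw [e1, if_neg (by omega)]
      have h' : ¬ x < a := not_lt.2 h.le
      simp only [List.filter_cons, List.filter_nil, h', decide_true, if_true, decide_false,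
        Bool.false_eq_true, if_false, List.append_nil, List.length_singleton, not_false_iff]
      rw [ih2, show ∀ u v : ℕ, u + 1 + v - u - 1 = v by intros; omega]
      ring

theorem sum_gapDepth_cons (x : α) (l : List α) (f : ℕ → ℝ) :
    ∑ r ∈ Finset.range ((x :: l).length + 1), f (gapDepth (x :: l) r) =
      ∑ r ∈ Finset.range ((l.filter fun y => y < x).length + 1),
        f (1 + gapDepth (l.filter fun y => y < x) r) +
      ∑ r ∈ Finset.range ((l.filter fun y => ¬ y < x).length + 1),
        f (1 + gapDepth (l.filter fun y => ¬ y < x) r) := by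
  have hlen : (x :: l).length + 1 = ((l.filter fun y => y < x).length + 1) +
      ((l.filter fun y => ¬ y < x).length + 1) := by
    have := length_filter_add_length_filter_not l x
    rw [List.length_cons]; omega
  rw [hlen, Finset.sum_range_add]
  congr 1
  · refine Finset.sum_congr rfl fun r hr => ?_
    rw [gapDepth_cons, if_pos (by have := Finset.mem_range.1 hr; omega)]
  · refine Finset.sum_congr rfl fun r hr => ?_
    rw [gapDepth_cons, if_neg (by omega)]
    congr 3
    omega

/-- External path length equals internal path length plus twice the number of nodes; the internal
path length is the number of key comparisons. -/
theorem sum_gapDepth (l : List α) :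
    ∑ r ∈ Finset.range (l.length + 1), (gapDepth l r : ℝ) = keyCount l + 2 * l.length := by
  induction l using quickSort_induction with
  | h0 => simp [keyCount_nil, gapDepth_nil]
  | h1 a l ih1 ih2 =>
    rw [sum_gapDepth_cons a l (fun n => (n : ℝ)), keyCount_cons]
    push_cast
    rw [Finset.sum_add_distrib, Finset.sum_add_distrib, ih1, ih2]
    simp only [Finset.sum_const, Finset.card_range, nsmul_eq_mul, mul_one, List.length_cons]
    rw [← length_filter_add_length_filter_not l a]
    push_cast
    ring

/-- The sum of the squared depths of the external nodes of the binary search tree. -/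
noncomputable def gapSquares (l : List α) : ℝ :=
  ∑ r ∈ Finset.range (l.length + 1), (gapDepth l r : ℝ) ^ 2

theorem gapSquares_nil : gapSquares ([] : List α) = 0 := by simp [gapSquares, gapDepth_nil]

theorem gapSquares_cons (x : α) (l : List α) : gapSquares (x :: l) =
    (gapSquares (l.filter fun y => y < x) + 2 * keyCount (l.filter fun y => y < x)
      + 5 * (l.filter fun y => y < x).length + 1) +
    (gapSquares (l.filter fun y => ¬ y < x) + 2 * keyCount (l.filter fun y => ¬ y < x)
      + 5 * (l.filter fun y => ¬ y < x).length + 1) := by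
  -- Expanding (1 + d)², the linear term contributes 2 `keyCount` + 4 length by `sum_gapDepth`, and
  -- the constant contributes length + 1.
  have h : ∀ l' : List α, ∑ r ∈ Finset.range (l'.length + 1), (((1 + gapDepth l' r : ℕ)) : ℝ) ^ 2 =
      gapSquares l' + 2 * keyCount l' + 5 * l'.length + 1 := fun l' => by
    have h1 : ∀ r, (((1 + gapDepth l' r : ℕ)) : ℝ) ^ 2 =
        (gapDepth l' r : ℝ) ^ 2 + 2 * gapDepth l' r + 1 := fun r => by push_cast; ring
    simp only [h1, Finset.sum_add_distrib, ← Finset.mul_sum, sum_gapDepth, gapSquares]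
    simp
    ring
  rw [gapSquares, sum_gapDepth_cons x l (fun n => (n : ℝ) ^ 2), h, h]

end QuickSort

/-! ### Exact first and second moments for uniform orderings. -/

section Moments

variable {α : Type*} [LinearOrder α]

/-- The harmonic numbers. -/
noncomputable def harm (n : ℕ) : ℝ := ∑ i ∈ Finset.range n, 1 / ((i : ℝ) + 1)

/-- The second order harmonic numbers. -/
noncomputable def harmSq (n : ℕ) : ℝ := ∑ i ∈ Finset.range n, 1 / ((i : ℝ) + 1) ^ 2

theorem harm_zero : harm 0 = 0 := by simp [harm]

theorem harmSq_zero : harmSq 0 = 0 := by simp [harmSq]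

theorem harm_succ (n : ℕ) : harm (n + 1) = harm n + 1 / ((n : ℝ) + 1) :=
  Finset.sum_range_succ _ _

theorem harmSq_succ (n : ℕ) : harmSq (n + 1) = harmSq n + 1 / ((n : ℝ) + 1) ^ 2 :=
  Finset.sum_range_succ _ _

/-- The mean number of key comparisons for `n` keys. -/
noncomputable def keyMean (n : ℕ) : ℝ := 2 * (n + 1) * harm n - 4 * n

/-- The variance of the number of key comparisons for `n` keys. -/
noncomputable def keyVar (n : ℕ) : ℝ :=
  7 * n ^ 2 - 4 * (n + 1) ^ 2 * harmSq n - 2 * (n + 1) * harm n + 13 * n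

/-- The mean of `gapSquares` for `n` keys. -/
noncomputable def gapSquaresMean (n : ℕ) : ℝ :=
  (n + 1) * (4 * (harm (n + 1) ^ 2 - harmSq (n + 1)) - 6 * harm (n + 1) + 6)

theorem keyMean_zero : keyMean 0 = 0 := by simp [keyMean, harm_zero]

theorem keyVar_zero : keyVar 0 = 0 := by simp [keyVar, harm_zero, harmSq_zero]

theorem gapSquaresMean_zero : gapSquaresMean 0 = 0 := by
  simp [gapSquaresMean, harm_succ, harmSq_succ, harm_zero, harmSq_zero]

theorem keyMean_succ (n : ℕ) : keyMean (n + 1) = keyMean n + 2 * (harm (n + 1) - 1) := by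
  rw [keyMean, keyMean, harm_succ]
  push_cast
  have : (n : ℝ) + 1 ≠ 0 := by positivity
  field_simp
  ring

/-- The recursion seen from the last key: given a tree with n keys and K comparisons, the new key
costs (K + 2n)/(n + 1) on average. -/
theorem keyMean_succ' (n : ℕ) :
    keyMean (n + 1) = keyMean n * ((n + 2) / (n + 1)) + 2 * n / (n + 1) := by
  rw [keyMean, keyMean, harm_succ]
  push_cast
  have : (n : ℝ) + 1 ≠ 0 := by positivity
  field_simp
  ring

/-- The second moment recursion for inserting a last key into a uniform gap; `gapSquaresMean` enters
through the squared depth. -/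
theorem keyVar_succ (n : ℕ) : keyVar (n + 1) =
    keyVar n * ((n + 3) / (n + 1)) + gapSquaresMean n / (n + 1)
      - (keyMean (n + 1) - keyMean n) ^ 2 := by
  rw [keyMean_succ, keyVar, keyVar, gapSquaresMean, harm_succ, harmSq_succ]
  push_cast
  have : (n : ℝ) + 1 ≠ 0 := by positivity
  field_simp
  ring

/-- The QuickSort recursion M_n = n - 1 + (2/n) ∑_{j<n} M_j, cleared of denominators. -/
theorem sum_keyMean (n : ℕ) :
    2 * ∑ j ∈ Finset.range n, keyMean j = n * keyMean n - n * (n - 1) := by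
  induction n with
  | zero => simp
  | succ n ih =>
    rw [Finset.sum_range_succ, mul_add, ih, keyMean_succ']
    push_cast
    have : (n : ℝ) + 1 ≠ 0 := by positivity
    field_simp
    ring

theorem sum_gapSquaresMean (n : ℕ) :
    2 * ∑ j ∈ Finset.range n, (gapSquaresMean j + 2 * keyMean j + 5 * j + 1) =
      n * gapSquaresMean n := by
  induction n with
  | zero => simp
  | succ n ih =>
    rw [Finset.sum_range_succ, mul_add, ih, gapSquaresMean, gapSquaresMean, keyMean,
      harm_succ (n + 1), harmSq_succ (n + 1), harm_succ, harmSq_succ]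
    push_cast
    have : (n : ℝ) + 1 ≠ 0 := by positivity
    have : (n : ℝ) + 1 + 1 ≠ 0 := by positivity
    field_simp
    ring

theorem card_filter_lt_injOn (s : Finset α) :
    Set.InjOn (fun x => (s.filter fun y => y < x).card) s := by
  have key : ∀ x ∈ s, ∀ y, x < y →
      (s.filter fun z => z < x).card < (s.filter fun z => z < y).card := by
    intro x hx y hxy
    apply Finset.card_lt_card
    rw [Finset.ssubset_iff_of_subset]
    · exact ⟨x, by simp [hx, hxy], by simp⟩
    · intro z
      simp only [Finset.mem_filter]
      exact fun h => ⟨h.1, h.2.trans hxy⟩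
  intro x hx y hy h
  simp only at h
  rcases lt_trichotomy x y with h' | h' | h'
  · exact absurd h (key x hx y h').ne
  · exact h'
  · exact absurd h (key y hy x h').ne'

theorem card_filter_lt_lt {s : Finset α} {x : α} (hx : x ∈ s) :
    (s.filter fun y => y < x).card < s.card :=
  Finset.card_lt_card (Finset.filter_ssubset.2 ⟨x, hx, by simp⟩)

theorem sum_rank {M : Type*} [AddCommMonoid M] (s : Finset α) (f : ℕ → M) :
    ∑ x ∈ s, f (s.filter fun y => y < x).card = ∑ j ∈ Finset.range s.card, f j := by
  rw [← Finset.sum_image (f := f) (card_filter_lt_injOn s)]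
  congr 1
  apply Finset.eq_of_subset_of_card_le
  · intro j
    simp only [Finset.mem_image, Finset.mem_range]
    rintro ⟨x, hx, rfl⟩
    exact card_filter_lt_lt hx
  · rw [Finset.card_image_of_injOn (card_filter_lt_injOn s), Finset.card_range]

theorem filter_lt_erase (s : Finset α) (x : α) :
    (s.erase x).filter (fun y => y < x) = s.filter fun y => y < x := by
  ext y
  simp only [Finset.mem_filter, Finset.mem_erase]
  exact ⟨fun h => ⟨h.1.2, h.2⟩, fun h => ⟨⟨h.2.ne, h.1⟩, h.2⟩⟩

theorem card_filter_not_lt_erase {s : Finset α} {x : α} (hx : x ∈ s) :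
    ((s.erase x).filter fun y => ¬ y < x).card = s.card - 1 - (s.filter fun y => y < x).card := by
  have := Finset.card_filter_add_card_filter_not (s := s.erase x) (fun y => y < x)
  rw [filter_lt_erase, Finset.card_erase_of_mem hx] at this
  omega

/-- The pivot has uniform rank j, both sublists are uniformly ordered, and the sizes j and n - 1 - j
have the same distribution, whence the factor 2. -/
theorem orderAvg_pivot_split {s : Finset α} (hs : s.Nonempty) (f : ℝ) (g : List α → ℝ)
    (Φ : List α → ℝ) (hΦ : ∀ x l, Φ (x :: l) = f + g (l.filter fun y => y < x)
      + g (l.filter fun y => ¬ y < x)) (γ : ℕ → ℝ)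
    (hγ : ∀ x ∈ s, ∀ t ⊆ s.erase x, orderAvg t g = γ t.card) :
    orderAvg s Φ = f + 2 * (s.card : ℝ)⁻¹ * ∑ j ∈ Finset.range s.card, γ j := by
  have hs0 : (s.card : ℝ) ≠ 0 := by exact_mod_cast hs.card_pos.ne'
  rw [orderAvg_eq hs]
  have h1 : ∀ x ∈ s, orderAvg (s.erase x) (fun l => Φ (x :: l)) =
      f + γ (s.filter fun y => y < x).card + γ (s.card - 1 - (s.filter fun y => y < x).card) := by
    intro x hx
    simp only [hΦ]
    rw [orderAvg_add, orderAvg_add, orderAvg_const, orderAvg_filter _ (fun y => y < x),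
      orderAvg_filter _ (fun y => ¬ y < x), hγ x hx _ (Finset.filter_subset _ _),
      hγ x hx _ (Finset.filter_subset _ _), card_filter_not_lt_erase hx, filter_lt_erase]
  rw [Finset.sum_congr rfl h1, sum_rank s (fun j => f + γ j + γ (s.card - 1 - j)),
    Finset.sum_add_distrib, Finset.sum_add_distrib, Finset.sum_range_reflect]
  simp only [Finset.sum_const, Finset.card_range, nsmul_eq_mul]
  field_simp
  ring

theorem orderAvg_keyCount (s : Finset α) :
    orderAvg s (fun l => (keyCount l : ℝ)) = keyMean s.card := by
  induction hn : s.card using Nat.strong_induction_on generalizing s with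
  | _ n ih =>
    subst hn
    rcases s.eq_empty_or_nonempty with rfl | hs
    · simp [orderAvg_empty, keyCount_nil, keyMean_zero]
    · have hs0 : (s.card : ℝ) ≠ 0 := by exact_mod_cast hs.card_pos.ne'
      have h1 : orderAvg s (fun l => (keyCount l : ℝ) - (l.length - 1)) =
          0 + 2 * (s.card : ℝ)⁻¹ * ∑ j ∈ Finset.range s.card, keyMean j := by
        refine orderAvg_pivot_split hs 0 (fun l => (keyCount l : ℝ)) _ ?_ _ ?_
        · intro x l
          rw [keyCount_cons]
          push_cast [List.length_cons]
          ring
        · intro x hx t ht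
          refine ih _ ?_ t rfl
          exact (Finset.card_le_card ht).trans_lt (Finset.card_erase_lt_of_mem hx)
      have h2 : orderAvg s (fun l => (keyCount l : ℝ) - (l.length - 1)) =
          orderAvg s (fun l => (keyCount l : ℝ)) - (s.card - 1) := by
        rw [orderAvg_sub]
        congr 1
        rw [orderAvg_congr (Ψ := fun _ => (s.card : ℝ) - 1), orderAvg_const]
        intro l hl
        rw [hl.length]
      have h3 := sum_keyMean s.card
      rw [h2] at h1
      have h4 : orderAvg s (fun l => (keyCount l : ℝ)) = (s.card - 1) +
        (s.card : ℝ)⁻¹ * (2 * ∑ j ∈ Finset.range s.card, keyMean j) := by linarith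
      rw [h4, h3]
      field_simp
      ring

theorem orderAvg_gapSquares (s : Finset α) : orderAvg s gapSquares = gapSquaresMean s.card := by
  induction hn : s.card using Nat.strong_induction_on generalizing s with
  | _ n ih =>
    subst hn
    rcases s.eq_empty_or_nonempty with rfl | hs
    · simp [orderAvg_empty, gapSquares_nil, gapSquaresMean_zero]
    · have hs0 : (s.card : ℝ) ≠ 0 := by exact_mod_cast hs.card_pos.ne'
      have h1 : orderAvg s gapSquares = 0 + 2 * (s.card : ℝ)⁻¹ * ∑ j ∈ Finset.range s.card,
          (gapSquaresMean j + 2 * keyMean j + 5 * j + 1) := by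
        refine orderAvg_pivot_split hs 0
          (fun l => gapSquares l + 2 * keyCount l + 5 * l.length + 1) _ ?_ _ ?_
        · intro x l
          rw [gapSquares_cons]
          ring
        · intro x hx t ht
          rw [orderAvg_add, orderAvg_add, orderAvg_add, orderAvg_const_mul, orderAvg_const,
            orderAvg_keyCount,
            ih _ ((Finset.card_le_card ht).trans_lt (Finset.card_erase_lt_of_mem hx)) t rfl]
          congr 2
          rw [orderAvg_congr (Ψ := fun _ => 5 * (t.card : ℝ)), orderAvg_const]
          intro l hl
          rw [hl.length]
      have h3 := sum_gapSquaresMean s.card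
      rw [h1, zero_add, mul_comm (2 : ℝ), mul_assoc, h3]
      field_simp

/-- The centred number of key comparisons. -/
noncomputable def keyDev (l : List α) : ℝ := keyCount l - keyMean l.length

theorem keyDev_nil : keyDev ([] : List α) = 0 := by simp [keyDev, keyCount_nil, keyMean_zero]

theorem orderAvg_keyDev (s : Finset α) : orderAvg s keyDev = 0 := by
  have : orderAvg s keyDev = orderAvg s (fun l => (keyCount l : ℝ) - keyMean s.card) :=
    orderAvg_congr fun l hl => by rw [keyDev, hl.length]
  rw [this, orderAvg_sub, orderAvg_const, orderAvg_keyCount, sub_self]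

end Moments

/-! ### Filtering commutes with relabelling. -/

section FilterMap

theorem filter_map_of_iff {α : Type*} {f : α → α} {l : List α} {p : α → Prop} [DecidablePred p]
    (h : ∀ y ∈ l, (p (f y) ↔ p y)) : (l.map f).filter p = (l.filter p).map f := by
  rw [filter_map_comp]
  congr 1
  exact List.filter_congr fun y hy => by simp [h y hy]

theorem length_filter_map {α : Type*} {f : α → α} {l : List α} {p : α → Prop} [DecidablePred p]
    (h : ∀ y ∈ l, (p (f y) ↔ p y)) :
    ((l.map f).filter p).length = (l.filter p).length := by
  rw [filter_map_of_iff h, List.length_map]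

end FilterMap

/-! ### The martingale of normalized key comparisons. -/

section Martingale

variable {α : Type*} [LinearOrder α]

/-- Removing one or another element of `p` from a finite set leaves two sets that correspond to
each other by a map preserving `p` and the order among the elements of `p`. -/
theorem exists_pattern_map (s : Finset α) (p : α → Prop) [DecidablePred p] {x x' : α}
    (hx : x ∈ s) (hx' : x' ∈ s) (hpx : p x) (hpx' : p x') :
    ∃ f : α → α, Set.InjOn f (s.erase x) ∧ (s.erase x).image f = s.erase x' ∧
      (∀ y ∈ s.erase x, (p (f y) ↔ p y)) ∧
      (∀ y ∈ s.erase x, ∀ z ∈ s.erase x, p y → p z → (y < z ↔ f y < f z)) := by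
  set A := (s.filter p).erase x with hA
  set B := (s.filter p).erase x' with hB
  have hAc : A.card = (s.filter p).card - 1 := Finset.card_erase_of_mem (by simp [hx, hpx])
  have hBc : B.card = (s.filter p).card - 1 := Finset.card_erase_of_mem (by simp [hx', hpx'])
  -- The remaining elements of `p` are matched by rank; all other elements stay fixed.
  let e : A ≃o B := (A.orderIsoOfFin hAc).symm.trans (B.orderIsoOfFin hBc)
  let f : α → α := fun y => if h : y ∈ A then (e ⟨y, h⟩ : α) else y
  have fA : ∀ y (h : y ∈ A), f y = e ⟨y, h⟩ := fun y h => by simp only [f, dif_pos h]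
  have fn : ∀ y, y ∉ A → f y = y := fun y h => by simp only [f, dif_neg h]
  have memA : ∀ y ∈ s.erase x, (y ∈ A ↔ p y) := fun y hy => by
    simp only [hA, Finset.mem_erase, Finset.mem_filter] at hy ⊢; tauto
  have hBp : ∀ b : B, p b ∧ (b : α) ∈ s.erase x' := fun b => by
    have := b.2
    simp only [hB, Finset.mem_erase, Finset.mem_filter] at this ⊢; tauto
  have hp : ∀ y ∈ s.erase x, (p (f y) ↔ p y) := by
    intro y hy
    by_cases h : y ∈ A
    · rw [fA y h]; exact ⟨fun _ => (memA y hy).1 h, fun _ => (hBp _).1⟩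
    · rw [fn y h]
  have hinj : Set.InjOn f (s.erase x) := by
    intro y hy z hz hyz
    by_cases h : y ∈ A <;> by_cases h' : z ∈ A
    · rw [fA y h, fA z h'] at hyz
      have := e.injective (Subtype.ext hyz)
      simpa using this
    · exfalso
      have h1 := (hp y hy).2 ((memA y hy).1 h)
      rw [hyz] at h1
      exact h' ((memA z hz).2 ((hp z hz).1 h1))
    · exfalso
      have h1 := (hp z hz).2 ((memA z hz).1 h')
      rw [← hyz] at h1
      exact h ((memA y hy).2 ((hp y hy).1 h1))
    · rwa [fn y h, fn z h'] at hyz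
  refine ⟨f, hinj, ?_, hp, ?_⟩
  · apply Finset.eq_of_subset_of_card_le
    · intro z hz
      obtain ⟨y, hy, rfl⟩ := Finset.mem_image.1 hz
      by_cases h : y ∈ A
      · rw [fA y h]; exact (hBp _).2
      · rw [fn y h]
        have h2 : ¬ p y := fun h' => h ((memA y hy).2 h')
        exact Finset.mem_erase.2 ⟨fun e => h2 (e ▸ hpx'), (Finset.mem_erase.1 hy).2⟩
    · rw [Finset.card_image_of_injOn hinj, Finset.card_erase_of_mem hx,
        Finset.card_erase_of_mem hx']
  · intro y hy z hz hpy hpz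
    rw [fA y ((memA y hy).2 hpy), fA z ((memA z hz).2 hpz), Subtype.coe_lt_coe, e.lt_iff_lt,
      Subtype.mk_lt_mk]

/-- A functional depends only on the relative order of the elements of `p` and on the positions
that they occupy. -/
def PatternInvariant (p : α → Prop) (Φ : List α → ℝ) : Prop :=
  ∀ (f : α → α) (l : List α), (∀ y ∈ l, (p (f y) ↔ p y)) →
    (∀ y ∈ l, ∀ z ∈ l, p y → p z → (y < z ↔ f y < f z)) → Φ (l.map f) = Φ l

theorem keyCount_filter_map {f : α → α} {l : List α} {p : α → Prop} [DecidablePred p]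
    (h : ∀ y ∈ l, (p (f y) ↔ p y))
    (h' : ∀ y ∈ l, ∀ z ∈ l, p y → p z → (y < z ↔ f y < f z)) :
    keyCount ((l.map f).filter p) = keyCount (l.filter p) := by
  rw [filter_map_of_iff h, keyCount_map_congr f id, List.map_id]
  intro i hi j hj
  simp only [List.mem_filter, decide_eq_true_eq] at hi hj
  exact (h' i hi.1 j hj.1 hi.2 hj.2).symm

theorem gapDepth_filter_map {f : α → α} {l : List α} {p : α → Prop} [DecidablePred p]
    (h : ∀ y ∈ l, (p (f y) ↔ p y))
    (h' : ∀ y ∈ l, ∀ z ∈ l, p y → p z → (y < z ↔ f y < f z)) (r : ℕ) :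
    gapDepth ((l.map f).filter p) r = gapDepth (l.filter p) r := by
  rw [filter_map_of_iff h, gapDepth_map_congr f id, List.map_id]
  intro i hi j hj
  simp only [List.mem_filter, decide_eq_true_eq] at hi hj
  exact (h' i hi.1 j hj.1 hi.2 hj.2).symm

theorem PatternInvariant.take {p : α → Prop} {Φ : List α → ℝ} (h : PatternInvariant p Φ) (m : ℕ) :
    PatternInvariant p fun l => Φ (l.take m) := by
  intro f l h1 h2
  simp only
  rw [← List.map_take, h f]
  · exact fun y hy => h1 y (List.mem_of_mem_take hy)
  · exact fun y hy z hz => h2 y (List.mem_of_mem_take hy) z (List.mem_of_mem_take hz)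

/-- The rank of an element of `p` that arrives last is uniform, independently of the pattern formed
by the other elements. -/
theorem sum_orderAvg_rank (s : Finset α) (p : α → Prop) [DecidablePred p] (Φ : ℕ → List α → ℝ)
    (hΦ : ∀ r, PatternInvariant p (Φ r)) :
    ∑ x ∈ s.filter p, orderAvg (s.erase x) (Φ ((s.filter p).filter fun y => y < x).card) =
      ∑ x ∈ s.filter p, orderAvg (s.erase x)
        (fun l => ((s.filter p).card : ℝ)⁻¹ * ∑ r ∈ Finset.range (s.filter p).card, Φ r l) := by
  rcases (s.filter p).eq_empty_or_nonempty with h0 | ⟨x₀, hx₀⟩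
  · simp [h0]
  · have hc : ((s.filter p).card : ℝ) ≠ 0 := by
      exact_mod_cast (Finset.card_pos.2 ⟨x₀, hx₀⟩).ne'
    have hx₀' := Finset.mem_filter.1 hx₀
    -- By invariance the average for a fixed rank does not depend on which element of `p` is
    -- removed. As x varies over `s.filter p`, its rank takes each value once.
    have h1 : ∀ x ∈ s.filter p, ∀ r, orderAvg (s.erase x) (Φ r) = orderAvg (s.erase x₀) (Φ r) := by
      intro x hx r
      have hx' := Finset.mem_filter.1 hx
      obtain ⟨f, hf1, hf2, hf3, hf4⟩ :=
        exists_pattern_map s p hx'.1 hx₀'.1 hx'.2 hx₀'.2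
      rw [← hf2, orderAvg_image _ f hf1]
      refine orderAvg_congr fun l hl => ?_
      rw [hΦ r f l]
      · exact fun y hy => hf3 y (hl.mem.1 hy)
      · exact fun y hy z hz => hf4 y (hl.mem.1 hy) z (hl.mem.1 hz)
    rw [Finset.sum_congr rfl fun x hx => h1 x hx _,
      sum_rank (s.filter p) (fun r => orderAvg (s.erase x₀) (Φ r))]
    have h2 : ∀ x ∈ s.filter p, orderAvg (s.erase x) (fun l => ((s.filter p).card : ℝ)⁻¹ *
        ∑ r ∈ Finset.range (s.filter p).card, Φ r l) = ((s.filter p).card : ℝ)⁻¹ *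
        ∑ r ∈ Finset.range (s.filter p).card, orderAvg (s.erase x₀) (Φ r) := by
      intro x hx
      rw [orderAvg_const_mul, orderAvg_sum]
      congr 1
      exact Finset.sum_congr rfl fun r _ => h1 x hx r
    rw [Finset.sum_congr rfl h2, Finset.sum_const, nsmul_eq_mul]
    field_simp

theorem card_filter_lt_of_isOrdering {s : Finset α} {p : α → Prop} [DecidablePred p] {x : α}
    {l : List α} (hl : IsOrdering (s.erase x) l) :
    ((l.filter p).filter fun y => y < x).length =
      ((s.filter p).filter fun y => y < x).card := by
  rw [((hl.filter p).filter _).length, Finset.filter_erase, filter_lt_erase]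

theorem length_filter_of_isOrdering_erase {s : Finset α} {p : α → Prop} [DecidablePred p] {x : α}
    (hx : x ∈ s) (hp : p x) {l : List α} (hl : IsOrdering (s.erase x) l) :
    (l.filter p).length + 1 = (s.filter p).card := by
  have hx' : x ∈ s.filter p := by simp [hx, hp]
  rw [(hl.filter p).length, Finset.filter_erase, Finset.card_erase_of_mem hx']
  have := Finset.card_pos.2 ⟨x, hx'⟩
  omega

/-- Add the last key. Given the others it falls into each of the n + 1 gaps with equal probability,
so the first two moments of its cost come from `sum_gapDepth` and `gapSquares`. -/
theorem orderAvg_keyDev_sq (s : Finset α) :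
    orderAvg s (fun l => keyDev l ^ 2) = keyVar s.card := by
  induction hn : s.card generalizing s with
  | zero =>
    rw [Finset.card_eq_zero.1 hn, orderAvg_empty]
    simp [keyDev_nil, keyVar_zero]
  | succ n ih =>
    have hs : s.Nonempty := Finset.card_pos.1 (by omega)
    have hn0 : (n : ℝ) + 1 ≠ 0 := by positivity
    rw [orderAvg_eq_append hs]
    set δ := keyMean (n + 1) - keyMean n with hδ
    let Φ : ℕ → List α → ℝ := fun r l =>
      ((keyCount (l.filter fun _ => True) : ℝ) + gapDepth (l.filter fun _ => True) r
        - keyMean (n + 1)) ^ 2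
    have hΦ : ∀ r, PatternInvariant (fun _ => True) (Φ r) := by
      intro r f l h1 h2
      simp only [Φ]
      rw [keyCount_filter_map h1 h2, gapDepth_filter_map h1 h2]
    have h1 := sum_orderAvg_rank s (fun _ => True) Φ hΦ
    simp only [Finset.filter_true] at h1
    have h2 : ∀ x ∈ s, orderAvg (s.erase x) (fun l => keyDev (l ++ [x]) ^ 2) =
        orderAvg (s.erase x) (Φ (s.filter fun y => y < x).card) := by
      intro x hx
      refine orderAvg_congr fun l hl => ?_
      have hxl : x ∉ l := fun h => by simpa using hl.mem.1 h
      have hlen : (l ++ [x]).length = n + 1 := by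
        rw [List.length_append, hl.length, Finset.card_erase_of_mem hx, hn]; rfl
      have hrank : (l.filter fun y => y < x).length = (s.filter fun y => y < x).card := by
        rw [(hl.filter _).length, filter_lt_erase]
      simp only [Φ, decide_true, List.filter_true]
      rw [keyDev, hlen, keyCount_append_singleton l x hxl, hrank]
      push_cast
      rfl
    have h3 : ∀ x ∈ s, orderAvg (s.erase x) (fun l => ((s.card : ℕ) : ℝ)⁻¹ *
        ∑ r ∈ Finset.range s.card, Φ r l) = keyVar (n + 1) := by
      intro x hx
      have hcx : (s.erase x).card = n := by rw [Finset.card_erase_of_mem hx, hn]; rfl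
      have h4 : orderAvg (s.erase x) (fun l => ((s.card : ℕ) : ℝ)⁻¹ *
          ∑ r ∈ Finset.range s.card, Φ r l) = orderAvg (s.erase x) (fun l =>
            ((n + 3) / (n + 1) : ℝ) * keyDev l ^ 2 + (2 * (keyMean n + 2 * n) / (n + 1) - 2 * δ
              - 2 * δ / (n + 1)) * keyDev l
            + (1 / (n + 1) : ℝ) * gapSquares l
            + (δ ^ 2 - 2 * δ * (keyMean n + 2 * n) / (n + 1))) := by
        refine orderAvg_congr fun l hl => ?_
        have hlen : l.length = n := by rw [hl.length, hcx]
        have e1 := sum_gapDepth l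
        have e2 : gapSquares l = ∑ r ∈ Finset.range (n + 1), (gapDepth l r : ℝ) ^ 2 := by
          rw [gapSquares, hlen]
        rw [hlen] at e1
        rw [hn, e2]
        simp only [Φ, decide_true, List.filter_true]
        have e3 : ∀ r, ((keyCount l : ℝ) + gapDepth l r - keyMean (n + 1)) ^ 2 =
            (gapDepth l r : ℝ) ^ 2 + (2 * (keyDev l - δ)) * gapDepth l r
              + (keyDev l - δ) ^ 2 := by
          intro r
          rw [keyDev, hlen, hδ]; ring
        simp only [e3, Finset.sum_add_distrib, ← Finset.mul_sum, e1]
        have e4 : (keyCount l : ℝ) = keyDev l + keyMean n := by rw [keyDev, hlen]; ring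
        rw [e4]
        simp only [Finset.sum_const, Finset.card_range, nsmul_eq_mul]
        push_cast
        field_simp
        ring
      rw [h4, orderAvg_add, orderAvg_add, orderAvg_add, orderAvg_const, orderAvg_const_mul,
        orderAvg_const_mul, orderAvg_const_mul, ih _ hcx, orderAvg_gapSquares, hcx,
        orderAvg_keyDev, keyVar_succ, ← hδ]
      -- The expected depth of a uniform gap, averaged over orderings, is the increment δ of the
      -- mean.
      have h5 : keyMean n + 2 * n = (n + 1) * δ := by
        rw [hδ, keyMean_succ']; field_simp; ring
      rw [h5]
      field_simp
      ring
    rw [Finset.sum_congr rfl h2, h1, Finset.sum_congr rfl h3, Finset.sum_const, nsmul_eq_mul, hn]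
    push_cast
    field_simp

/-- The normalized number of key comparisons between keys in `p`. -/
noncomputable def keyRatio (p : α → Prop) [DecidablePred p] (l : List α) : ℝ :=
  keyDev (l.filter p) / ((l.filter p).length + 1)

theorem keyRatio_patternInvariant (p : α → Prop) [DecidablePred p] :
    PatternInvariant p (keyRatio p) := by
  intro f l h1 h2
  rw [keyRatio, keyRatio, keyDev, keyDev, keyCount_filter_map h1 h2, length_filter_map h1]

/-- The martingale property. With c earlier keys in `p`, averaging over the c + 1 gaps multiplies
the centred count by (c + 2)/(c + 1), which the denominators c + 1 and c + 2 absorb. The test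
functional `G` may depend on the whole pattern of earlier keys. -/
theorem sum_orderAvg_keyRatio_append (s : Finset α) (p : α → Prop) [DecidablePred p]
    (G : List α → ℝ) (hG : PatternInvariant p G) :
    ∑ x ∈ s.filter p, orderAvg (s.erase x) (fun l => keyRatio p (l ++ [x]) * G l) =
      ∑ x ∈ s.filter p, orderAvg (s.erase x) (fun l => keyRatio p l * G l) := by
  set q := (s.filter p).card with hq
  let Φ : ℕ → List α → ℝ := fun r l =>
    ((keyCount (l.filter p) : ℝ) + gapDepth (l.filter p) r - keyMean q) / (q + 1) * G l
  have hΦ : ∀ r, PatternInvariant p (Φ r) := by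
    intro r f l h1 h2
    simp only [Φ]
    rw [keyCount_filter_map h1 h2, gapDepth_filter_map h1 h2, hG f l h1 h2]
  have h1 := sum_orderAvg_rank s p Φ hΦ
  rw [Finset.sum_congr rfl, h1]
  · refine Finset.sum_congr rfl fun x hx => orderAvg_congr fun l hl => ?_
    have hx' := Finset.mem_filter.1 hx
    have hlen := length_filter_of_isOrdering_erase hx'.1 hx'.2 hl
    rw [← hq] at hlen ⊢
    simp only [Φ, ← Finset.sum_mul, ← Finset.sum_div]
    rw [keyRatio, keyDev]
    set c := (l.filter p).length with hc
    have e1 := sum_gapDepth (l.filter p)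
    rw [← hc] at e1
    have hc1 : (c : ℝ) + 1 ≠ 0 := by positivity
    have hc2 : (c : ℝ) + 1 + 1 ≠ 0 := by positivity
    rw [← hlen]
    simp only [Finset.sum_sub_distrib, Finset.sum_add_distrib, e1]
    simp only [Finset.sum_const, Finset.card_range, nsmul_eq_mul]
    rw [keyMean_succ']
    push_cast
    field_simp
    ring
  · intro x hx
    refine orderAvg_congr fun l hl => ?_
    have hx' := Finset.mem_filter.1 hx
    have hlen := length_filter_of_isOrdering_erase hx'.1 hx'.2 hl
    rw [← hq] at hlen
    have hxl : x ∉ l.filter p := fun h => by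
      simpa using hl.mem.1 (List.mem_of_mem_filter h)
    have e1 : (l ++ [x]).filter p = l.filter p ++ [x] := by
      rw [List.filter_append]; simp [hx'.2]
    simp only [Φ]
    rw [keyRatio, keyDev, e1, keyCount_append_singleton _ _ hxl, card_filter_lt_of_isOrdering hl,
      List.length_append, List.length_singleton, hlen]
    push_cast
    rfl

/-- Martingale orthogonality, by removing last keys until m are left; a last key outside `p` does
not change `keyRatio`. -/
theorem orderAvg_keyRatio_mul_take (s : Finset α) (p : α → Prop) [DecidablePred p]
    (m : ℕ) (hm : m ≤ s.card) :
    orderAvg s (fun l => keyRatio p l * keyRatio p (l.take m)) =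
      orderAvg s (fun l => keyRatio p (l.take m) ^ 2) := by
  induction hn : s.card using Nat.strong_induction_on generalizing s with
  | _ n ih =>
    subst hn
    rcases hm.eq_or_lt with rfl | hm
    · refine orderAvg_congr fun l hl => ?_
      rw [List.take_of_length_le hl.length.le, sq]
    · have hs : s.Nonempty := Finset.card_pos.1 (by omega)
      rw [orderAvg_eq_append hs, orderAvg_eq_append hs]
      congr 1
      have ht : ∀ x ∈ s, ∀ l, IsOrdering (s.erase x) l → (l ++ [x]).take m = l.take m := by
        intro x hx l hl
        apply List.take_append_of_le_length
        rw [hl.length, Finset.card_erase_of_mem hx]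
        omega
      have h1 : ∀ x ∈ s, orderAvg (s.erase x)
          (fun l => keyRatio p (l ++ [x]) * keyRatio p ((l ++ [x]).take m)) =
          orderAvg (s.erase x) (fun l => keyRatio p (l ++ [x]) * keyRatio p (l.take m)) :=
        fun x hx => orderAvg_congr fun l hl => by rw [ht x hx l hl]
      have h2 : ∀ x ∈ s, orderAvg (s.erase x) (fun l => keyRatio p ((l ++ [x]).take m) ^ 2) =
          orderAvg (s.erase x) (fun l => keyRatio p l * keyRatio p (l.take m)) := by
        intro x hx
        have hc := Finset.card_erase_of_mem hx
        rw [ih _ (Finset.card_erase_lt_of_mem hx) _ (by omega) rfl]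
        exact orderAvg_congr fun l hl => by rw [ht x hx l hl]
      rw [Finset.sum_congr rfl h1, Finset.sum_congr rfl h2,
        ← Finset.sum_filter_add_sum_filter_not s p,
        ← Finset.sum_filter_add_sum_filter_not s p (fun x => orderAvg (s.erase x) _),
        sum_orderAvg_keyRatio_append s p (fun l => keyRatio p (l.take m))
          ((keyRatio_patternInvariant p).take m)]
      congr 1
      refine Finset.sum_congr rfl fun x hx => orderAvg_congr fun l hl => ?_
      have : (l ++ [x]).filter p = l.filter p := by
        rw [List.filter_append]; simp [(Finset.mem_filter.1 hx).2]
      rw [keyRatio, this, ← keyRatio]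

/-- Given which m keys come first, their order is uniform. Last elements are removed one by one. -/
theorem orderAvg_take_congr (s : Finset α) (m : ℕ) (hm : m ≤ s.card) {Ψ Θ : List α → ℝ}
    (h : ∀ t : Finset α, t.card = m → orderAvg t Ψ = orderAvg t Θ) :
    orderAvg s (fun l => Ψ (l.take m)) = orderAvg s (fun l => Θ (l.take m)) := by
  induction hn : s.card using Nat.strong_induction_on generalizing s with
  | _ n ih =>
    subst hn
    rcases hm.eq_or_lt with rfl | hm
    · have : ∀ Ξ : List α → ℝ, orderAvg s (fun l => Ξ (l.take s.card)) = orderAvg s Ξ :=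
        fun Ξ => orderAvg_congr fun l hl => by rw [List.take_of_length_le hl.length.le]
      rw [this, this, h s rfl]
    · have hs : s.Nonempty := Finset.card_pos.1 (by omega)
      rw [orderAvg_eq_append hs, orderAvg_eq_append hs]
      congr 1
      refine Finset.sum_congr rfl fun x hx => ?_
      have ht : ∀ Ξ : List α → ℝ, orderAvg (s.erase x) (fun l => Ξ ((l ++ [x]).take m)) =
          orderAvg (s.erase x) (fun l => Ξ (l.take m)) := by
        refine fun Ξ => orderAvg_congr fun l hl => ?_
        rw [List.take_append_of_le_length]
        rw [hl.length, Finset.card_erase_of_mem hx]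
        omega
      rw [ht, ht, ih _ (Finset.card_erase_lt_of_mem hx) _ _ rfl]
      rw [Finset.card_erase_of_mem hx]
      omega

/-- The variance of the normalized number of key comparisons for `n` keys. -/
noncomputable def ratioVar (n : ℕ) : ℝ := keyVar n / (n + 1) ^ 2

/-- The weight `g` is constant over the orderings of a given set. It will be 1, (n + 1)⁻² or ((n +
1)/t - p_w)² (n + 1)⁻². -/
theorem orderAvg_mul_keyDev_filter_sq (s : Finset α) (p : α → Prop) [DecidablePred p]
    (g : ℕ → ℝ) :
    orderAvg s (fun l => g (l.filter p).length * keyDev (l.filter p) ^ 2) =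
      orderAvg s (fun l => g (l.filter p).length * keyVar (l.filter p).length) := by
  rw [orderAvg_filter s p (fun l => g l.length * keyDev l ^ 2),
    orderAvg_filter s p (fun l => g l.length * keyVar l.length)]
  generalize s.filter p = t
  have h1 : orderAvg t (fun l => g l.length * keyDev l ^ 2) =
      orderAvg t (fun l => g t.card * keyDev l ^ 2) :=
    orderAvg_congr fun l hl => by rw [hl.length]
  have h2 : orderAvg t (fun l => g l.length * keyVar l.length) =
      orderAvg t (fun _ => g t.card * keyVar t.card) :=
    orderAvg_congr fun l hl => by rw [hl.length]
  rw [h1, h2, orderAvg_const_mul, orderAvg_const, orderAvg_keyDev_sq]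

theorem orderAvg_keyRatio_sq (s : Finset α) (p : α → Prop) [DecidablePred p] :
    orderAvg s (fun l => keyRatio p l ^ 2) =
      orderAvg s (fun l => ratioVar (l.filter p).length) := by
  have := orderAvg_mul_keyDev_filter_sq s p (fun n => (((n : ℝ) + 1) ^ 2)⁻¹)
  simpa only [keyRatio, ratioVar, div_eq_inv_mul, mul_pow, inv_pow] using this

theorem orderAvg_keyRatio_sub_sq (s : Finset α) (p : α → Prop) [DecidablePred p]
    (m : ℕ) (hm : m ≤ s.card) :
    orderAvg s (fun l => (keyRatio p l - keyRatio p (l.take m)) ^ 2) =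
      orderAvg s (fun l =>
        ratioVar (l.filter p).length - ratioVar ((l.take m).filter p).length) := by
  have h1 : orderAvg s (fun l => (keyRatio p l - keyRatio p (l.take m)) ^ 2) =
      orderAvg s (fun l => keyRatio p l ^ 2) -
        2 * orderAvg s (fun l => keyRatio p l * keyRatio p (l.take m)) +
        orderAvg s (fun l => keyRatio p (l.take m) ^ 2) := by
    rw [← orderAvg_const_mul, ← orderAvg_sub, ← orderAvg_add]
    exact orderAvg_congr fun l _ => by ring
  have h2 : orderAvg s (fun l => keyRatio p (l.take m) ^ 2) =
      orderAvg s (fun l => ratioVar ((l.take m).filter p).length) := by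
    have h3 : ∀ t : Finset α, t.card = m → orderAvg t (fun l => keyRatio p l ^ 2) =
        orderAvg t (fun l => ratioVar (l.filter p).length) := fun t _ => orderAvg_keyRatio_sq t p
    exact orderAvg_take_congr s m hm h3
  rw [h1, orderAvg_keyRatio_mul_take s p m hm,
    orderAvg_sub s (fun l => ratioVar (l.filter p).length)
      (fun l => ratioVar ((l.take m).filter p).length), ← orderAvg_keyRatio_sq]
  refine Eq.trans ?_ (congrArg _ h2)
  ring

/-- The variance of a martingale is nondecreasing: its increment is the second moment of a step. -/
theorem ratioVar_mono : Monotone ratioVar := by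
  refine monotone_nat_of_le_succ fun n => ?_
  have h := orderAvg_keyRatio_sub_sq (Finset.range (n + 1)) (fun _ => True) n (by simp)
  have h0 : 0 ≤ orderAvg (Finset.range (n + 1))
      (fun l => (keyRatio (fun _ => True) l - keyRatio (fun _ => True) (l.take n)) ^ 2) :=
    orderAvg_nonneg fun l _ => sq_nonneg _
  rw [h, orderAvg_congr (Ψ := fun _ => ratioVar (n + 1) - ratioVar n), orderAvg_const] at h0
  · linarith
  · intro l hl
    have := hl.length
    rw [Finset.card_range] at this
    simp [this]

end Martingale

/-! ### Convexity of the mean and Chebyshev's sum inequality. -/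

section Convexity

theorem harm_mono : Monotone harm := monotone_nat_of_le_succ fun n => by
  rw [harm_succ]
  have : (0 : ℝ) ≤ 1 / ((n : ℝ) + 1) := by positivity
  linarith

theorem keyMean_convex_aux (i j d : ℕ) (hij : i ≤ j) :
    keyMean (i + d) - keyMean i ≤ keyMean (j + d) - keyMean j := by
  induction d with
  | zero => simp
  | succ d ih =>
    rw [← add_assoc, ← add_assoc, keyMean_succ, keyMean_succ]
    have := harm_mono (show i + d + 1 ≤ j + d + 1 by omega)
    linarith

/-- Increments of `keyMean` are nondecreasing, so of two pairs with the same sum the more spread one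
has the larger total. -/
theorem keyMean_add_le {i j i' j' : ℕ} (h : i + j = i' + j') (hm : min i j ≤ min i' j') :
    keyMean i' + keyMean j' ≤ keyMean i + keyMean j := by
  wlog hij : i ≤ j generalizing i j
  · rw [add_comm (keyMean i)]
    exact this (by omega) (by omega) (by omega)
  have h1 : i ≤ i' := by omega
  have h2 : i ≤ j' := by omega
  obtain ⟨d, rfl⟩ := Nat.exists_eq_add_of_le h1
  have := keyMean_convex_aux i j' d h2
  rw [show j = j' + d by omega]
  linarith

/-- The deviation of the expected cost from its mean that is caused by a pivot of rank `j`. -/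
noncomputable def pivotToll (n j : ℕ) : ℝ :=
  (n : ℝ) - 1 + keyMean j + keyMean (n - 1 - j) - keyMean n

theorem sum_pivotToll (n : ℕ) : ∑ j ∈ Finset.range n, pivotToll n j = 0 := by
  have h := sum_keyMean n
  simp only [pivotToll, Finset.sum_sub_distrib, Finset.sum_add_distrib, Finset.sum_range_reflect]
  simp only [Finset.sum_const, Finset.card_range, nsmul_eq_mul]
  linarith

/-- The second factor is symmetric under j ↦ m - 1 - j, so the first may be symmetrized. By
convexity both are then nonincreasing in min(j, m - 1 - j), and Chebyshev's inequality applies; its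
lower bound is zero because the second factor sums to zero. -/
theorem sum_pivotToll_mul_nonneg {n a m : ℕ} (h : a + m ≤ n) :
    0 ≤ ∑ j ∈ Finset.range m, pivotToll n (a + j) * pivotToll m j := by
  rcases m.eq_zero_or_pos with rfl | hm
  · simp
  set f : ℕ → ℝ := fun j => pivotToll m j with hf
  set g : ℕ → ℝ := fun j => pivotToll n (a + j) + pivotToll n (a + (m - 1 - j)) with hg
  have h2 : 2 * ∑ j ∈ Finset.range m, pivotToll n (a + j) * pivotToll m j =
      ∑ j ∈ Finset.range m, g j * f j := by
    have h3 := Finset.sum_range_reflect (fun j => pivotToll n (a + j) * pivotToll m j) m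
    rw [two_mul]
    nth_rw 1 [← h3]
    rw [← Finset.sum_add_distrib]
    refine Finset.sum_congr rfl fun j hj => ?_
    have hj := Finset.mem_range.1 hj
    have : pivotToll m (m - 1 - j) = pivotToll m j := by
      rw [pivotToll, pivotToll, show m - 1 - (m - 1 - j) = j by omega]; ring
    simp only [hf, hg]
    rw [this]; ring
  have hmono : MonovaryOn g f (Finset.range m) := by
    have key : ∀ i < m, ∀ j < m, min j (m - 1 - j) ≤ min i (m - 1 - i) →
        f i ≤ f j ∧ g i ≤ g j := by
      intro i hi j hj hij
      constructor
      · have := keyMean_add_le (i := j) (j := m - 1 - j) (i' := i) (j' := m - 1 - i)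
          (by omega) hij
        simp only [hf, pivotToll]
        linarith
      · have h1 := keyMean_add_le (i := a + j) (j := a + (m - 1 - j)) (i' := a + i)
          (j' := a + (m - 1 - i)) (by omega) (by omega)
        have h2 := keyMean_add_le (i := n - 1 - (a + j)) (j := n - 1 - (a + (m - 1 - j)))
          (i' := n - 1 - (a + i)) (j' := n - 1 - (a + (m - 1 - i))) (by omega) (by omega)
        simp only [hg, pivotToll]
        linarith
    intro i hi j hj hij
    have hi := Finset.mem_range.1 hi
    have hj := Finset.mem_range.1 hj
    rcases le_total (min j (m - 1 - j)) (min i (m - 1 - i)) with h' | h'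
    · exact (key i hi j hj h').2
    · exact absurd (key j hj i hi h').1 (not_le.2 hij)
  have h4 := hmono.sum_mul_sum_le_card_mul_sum
  rw [hf, sum_pivotToll, mul_zero, ← hf, Finset.card_range, ← h2] at h4
  have hm' : (0 : ℝ) < m := by exact_mod_cast hm
  nlinarith [nonneg_of_mul_nonneg_right h4 hm']

end Convexity

/-! ### Nonnegative correlation and the variance lower bound. -/

section Covariance

variable {α ι : Type*} [LinearOrder α]

theorem keyDev_cons (x : α) (l : List α) : keyDev (x :: l) =
    pivotToll (l.length + 1) (l.filter fun y => y < x).length +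
      keyDev (l.filter fun y => y < x) + keyDev (l.filter fun y => ¬ y < x) := by
  have h := length_filter_add_length_filter_not l x
  rw [keyDev, keyDev, keyDev, keyCount_cons, pivotToll, List.length_cons,
    show l.length + 1 - 1 - (l.filter fun y => y < x).length =
      (l.filter fun y => ¬ y < x).length by omega]
  push_cast
  ring

theorem filter_comm {γ : Type*} (l : List γ) (p q : γ → Prop) [DecidablePred p]
    [DecidablePred q] : (l.filter p).filter q = (l.filter q).filter p := by
  rw [List.filter_filter, List.filter_filter]; simp only [Bool.and_comm]

/-- For a pivot outside `p` one sublist contains no element of `p` and contributes 0, so a single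
formula covers both cases. -/
theorem keyDev_filter_cons {p : α → Prop} [DecidablePred p] (hp : ConvexPred p) (x : α)
    (l : List α) : keyDev ((x :: l).filter p) =
    (if p x then pivotToll ((l.filter p).length + 1) ((l.filter p).filter fun y => y < x).length
      else 0) +
      keyDev ((l.filter fun y => y < x).filter p) +
      keyDev ((l.filter fun y => ¬ y < x).filter p) := by
  by_cases hx : p x
  · rw [List.filter_cons_of_pos (by simpa using hx), keyDev_cons, if_pos hx, filter_comm l p,
      filter_comm l p]
  · rw [List.filter_cons_of_neg (by simpa using hx), if_neg hx]
    rcases filter_lt_or_filter_not_lt hp hx l with ⟨h1, h2⟩ | ⟨h1, h2⟩ <;>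
      rw [h1, h2] <;> simp [keyDev_nil]

/-- The two sublists are ordered independently and all deviations have mean zero. Only the product
of the tolls and the two covariances within a sublist survive, and the latter are nonnegative by
assumption. -/
theorem orderAvg_pivot_cov {s : Finset α} (x : α) (C c : ℝ) (p : α → Prop) [DecidablePred p]
    (h1 : 0 ≤ orderAvg (s.filter fun y => y < x) fun l => keyDev l * keyDev (l.filter p))
    (h2 : 0 ≤ orderAvg (s.filter fun y => ¬ y < x) fun l => keyDev l * keyDev (l.filter p)) :
    C * c ≤ orderAvg s fun l =>
      (C + keyDev (l.filter fun y => y < x) + keyDev (l.filter fun y => ¬ y < x)) *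
      (c + keyDev ((l.filter fun y => y < x).filter p) +
        keyDev ((l.filter fun y => ¬ y < x).filter p)) := by
  have z : ∀ t : Finset α, orderAvg t (fun l => keyDev (l.filter p)) = 0 := fun t => by
    rw [orderAvg_filter t p, orderAvg_keyDev]
  have e1 := orderAvg_filter s (fun y => y < x) keyDev
  have e2 := orderAvg_filter s (fun y => ¬ y < x) keyDev
  have e3 := orderAvg_filter s (fun y => y < x) (fun l => keyDev (l.filter p))
  have e4 := orderAvg_filter s (fun y => ¬ y < x) (fun l => keyDev (l.filter p))
  have e5 := orderAvg_filter s (fun y => y < x) (fun l => keyDev l * keyDev (l.filter p))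
  have e6 := orderAvg_filter s (fun y => ¬ y < x) (fun l => keyDev l * keyDev (l.filter p))
  have e7 := orderAvg_filter_mul_filter s (fun y => y < x) (fun y => ¬ y < x)
    (fun y h => not_not.2 h) keyDev (fun l => keyDev (l.filter p))
  have e8 := orderAvg_filter_mul_filter s (fun y => y < x) (fun y => ¬ y < x)
    (fun y h => not_not.2 h) (fun l => keyDev (l.filter p)) keyDev
  rw [orderAvg_keyDev] at e1 e2
  rw [z] at e3 e4
  rw [orderAvg_keyDev, zero_mul] at e7
  rw [orderAvg_keyDev, mul_zero] at e8
  rw [← e5] at h1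
  rw [← e6] at h2
  have hexp : orderAvg s (fun l =>
      (C + keyDev (l.filter fun y => y < x) + keyDev (l.filter fun y => ¬ y < x)) *
      (c + keyDev ((l.filter fun y => y < x).filter p) +
        keyDev ((l.filter fun y => ¬ y < x).filter p))) =
      C * c + C * orderAvg s (fun l => keyDev ((l.filter fun y => y < x).filter p)) +
      C * orderAvg s (fun l => keyDev ((l.filter fun y => ¬ y < x).filter p)) +
      c * orderAvg s (fun l => keyDev (l.filter fun y => y < x)) +
      c * orderAvg s (fun l => keyDev (l.filter fun y => ¬ y < x)) +
      orderAvg s (fun l => keyDev (l.filter fun y => y < x) *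
        keyDev ((l.filter fun y => y < x).filter p)) +
      orderAvg s (fun l => keyDev (l.filter fun y => ¬ y < x) *
        keyDev ((l.filter fun y => ¬ y < x).filter p)) +
      orderAvg s (fun l => keyDev (l.filter fun y => y < x) *
        keyDev ((l.filter fun y => ¬ y < x).filter p)) +
      orderAvg s (fun l => keyDev ((l.filter fun y => y < x).filter p) *
        keyDev (l.filter fun y => ¬ y < x)) := by
    rw [← orderAvg_const s (C * c)]
    simp only [← orderAvg_const_mul, ← orderAvg_add]
    exact orderAvg_congr fun l _ => by ring
  rw [hexp, e1, e2, e3, e4, e7, e8]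
  linarith

/-- The key comparisons between all keys and the key comparisons between the keys of an interval
are nonnegatively correlated. -/
theorem orderAvg_keyDev_mul_filter_nonneg {p : α → Prop} [DecidablePred p] (hp : ConvexPred p)
    (s : Finset α) : 0 ≤ orderAvg s (fun l => keyDev l * keyDev (l.filter p)) := by
  induction hn : s.card using Nat.strong_induction_on generalizing s with
  | _ n ih =>
    subst hn
    rcases s.eq_empty_or_nonempty with rfl | hs
    · simp [orderAvg_empty, keyDev_nil]
    rw [orderAvg_eq hs]
    refine mul_nonneg (by positivity) ?_
    -- Conditioning on the pivot bounds the covariance below by the product of the tolls, the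
    -- interval having toll 0 when the pivot lies outside it.
    have h1 : ∀ x ∈ s, pivotToll s.card (s.filter fun y => y < x).card *
        (if p x then pivotToll (s.filter p).card ((s.filter p).filter fun y => y < x).card else 0) ≤
        orderAvg (s.erase x) (fun l => keyDev (x :: l) * keyDev ((x :: l).filter p)) := by
      intro x hx
      have hlt : ∀ t ⊆ s.erase x, t.card < s.card := fun t ht =>
        (Finset.card_le_card ht).trans_lt (Finset.card_erase_lt_of_mem hx)
      refine (orderAvg_pivot_cov (s := s.erase x) x _ _ p
        (ih _ (hlt _ (Finset.filter_subset _ _)) _ rfl)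
        (ih _ (hlt _ (Finset.filter_subset _ _)) _ rfl)).trans_eq ?_
      refine orderAvg_congr fun l hl => ?_
      have hcard : l.length + 1 = s.card := by
        rw [hl.length, Finset.card_erase_of_mem hx]
        have := hs.card_pos
        omega
      rw [keyDev_cons, keyDev_filter_cons hp, hcard, (hl.filter _).length, filter_lt_erase,
        card_filter_lt_of_isOrdering hl]
      congr 3
      by_cases hpx : p x
      · rw [if_pos hpx, if_pos hpx, length_filter_of_isOrdering_erase hx hpx hl]
      · rw [if_neg hpx, if_neg hpx]
    refine le_trans ?_ (Finset.sum_le_sum h1)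
    simp only [mul_ite, mul_zero]
    rw [← Finset.sum_filter]
    rcases (s.filter p).eq_empty_or_nonempty with h0 | ⟨x₀, hx₀⟩
    · rw [h0]; simp
    have hx₀' := Finset.mem_filter.1 hx₀
    -- By convexity `a` is the number of keys below the whole interval, whichever `x₀` is used;
    -- ranks in `s` are ranks in the interval shifted by `a`.
    set a := (s.filter fun y => ¬ p y ∧ y < x₀).card with ha
    have h2 : ∀ x ∈ s.filter p, (s.filter fun y => y < x).card =
        a + ((s.filter p).filter fun y => y < x).card := by
      intro x hx
      have hx' := Finset.mem_filter.1 hx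
      have e1 : (s.filter fun y => ¬ p y ∧ y < x₀) = s.filter fun y => ¬ p y ∧ y < x := by
        refine Finset.filter_congr fun y _ => and_congr_right fun hy => ?_
        constructor
        · intro h
          by_contra h'
          exact hy (hp x x₀ y hx'.2 hx₀'.2 (not_lt.1 h') h.le)
        · intro h
          by_contra h'
          exact hy (hp x₀ x y hx₀'.2 hx'.2 (not_lt.1 h') h.le)
      rw [ha, e1, ← Finset.card_filter_add_card_filter_not (s := s.filter fun y => y < x) p,
        add_comm]
      congr 2
      · rw [Finset.filter_filter]; simp only [and_comm]
      · rw [Finset.filter_filter, Finset.filter_filter]; simp only [and_comm]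
    have h3 : a + (s.filter p).card ≤ s.card := by
      rw [← Finset.card_filter_add_card_filter_not (s := s) p, add_comm, ha]
      gcongr
      exact fun h => h.1
    rw [Finset.sum_congr rfl fun x hx => by rw [h2 x hx],
      sum_rank (s.filter p) (fun j => pivotToll s.card (a + j) * pivotToll (s.filter p).card j)]
    exact sum_pivotToll_mul_nonneg h3

/-- Write the bracket as U + V with U = `keyDev` and use (U + V)² ≥ U² + 2UV; the average of UV is
nonnegative. The constant `c` is free because the global mean, not the conditional mean given `s`,
will be subtracted. -/
theorem keyVar_le_orderAvg (s : Finset α) (I : Finset ι) (p : ι → α → Prop)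
    [∀ i, DecidablePred (p i)] (hp : ∀ i ∈ I, ConvexPred (p i)) (c : ℝ) :
    keyVar s.card ≤ orderAvg s (fun l =>
      ((keyCount l : ℝ) + ∑ i ∈ I, (keyCount (l.filter (p i)) : ℝ) - c) ^ 2) := by
  set Z : ℝ := keyMean s.card + ∑ i ∈ I, keyMean (s.filter (p i)).card - c with hZ
  have h1 : orderAvg s (fun l => keyDev l ^ 2 + 2 * (∑ i ∈ I, keyDev l * keyDev (l.filter (p i)) +
      Z * keyDev l)) ≤ orderAvg s (fun l =>
      ((keyCount l : ℝ) + ∑ i ∈ I, (keyCount (l.filter (p i)) : ℝ) - c) ^ 2) := by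
    refine orderAvg_mono fun l hl => ?_
    have e1 : (keyCount l : ℝ) = keyDev l + keyMean s.card := by
      rw [keyDev, hl.length]; ring
    have e2 : ∀ i, (keyCount (l.filter (p i)) : ℝ) =
        keyDev (l.filter (p i)) + keyMean (s.filter (p i)).card := fun i => by
      rw [keyDev, (hl.filter (p i)).length]; ring
    rw [e1]
    simp only [e2, Finset.sum_add_distrib, ← Finset.mul_sum]
    have : keyDev l + keyMean s.card + (∑ i ∈ I, keyDev (l.filter (p i)) +
        ∑ i ∈ I, keyMean (s.filter (p i)).card) - c =
        keyDev l + (∑ i ∈ I, keyDev (l.filter (p i)) + Z) := by rw [hZ]; ring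
    rw [this]
    nlinarith [sq_nonneg (∑ i ∈ I, keyDev (l.filter (p i)) + Z)]
  refine le_trans ?_ h1
  rw [orderAvg_add, orderAvg_keyDev_sq, orderAvg_const_mul, orderAvg_add, orderAvg_const_mul,
    orderAvg_keyDev, orderAvg_sum]
  have := Finset.sum_nonneg fun i hi => orderAvg_keyDev_mul_filter_nonneg (hp i hi) s
  linarith

end Covariance

/-! ### Bounds and limits for the moments. -/

section Asymptotics

theorem harm_eq_harmonic (n : ℕ) : harm n = (harmonic n : ℝ) := by
  rw [harm, harmonic]
  push_cast
  exact Finset.sum_congr rfl fun i _ => one_div _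

theorem one_le_harm_succ (n : ℕ) : 1 ≤ harm (n + 1) := by
  have := harm_mono (show 1 ≤ n + 1 by omega)
  rw [harm_succ 0, harm_zero] at this
  simpa using this

theorem harm_succ_sub_one_le_log (n : ℕ) : harm (n + 1) - 1 ≤ Real.log (n + 1) := by
  have := harmonic_le_one_add_log (n + 1)
  rw [harm_eq_harmonic]
  push_cast at this
  linarith

theorem harm_succ_sub_one_le (n : ℕ) : harm (n + 1) - 1 ≤ n / 2 := by
  induction n with
  | zero => simp [harm_succ, harm_zero]
  | succ n ih =>
    rw [harm_succ (n + 1)]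
    have : 1 / (((n + 1 : ℕ) : ℝ) + 1) ≤ 1 / 2 := by
      apply one_div_le_one_div_of_le (by norm_num)
      push_cast
      have : (0 : ℝ) ≤ n := n.cast_nonneg
      linarith
    push_cast at this ⊢
    linarith

/-- Without an additive constant, so that Poincaré gives a variance of order r² even for small r.
Long prefixes, for which r = p_w t is small, require this. -/
theorem harm_succ_sub_one_sq_le (n : ℕ) : (harm (n + 1) - 1) ^ 2 ≤ n := by
  induction n with
  | zero => simp [harm_succ, harm_zero]
  | succ n ih =>
    have h1 := harm_succ_sub_one_le n
    have h0 : (0 : ℝ) ≤ n := n.cast_nonneg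
    rw [harm_succ (n + 1)]
    push_cast
    set u := harm (n + 1) - 1 with hu
    have e : harm (n + 1) + 1 / ((n : ℝ) + 1 + 1) - 1 = u + 1 / ((n : ℝ) + 1 + 1) := by
      rw [hu]; ring
    rw [e]
    set d := 1 / ((n : ℝ) + 1 + 1) with hd
    have hd0 : 0 < d := by positivity
    have hd1 : d * (n + 2) = 1 := by rw [hd]; field_simp; ring
    nlinarith [mul_le_mul_of_nonneg_left h1 hd0.le, mul_nonneg h0 hd0.le]

/-- An arbitrarily small slope, because log² n = o(n). This makes the conditional means negligible
in the limit. -/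
theorem exists_harm_sq_le {ε : ℝ} (hε : 0 < ε) :
    ∃ C : ℝ, 0 ≤ C ∧ ∀ n : ℕ, (harm (n + 1) - 1) ^ 2 ≤ ε * n + C := by
  have h := (Real.isLittleO_pow_log_id_atTop (n := 2)).def hε
  obtain ⟨x₀, hx₀⟩ := eventually_atTop.1 h
  obtain ⟨n₀, hn₀⟩ := exists_nat_ge x₀
  -- The term ε pays for the shift from n + 1 to n, and n₀ for all n ≤ n₀ by the cruder bound.
  refine ⟨ε + n₀, by positivity, fun n => ?_⟩
  rcases le_total n₀ n with hn | hn
  · have hn' : (n₀ : ℝ) ≤ n := by exact_mod_cast hn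
    have h1 := hx₀ ((n : ℝ) + 1) (by linarith)
    simp only [id, Real.norm_eq_abs] at h1
    rw [abs_of_nonneg (by positivity), abs_of_nonneg (by positivity)] at h1
    have h2 : (harm (n + 1) - 1) ^ 2 ≤ Real.log (n + 1) ^ 2 := by
      have := one_le_harm_succ n
      have := harm_succ_sub_one_le_log n
      gcongr
    have : (0 : ℝ) ≤ n₀ := n₀.cast_nonneg
    nlinarith
  · have hn' : (n : ℝ) ≤ n₀ := by exact_mod_cast hn
    have := harm_succ_sub_one_sq_le n
    have : 0 ≤ ε * n := by positivity
    linarith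

theorem keyMean_nonneg (n : ℕ) : 0 ≤ keyMean n := by
  induction n with
  | zero => rw [keyMean_zero]
  | succ n ih =>
    rw [keyMean_succ]
    have := one_le_harm_succ n
    linarith

theorem keyMean_le (n : ℕ) : keyMean n ≤ n * (n - 1) := by
  induction n with
  | zero => simp [keyMean_zero]
  | succ n ih =>
    rw [keyMean_succ]
    have := harm_succ_sub_one_le n
    push_cast
    nlinarith

theorem keyVar_nonneg (n : ℕ) : 0 ≤ keyVar n := by
  rw [← Finset.card_range n, ← orderAvg_keyDev_sq]
  exact orderAvg_nonneg fun _ _ => sq_nonneg _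

/-- The factor n(n - 1) vanishes for n ≤ 1 and has Poisson mean exactly r². The constant 40 is not
sharp. -/
theorem keyVar_le (n : ℕ) : keyVar n ≤ 40 * (n * (n - 1)) := by
  match n with
  | 0 => simp [keyVar_zero]
  | 1 => norm_num [keyVar, harm_succ, harmSq_succ, harm_zero, harmSq_zero]
  | n + 2 =>
    have h1 : 0 ≤ harm (n + 2) := Finset.sum_nonneg fun _ _ => by positivity
    have h2 : 0 ≤ harmSq (n + 2) := Finset.sum_nonneg fun _ _ => by positivity
    rw [keyVar]
    push_cast
    have h3 : 0 ≤ 4 * ((n : ℝ) + 2 + 1) ^ 2 * harmSq (n + 2) := by positivity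
    have h4 : 0 ≤ 2 * ((n : ℝ) + 2 + 1) * harm (n + 2) := by positivity
    have h5 : (0 : ℝ) ≤ n := n.cast_nonneg
    nlinarith

theorem ratioVar_nonneg (n : ℕ) : 0 ≤ ratioVar n := div_nonneg (keyVar_nonneg n) (by positivity)

theorem ratioVar_le (n : ℕ) : ratioVar n ≤ 40 := by
  have := keyVar_le n
  have h5 : (0 : ℝ) ≤ n := n.cast_nonneg
  rw [ratioVar, div_le_iff₀ (by positivity)]
  nlinarith

theorem tendsto_harmSq : Tendsto harmSq atTop (𝓝 (Real.pi ^ 2 / 6)) := by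
  have h := (hasSum_zeta_two.tendsto_sum_nat).comp (tendsto_add_atTop_nat 1)
  refine h.congr fun n => ?_
  rw [Function.comp_apply, Finset.sum_range_succ', harmSq]
  simp

theorem tendsto_harm_div : Tendsto (fun n : ℕ => harm n / ((n : ℝ) + 1)) atTop (𝓝 0) := by
  have h : Tendsto (fun n : ℕ => 2 / √((n : ℝ) + 1)) atTop (𝓝 0) := by
    refine Tendsto.div_atTop tendsto_const_nhds (Real.tendsto_sqrt_atTop.comp ?_)
    exact tendsto_atTop_add_const_right _ _ tendsto_natCast_atTop_atTop
  refine squeeze_zero (fun n => ?_) (fun n => ?_) h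
  · exact div_nonneg (Finset.sum_nonneg fun _ _ => by positivity) (by positivity)
  · have h1 := harm_mono (show n ≤ n + 1 by omega)
    have h2 : harm (n + 1) - 1 ≤ √((n : ℝ) + 1) := by
      apply Real.le_sqrt_of_sq_le
      have := harm_succ_sub_one_sq_le n
      linarith
    have h3 : 1 ≤ √((n : ℝ) + 1) := by
      rw [Real.one_le_sqrt]
      have : (0 : ℝ) ≤ n := n.cast_nonneg
      linarith
    have h4 : √((n : ℝ) + 1) * √((n : ℝ) + 1) = (n : ℝ) + 1 := Real.mul_self_sqrt (by positivity)
    rw [div_le_div_iff₀ (by positivity) (by positivity)]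
    nlinarith

theorem tendsto_ratioVar : Tendsto ratioVar atTop (𝓝 (7 - 2 / 3 * Real.pi ^ 2)) := by
  have h1 : Tendsto (fun n : ℕ => (n : ℝ) / ((n : ℝ) + 1)) atTop (𝓝 1) :=
    tendsto_natCast_div_add_atTop 1
  have h2 : Tendsto (fun n : ℕ => 1 / ((n : ℝ) + 1)) atTop (𝓝 0) :=
    tendsto_one_div_add_atTop_nhds_zero_nat
  have h := ((((h1.pow 2).const_mul 7).sub (tendsto_harmSq.const_mul 4)).sub
    (tendsto_harm_div.const_mul 2)).add ((h1.mul h2).const_mul 13)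
  have e : (7 : ℝ) * 1 ^ 2 - 4 * (Real.pi ^ 2 / 6) - 2 * 0 + 13 * (1 * 0) =
      7 - 2 / 3 * Real.pi ^ 2 := by ring
  rw [e] at h
  refine h.congr fun n => ?_
  rw [ratioVar, keyVar]
  have : (n : ℝ) + 1 ≠ 0 := by positivity
  field_simp

theorem limit_pos : 0 < 7 - 2 / 3 * Real.pi ^ 2 := by
  have := Real.pi_lt_d2
  have := Real.pi_pos
  nlinarith

end Asymptotics

/-! ### Prefixes and the decomposition of the cost by symbol position. -/

section Words

variable {A : Type*}

/-- The word `y` begins with `w`. -/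
def HasPrefix {k : ℕ} (w : Fin k → A) (y : Lex (ℕ → A)) : Prop := ∀ i : Fin k, ofLex y i = w i

theorem HasPrefix.unique {k : ℕ} {w w' : Fin k → A} {y : Lex (ℕ → A)} (h : HasPrefix w y)
    (h' : HasPrefix w' y) : w = w' := funext fun i => (h i).symm.trans (h' i)

/-- The first `n` words of a sequence. -/
def wordList (x : ℕ → ℕ → A) (n : ℕ) : List (Lex (ℕ → A)) :=
  (List.range n).map fun i => toLex (x i)

theorem length_wordList (x : ℕ → ℕ → A) (n : ℕ) : (wordList x n).length = n := by
  simp [wordList]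

theorem take_wordList (x : ℕ → ℕ → A) {m n : ℕ} (h : m ≤ n) :
    (wordList x n).take m = wordList x m := by
  rw [wordList, wordList, ← List.map_take, List.take_range, min_eq_left h]

theorem nodup_wordList {x : ℕ → ℕ → A} (hx : Function.Injective x) (n : ℕ) :
    (wordList x n).Nodup :=
  List.nodup_range.map fun _ _ h => hx (toLex_inj.1 h)

theorem wordList_extendDomain {n : ℕ} (x : ℕ → ℕ → A) (σ : Equiv.Perm (Fin n)) :
    wordList (fun i => x (σ.extendDomain Fin.equivSubtype i)) n =
      List.ofFn fun i : Fin n => toLex (x (σ i)) := by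
  rw [wordList, List.ofFn_eq_map, ← List.map_coe_finRange_eq_range, List.map_map]
  refine List.map_congr_left fun i _ => ?_
  have := Equiv.Perm.extendDomain_apply_image σ Fin.equivSubtype i
  simp only [Function.comp_apply]
  rw [show ((i : Fin n) : ℕ) = ((Fin.equivSubtype i : {j : ℕ // j < n}) : ℕ) from rfl, this]
  rfl

theorem measurableSet_hasPrefix {k : ℕ} [MeasurableSpace A] [DiscreteMeasurableSpace A]
    (w : Fin k → A) : MeasurableSet {y : ℕ → A | HasPrefix w (toLex y)} := by
  have : {y : ℕ → A | HasPrefix w (toLex y)} = ⋂ i : Fin k, (fun y => y i) ⁻¹' {w i} := by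
    ext y; simp [HasPrefix]
  rw [this]
  exact MeasurableSet.iInter fun i => measurable_pi_apply _ (MeasurableSet.of_discrete)

theorem sum_prefixProb_sq_tendsto [Fintype A] [MeasurableSpace A]
    {μ : Measure (ℕ → A)} (hμ : SummableSource μ) :
    Tendsto (fun k : ℕ => ∑ w : Fin k → A, prefixProb μ w ^ 2) atTop (𝓝 0) := by
  have h := hμ.tendsto_atTop_zero
  have h2 := h.pow 2
  rw [zero_pow two_ne_zero] at h2
  refine h2.congr fun k => Real.sq_sqrt ?_
  exact Finset.sum_nonneg fun _ _ => sq_nonneg _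

variable [LinearOrder A]

instance {k : ℕ} (w : Fin k → A) : DecidablePred (HasPrefix w) := fun y =>
  inferInstanceAs (Decidable (∀ i : Fin k, ofLex y i = w i))

/-- Induction on the position: as long as the earlier symbols agree, the lexicographic order
squeezes the next symbol between two copies of that of `w`. -/
theorem convexPred_hasPrefix {k : ℕ} (w : Fin k → A) : ConvexPred (HasPrefix w) := by
  intro a b c ha hb hac hcb
  have key : ∀ n, ∀ h : n < k, ofLex c n = w ⟨n, h⟩ := by
    intro n
    induction n using Nat.strong_induction_on with
    | _ n ih =>
      intro h
      have h1 := Pi.apply_le_of_toLex (x := ofLex a) (y := ofLex c) (i := n) hac fun j hj => by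
        rw [ih j hj (hj.trans h)]; exact ha ⟨j, hj.trans h⟩
      have h2 := Pi.apply_le_of_toLex (x := ofLex c) (y := ofLex b) (i := n) hcb fun j hj => by
        rw [ih j hj (hj.trans h)]; exact (hb ⟨j, hj.trans h⟩).symm
      rw [show ofLex a n = w ⟨n, h⟩ from ha ⟨n, h⟩] at h1
      rw [show ofLex b n = w ⟨n, h⟩ from hb ⟨n, h⟩] at h2
      exact le_antisymm h2 h1
  exact fun i => key i i.2

/-- The number of words beginning with `w` among the first `n`. -/
def prefixCount {k : ℕ} (w : Fin k → A) (x : ℕ → ℕ → A) (n : ℕ) : ℕ :=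
  ((wordList x n).filter (HasPrefix w)).length

theorem prefixCount_eq_sum {k : ℕ} (w : Fin k → A) (x : ℕ → ℕ → A) (n : ℕ) :
    prefixCount w x n = ∑ i ∈ Finset.range n, if HasPrefix w (toLex (x i)) then 1 else 0 := by
  induction n with
  | zero => rfl
  | succ n ih =>
    rw [Finset.sum_range_succ, ← ih, prefixCount, prefixCount, wordList, List.range_succ,
      List.map_append, List.filter_append, List.length_append]
    congr 1
    by_cases h : HasPrefix w (toLex (x n)) <;> simp [h]

theorem prefixCount_mono {k : ℕ} (w : Fin k → A) (x : ℕ → ℕ → A) : Monotone (prefixCount w x) := by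
  intro m n h
  rw [prefixCount_eq_sum, prefixCount_eq_sum]
  exact Finset.sum_le_sum_of_subset (Finset.range_subset_range.2 h)

theorem measurable_prefixCount [MeasurableSpace A] [DiscreteMeasurableSpace A]
    {k : ℕ} (w : Fin k → A) (n : ℕ) :
    Measurable fun x : ℕ → ℕ → A => prefixCount w x n := by
  simp only [prefixCount_eq_sum]
  refine Finset.measurable_sum _ fun i _ => Measurable.ite ?_ measurable_const measurable_const
  exact (measurable_pi_apply (X := fun _ : ℕ => ℕ → A) i) (measurableSet_hasPrefix w)

variable [Fintype A]

/-- The number of comparisons of symbols in position `k`: the number of key comparisons between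
words that share their first `k` symbols. -/
noncomputable def levelCount (k : ℕ) (l : List (Lex (ℕ → A))) : ℕ :=
  ∑ w : Fin k → A, keyCount (l.filter (HasPrefix w))

theorem levelCount_zero (l : List (Lex (ℕ → A))) : levelCount 0 l = keyCount l := by
  rw [levelCount, Fintype.sum_unique]
  congr 1
  rw [List.filter_eq_self]
  intro y _
  simp [HasPrefix]

/-- At most one word of length k is a prefix of both keys, and there is one exactly when the
position k is reached. -/
theorem sum_indicator_hasPrefix (k : ℕ) {x y : Lex (ℕ → A)} (hxy : x ≠ y) :
    ∑ w : Fin k → A, (if HasPrefix w x ∧ HasPrefix w y then 1 else 0) =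
      if k < symbolComparisons x y then 1 else 0 := by
  have hne : ofLex x ≠ ofLex y := fun h => hxy (ofLex_inj.1 h)
  have h := PiNat.mem_cylinder_iff_le_firstDiff hne k
  have h' : k < symbolComparisons x y ↔ ofLex x ∈ PiNat.cylinder (ofLex y) k := by
    rw [symbolComparisons, Nat.lt_succ_iff, ← h]
  by_cases hk : ofLex x ∈ PiNat.cylinder (ofLex y) k
  · rw [if_pos (h'.2 hk), Finset.sum_eq_single (fun i : Fin k => ofLex x i)]
    · rw [if_pos]
      exact ⟨fun _ => rfl, fun i => (hk i i.2).symm⟩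
    · intro w _ hw
      rw [if_neg]
      exact fun h' => hw (h'.1.unique fun _ => rfl)
    · simp
  · rw [if_neg fun h1 => hk (h'.1 h1)]
    refine Finset.sum_eq_zero fun w _ => if_neg fun h2 => hk fun i hi => ?_
    exact (h2.1 ⟨i, hi⟩).trans (h2.2 ⟨i, hi⟩).symm

/-- In a finite list of distinct words common prefixes have bounded length, so only finitely many
levels contribute. Distinctness keeps the conventional value of `symbolComparisons` on the diagonal
out of play. -/
theorem eventually_sum_levelCount {l : List (Lex (ℕ → A))} (hl : l.Nodup) :
    ∀ᶠ L in atTop, ∑ k ∈ Finset.range L, levelCount k l =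
      quickSortCost symbolComparisons l := by
  have h1 : ∀ᶠ L in atTop, ∀ x ∈ l.toFinset, ∀ y ∈ l.toFinset, symbolComparisons x y ≤ L := by
    rw [Filter.eventually_all_finset]
    intro x _
    rw [Filter.eventually_all_finset]
    exact fun y _ => eventually_ge_atTop _
  filter_upwards [h1] with L hL
  have h2 : ∀ k, levelCount k l = quickSortCost
      (fun x y => ∑ w : Fin k → A, if HasPrefix w x ∧ HasPrefix w y then 1 else 0) l := by
    intro k
    rw [quickSortCost_sum, levelCount]
    exact Finset.sum_congr rfl fun w _ => (quickSortCost_indicator (convexPred_hasPrefix w) l).symm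
  rw [Finset.sum_congr rfl fun k _ => h2 k, ← quickSortCost_sum]
  refine quickSortCost_congr hl fun x hx y hy hxy => ?_
  rw [Finset.sum_congr rfl fun k _ => sum_indicator_hasPrefix k hxy]
  have := hL x (List.mem_toFinset.2 hx) y (List.mem_toFinset.2 hy)
  rw [← Finset.card_filter]
  have : (Finset.range L).filter (fun k => k < symbolComparisons x y) =
      Finset.range (symbolComparisons x y) := by
    ext k; simp only [Finset.mem_filter, Finset.mem_range]; omega
  rw [this, Finset.card_range]

end Words

/-! ### Measurability of the counts. -/

section Measurability

variable {A : Type*} [LinearOrder A] [Fintype A] [MeasurableSpace A] [DiscreteMeasurableSpace A]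

theorem measurableSet_toLex_lt :
    MeasurableSet {y : (ℕ → A) × (ℕ → A) | toLex y.1 < toLex y.2} := by
  have : {y : (ℕ → A) × (ℕ → A) | toLex y.1 < toLex y.2} =
      ⋃ k : ℕ, (⋂ j : ℕ, ⋂ _ : j < k, (fun y => (y.1 j, y.2 j)) ⁻¹' {a : A × A | a.1 = a.2}) ∩
        (fun y => (y.1 k, y.2 k)) ⁻¹' {a : A × A | a.1 < a.2} := by
    ext y
    simp only [Set.mem_iUnion, Set.mem_inter_iff, Set.mem_iInter, Set.mem_preimage,
      Set.mem_ofPred_eq]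
    rfl
  rw [this]
  refine MeasurableSet.iUnion fun k => MeasurableSet.inter
    (MeasurableSet.iInter fun j => MeasurableSet.iInter fun _ => ?_) ?_
  · exact (show Measurable fun y : (ℕ → A) × (ℕ → A) => (y.1 j, y.2 j) by fun_prop)
      MeasurableSet.of_discrete
  · exact (show Measurable fun y : (ℕ → A) × (ℕ → A) => (y.1 k, y.2 k) by fun_prop)
      MeasurableSet.of_discrete

/-- The count factors through the finite table τ of order relations and prefix memberships of the
first n words. -/
theorem measurable_keyCount_filter {k : ℕ} (w : Fin k → A) (n : ℕ) :
    Measurable fun x : ℕ → ℕ → A => keyCount ((wordList x n).filter (HasPrefix w)) := by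
  classical
  let τ : (ℕ → ℕ → A) → (Fin n → Fin n → Bool) × (Fin n → Bool) := fun x =>
    (fun i j => decide (toLex (x i) < toLex (x j)), fun i => decide (HasPrefix w (toLex (x i))))
  have hτ : Measurable τ := by
    refine Measurable.prodMk (measurable_pi_iff.2 fun i => measurable_pi_iff.2 fun j => ?_)
      (measurable_pi_iff.2 fun i => ?_)
    · apply measurable_to_bool
      have : (fun x : ℕ → ℕ → A => decide (toLex (x i) < toLex (x j))) ⁻¹' {true} =
          (fun x => (x i, x j)) ⁻¹' {y | toLex y.1 < toLex y.2} := by ext; simp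
      rw [this]
      exact (show Measurable fun x : ℕ → ℕ → A => (x i, x j) by fun_prop) measurableSet_toLex_lt
    · apply measurable_to_bool
      have : (fun x : ℕ → ℕ → A => decide (HasPrefix w (toLex (x i)))) ⁻¹' {true} =
          (fun x => x i) ⁻¹' {y | HasPrefix w (toLex y)} := by ext; simp
      rw [this]
      exact (measurable_pi_apply (X := fun _ : ℕ => ℕ → A) (i : ℕ)) (measurableSet_hasPrefix w)
  have hfac : Function.FactorsThrough
      (fun x : ℕ → ℕ → A => keyCount ((wordList x n).filter (HasPrefix w))) τ := by
    intro x x' h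
    have h1 : ∀ i < n, ∀ j < n, (toLex (x i) < toLex (x j) ↔ toLex (x' i) < toLex (x' j)) := by
      intro i hi j hj
      have := congrFun (congrFun (congrArg Prod.fst h) ⟨i, hi⟩) ⟨j, hj⟩
      simpa [τ] using this
    have h2 : ∀ i < n, (HasPrefix w (toLex (x i)) ↔ HasPrefix w (toLex (x' i))) := by
      intro i hi
      have := congrFun (congrArg Prod.snd h) ⟨i, hi⟩
      simpa [τ] using this
    simp only [wordList]
    rw [filter_map_comp, filter_map_comp]
    have e : ((List.range n).filter fun i => HasPrefix w (toLex (x i))) =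
        (List.range n).filter fun i => HasPrefix w (toLex (x' i)) :=
      List.filter_congr fun i hi => by simp only [h2 i (List.mem_range.1 hi)]
    rw [e]
    exact keyCount_map_congr _ _ _ fun i hi j hj =>
      h1 i (List.mem_range.1 (List.mem_of_mem_filter hi)) j
        (List.mem_range.1 (List.mem_of_mem_filter hj))
  rw [← hfac.extend_comp (fun _ => 0)]
  exact (Measurable.of_discrete (f := Function.extend τ _ _)).comp hτ

end Measurability

/-! ### Exchangeability of the keys. -/

section Symmetrization

variable {A : Type*} [MeasurableSpace A]

/-- The law of an i.i.d. sequence of keys drawn from the source `μ`. -/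
noncomputable def keyLaw (μ : Measure (ℕ → A)) [IsProbabilityMeasure μ] : Measure (ℕ → ℕ → A) :=
  Measure.infinitePi fun _ : ℕ => μ

instance (μ : Measure (ℕ → A)) [IsProbabilityMeasure μ] : IsProbabilityMeasure (keyLaw μ) := by
  unfold keyLaw; infer_instance

variable [Fintype A] [DiscreteMeasurableSpace A]

/-- Two equal keys share a prefix of every length k, an event of probability ∑ p_w², which tends to
0. -/
theorem ae_injective_keyLaw (μ : Measure (ℕ → A)) [IsProbabilityMeasure μ]
    (hμ : SummableSource μ) : ∀ᵐ x ∂(keyLaw μ), Function.Injective x := by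
  have key : ∀ i j : ℕ, i ≠ j → ∀ᵐ x ∂(keyLaw μ), x i ≠ x j := by
    intro i j hij
    have hm : Measurable fun x : ℕ → ℕ → A => (x i, x j) := by fun_prop
    have hmap : (keyLaw μ).map (fun x => (x i, x j)) = μ.prod μ :=
      Measure.infinitePi_map_eval_prod hij
    have hk : ∀ k : ℕ, (keyLaw μ).real {x | x i = x j} ≤ ∑ w : Fin k → A, prefixProb μ w ^ 2 := by
      intro k
      have hsub : {x : ℕ → ℕ → A | x i = x j} ⊆ ⋃ w ∈ (Finset.univ : Finset (Fin k → A)),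
          (fun x => (x i, x j)) ⁻¹'
            ({y | ∀ i : Fin k, y i = w i} ×ˢ {y | ∀ i : Fin k, y i = w i}) := by
        intro x hx
        simp only [Set.mem_iUnion]
        refine ⟨fun l => x i l, Finset.mem_univ _, fun _ => rfl, fun l => ?_⟩
        rw [show x i = x j from hx]
      refine (measureReal_mono hsub (measure_ne_top _ _)).trans
        ((measureReal_biUnion_finset_le _ _).trans ?_)
      refine Finset.sum_le_sum fun w _ => ?_
      have hw : MeasurableSet {y : ℕ → A | ∀ i : Fin k, y i = w i} := measurableSet_hasPrefix w
      rw [← map_measureReal_apply hm (hw.prod hw), hmap, measureReal_prod_prod, sq]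
      rfl
    have h0 : (keyLaw μ).real {x | x i = x j} = 0 :=
      le_antisymm (ge_of_tendsto' (sum_prefixProb_sq_tendsto hμ) hk) measureReal_nonneg
    rw [measureReal_eq_zero_iff] at h0
    rw [ae_iff]
    simpa using h0
  have : ∀ᵐ x ∂(keyLaw μ), ∀ i j : ℕ, i ≠ j → x i ≠ x j := by
    rw [ae_all_iff]; intro i
    rw [ae_all_iff]; intro j
    by_cases hij : i = j
    · simp [hij]
    · filter_upwards [key i j hij] with x hx _ using hx
  filter_upwards [this] with x hx i j hij
  by_contra h
  exact hx i j h hij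

variable [LinearOrder A]

/-- A symmetrization principle: a functional of the first `n` keys may be averaged over all
orders of arrival. -/
theorem lintegral_wordList_le (μ : Measure (ℕ → A)) [IsProbabilityMeasure μ]
    (hμ : SummableSource μ) (n : ℕ) {Φ Ψ : List (Lex (ℕ → A)) → ℝ} (hΦ0 : ∀ l, 0 ≤ Φ l)
    (hΨ0 : ∀ l, 0 ≤ Ψ l)
    (hΦ : Measurable fun x : ℕ → ℕ → A => Φ (wordList x n))
    (hΨ : Measurable fun x : ℕ → ℕ → A => Ψ (wordList x n))
    (h : ∀ s : Finset (Lex (ℕ → A)), s.card = n → orderAvg s Φ ≤ orderAvg s Ψ) :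
    ∫⁻ x, ENNReal.ofReal (Φ (wordList x n)) ∂(keyLaw μ) ≤
      ∫⁻ x, ENNReal.ofReal (Ψ (wordList x n)) ∂(keyLaw μ) := by
  -- Each permutation of the first n keys preserves the law, so n! times the integral is the
  -- integral of the sum over permutations; for distinct keys that sum is n! `orderAvg`.
  have key : ∀ Ξ : List (Lex (ℕ → A)) → ℝ, (∀ l, 0 ≤ Ξ l) →
      (Measurable fun x : ℕ → ℕ → A => Ξ (wordList x n)) →
      (Fintype.card (Equiv.Perm (Fin n)) : ℝ≥0∞) *
        ∫⁻ x, ENNReal.ofReal (Ξ (wordList x n)) ∂(keyLaw μ) =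
      ∫⁻ x, ENNReal.ofReal (∑ σ : Equiv.Perm (Fin n),
        Ξ (List.ofFn fun i : Fin n => toLex (x (σ i)))) ∂(keyLaw μ) := by
    intro Ξ hΞ0 hΞ
    have hmeas : ∀ σ : Equiv.Perm (Fin n), Measurable fun (x : ℕ → ℕ → A) (i : ℕ) =>
        x (σ.extendDomain Fin.equivSubtype i) := fun σ => by fun_prop
    have h1 : ∀ σ : Equiv.Perm (Fin n), ∫⁻ x, ENNReal.ofReal (Ξ (wordList x n)) ∂(keyLaw μ) =
        ∫⁻ x, ENNReal.ofReal (Ξ (List.ofFn fun i : Fin n => toLex (x (σ i)))) ∂(keyLaw μ) := by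
      intro σ
      have hmp : (keyLaw μ).map (fun x i => x (σ.extendDomain Fin.equivSubtype i)) = keyLaw μ :=
        Measure.map_infinitePi_infinitePi_of_inj (Equiv.injective _)
      conv_lhs => rw [← hmp]
      rw [lintegral_map hΞ.ennreal_ofReal (hmeas σ)]
      simp only [wordList_extendDomain]
    simp only [ENNReal.ofReal_sum_of_nonneg fun σ _ => hΞ0 _]
    rw [lintegral_finsetSum]
    · rw [← Finset.sum_congr rfl fun σ _ => h1 σ, Finset.sum_const, Finset.card_univ,
        nsmul_eq_mul]
    · intro σ _
      have := ENNReal.measurable_ofReal.comp (hΞ.comp (hmeas σ))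
      simpa only [Function.comp_def, wordList_extendDomain] using this
  have hc0 : (Fintype.card (Equiv.Perm (Fin n)) : ℝ≥0∞) ≠ 0 := by simp
  rw [← ENNReal.mul_le_mul_iff_right hc0 (ENNReal.natCast_ne_top _), key Φ hΦ0 hΦ, key Ψ hΨ0 hΨ]
  refine lintegral_mono_ae ?_
  filter_upwards [ae_injective_keyLaw μ hμ] with x hx
  have hinj : Function.Injective fun i : Fin n => toLex (x i) := fun i j hij =>
    Fin.ext (hx (toLex_inj.1 hij))
  rw [sum_perm_ofFn _ hinj, sum_perm_ofFn _ hinj]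
  apply ENNReal.ofReal_le_ofReal
  refine mul_le_mul_of_nonneg_left (h _ ?_) (by positivity)
  rw [Finset.card_image_of_injective _ hinj, Finset.card_univ, Fintype.card_fin]

theorem lintegral_wordList_congr (μ : Measure (ℕ → A)) [IsProbabilityMeasure μ]
    (hμ : SummableSource μ) (n : ℕ) {Φ Ψ : List (Lex (ℕ → A)) → ℝ} (hΦ0 : ∀ l, 0 ≤ Φ l)
    (hΨ0 : ∀ l, 0 ≤ Ψ l)
    (hΦ : Measurable fun x : ℕ → ℕ → A => Φ (wordList x n))
    (hΨ : Measurable fun x : ℕ → ℕ → A => Ψ (wordList x n))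
    (h : ∀ s : Finset (Lex (ℕ → A)), s.card = n → orderAvg s Φ = orderAvg s Ψ) :
    ∫⁻ x, ENNReal.ofReal (Φ (wordList x n)) ∂(keyLaw μ) =
      ∫⁻ x, ENNReal.ofReal (Ψ (wordList x n)) ∂(keyLaw μ) :=
  le_antisymm (lintegral_wordList_le μ hμ n hΦ0 hΨ0 hΦ hΨ fun s hs => (h s hs).le)
    (lintegral_wordList_le μ hμ n hΨ0 hΦ0 hΨ hΦ fun s hs => (h s hs).ge)

end Symmetrization

/-! ### Poisson moments and a Poincaré inequality. -/

section Poisson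

/-- The Stein-Chen identity. -/
theorem lintegral_poisson_mul (r : ℝ≥0) (g : ℕ → ℝ≥0∞) :
    ∫⁻ n, n * g n ∂(poissonMeasure r) = r * ∫⁻ n, g (n + 1) ∂(poissonMeasure r) := by
  rw [lintegral_countable', lintegral_countable', tsum_eq_zero_add' ENNReal.summable,
    ← ENNReal.tsum_mul_left]
  simp only [Nat.cast_zero, zero_mul, zero_add]
  refine tsum_congr fun n => ?_
  have : ((n + 1 : ℕ) : ℝ≥0∞) * poissonMeasure r {n + 1} = r * poissonMeasure r {n} := by
    rw [poissonMeasure_singleton, poissonMeasure_singleton, ← ENNReal.ofReal_natCast,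
      ← ENNReal.ofReal_coe_nnreal, ← ENNReal.ofReal_mul (by positivity),
      ← ENNReal.ofReal_mul (by positivity)]
    congr 1
    rw [Nat.factorial_succ]
    push_cast
    field_simp
    ring
  calc ((n + 1 : ℕ) : ℝ≥0∞) * g (n + 1) * poissonMeasure r {n + 1}
      = g (n + 1) * (((n + 1 : ℕ) : ℝ≥0∞) * poissonMeasure r {n + 1}) := by ring
    _ = _ := by rw [this]; ring

theorem lintegral_poisson_id (r : ℝ≥0) : ∫⁻ n, (n : ℝ≥0∞) ∂(poissonMeasure r) = r := by
  have := lintegral_poisson_mul r (fun _ => 1)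
  simpa using this

theorem lintegral_poisson_mul_sub_one (r : ℝ≥0) :
    ∫⁻ n, ((n * (n - 1) : ℕ) : ℝ≥0∞) ∂(poissonMeasure r) = r ^ 2 := by
  have := lintegral_poisson_mul r (fun n => ((n - 1 : ℕ) : ℝ≥0∞))
  simp only [add_tsub_cancel_right, lintegral_poisson_id] at this
  push_cast at this ⊢
  rw [this, sq]

/-- By Stein-Chen, E[Y; Y > k] = r P(Y ≥ k) and E[X; X ≤ k] = r P(X < k). The integral is P(X ≤ k) r
P(Y ≥ k) - r P(X < k) P(Y > k), which collapses to r P(X = k). In `ℝ≥0∞` the subtracted term is kept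
on the left. -/
theorem lintegral_poisson_pairs (r : ℝ≥0) (k : ℕ) :
    ∫⁻ x, ∫⁻ y, (if x ≤ k ∧ k < y then ((y - x : ℕ) : ℝ≥0∞) else 0)
      ∂(poissonMeasure r) ∂(poissonMeasure r) = r * poissonMeasure r {k} := by
  set π := poissonMeasure r
  have hind : ∀ s : Set ℕ, ∫⁻ x, s.indicator 1 x ∂π = π s := fun s =>
    lintegral_indicator_one MeasurableSet.of_discrete
  have h1 : ∫⁻ x, (x : ℝ≥0∞) * (Set.Iic k).indicator 1 x ∂π = r * π (Set.Iio k) := by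
    rw [lintegral_poisson_mul, ← hind]
    congr 1
  have h2 : ∫⁻ y, (y : ℝ≥0∞) * (Set.Ioi k).indicator 1 y ∂π = r * π (Set.Ici k) := by
    rw [lintegral_poisson_mul, ← hind]
    congr 1
    refine lintegral_congr fun n => ?_
    simp [Set.indicator]
  have h3 : (∫⁻ x, ∫⁻ y, (if x ≤ k ∧ k < y then ((y - x : ℕ) : ℝ≥0∞) else 0) ∂π ∂π) +
      (r * π (Set.Iio k)) * π (Set.Ioi k) = π (Set.Iic k) * (r * π (Set.Ici k)) := by
    rw [← h1, ← h2, ← hind (Set.Ioi k), ← hind (Set.Iic k),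
      ← lintegral_mul_const _ .of_discrete, ← lintegral_mul_const _ .of_discrete,
      ← lintegral_add_left .of_discrete]
    refine lintegral_congr fun x => ?_
    rw [← lintegral_const_mul _ .of_discrete, ← lintegral_const_mul _ .of_discrete,
      ← lintegral_add_left .of_discrete]
    refine lintegral_congr fun y => ?_
    by_cases hx : x ≤ k <;> by_cases hy : k < y
    · have : x ≤ y := by omega
      simp only [hx, hy, and_self, if_true, Set.indicator, Set.mem_Iic, Set.mem_Ioi, Pi.one_apply,
        mul_one, one_mul]
      rw [← Nat.cast_add, Nat.sub_add_cancel this]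
    all_goals simp [hx, hy]
  have h4 : π (Set.Iic k) = π (Set.Iio k) + π {k} := by
    rw [← Set.Iio_union_right, measure_union (by simp) (.singleton k)]
  have h5 : π (Set.Ici k) = π (Set.Ioi k) + π {k} := by
    rw [← Set.Ioi_union_left, measure_union (by simp) (.singleton k)]
  have h6 : π (Set.Iio k) + π {k} + π (Set.Ioi k) = 1 := by
    rw [← h4, ← measure_union (by simp) measurableSet_Ioi, Set.Iic_union_Ioi, measure_univ]
  have h7 : π (Set.Iic k) * (r * π (Set.Ici k)) = r * π {k} *
      (π (Set.Iio k) + π {k} + π (Set.Ioi k)) + (r * π (Set.Iio k)) * π (Set.Ioi k) := by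
    rw [h4, h5]; ring
  rw [h7, h6, mul_one] at h3
  refine (ENNReal.add_left_inj ?_).1 h3
  exact ENNReal.mul_ne_top (ENNReal.mul_ne_top ENNReal.coe_ne_top (measure_ne_top _ _))
    (measure_ne_top _ _)

/-- Cauchy-Schwarz for the telescoping sum from x to y. -/
theorem sq_sub_le_sum (f : ℕ → ℝ) {x y : ℕ} (h : x < y) :
    ENNReal.ofReal ((f y - f x) ^ 2) ≤ ∑' k, (if x ≤ k ∧ k < y then ((y - x : ℕ) : ℝ≥0∞) else 0) *
      ENNReal.ofReal ((f (k + 1) - f k) ^ 2) := by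
  have h1 : (f y - f x) ^ 2 ≤ (y - x : ℕ) * ∑ k ∈ Finset.Ico x y, (f (k + 1) - f k) ^ 2 := by
    rw [← Finset.sum_Ico_sub f h.le, ← Nat.card_Ico]
    exact sq_sum_le_card_mul_sum_sq
  refine (ENNReal.ofReal_le_ofReal h1).trans ?_
  rw [ENNReal.ofReal_mul (by positivity), ENNReal.ofReal_natCast,
    ENNReal.ofReal_sum_of_nonneg fun _ _ => sq_nonneg _, Finset.mul_sum]
  refine le_trans (le_of_eq ?_) (ENNReal.sum_le_tsum (Finset.Ico x y))
  refine Finset.sum_congr rfl fun k hk => ?_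
  rw [if_pos (Finset.mem_Ico.1 hk)]

theorem lintegral_poisson_poincare (r : ℝ≥0) (f : ℕ → ℝ) :
    ∫⁻ x, ∫⁻ y, (if x < y then ENNReal.ofReal ((f y - f x) ^ 2) else 0)
      ∂(poissonMeasure r) ∂(poissonMeasure r) ≤
      r * ∫⁻ n, ENNReal.ofReal ((f (n + 1) - f n) ^ 2) ∂(poissonMeasure r) := by
  set π := poissonMeasure r
  set D : ℕ → ℝ≥0∞ := fun k => ENNReal.ofReal ((f (k + 1) - f k) ^ 2) with hD
  calc ∫⁻ x, ∫⁻ y, (if x < y then ENNReal.ofReal ((f y - f x) ^ 2) else 0) ∂π ∂π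
      ≤ ∫⁻ x, ∫⁻ y, ∑' k, (if x ≤ k ∧ k < y then ((y - x : ℕ) : ℝ≥0∞) else 0) * D k ∂π ∂π := by
        refine lintegral_mono fun x => lintegral_mono fun y => ?_
        dsimp only
        split_ifs with h
        · exact sq_sub_le_sum f h
        · exact zero_le
    _ = ∑' k, (∫⁻ x, ∫⁻ y, (if x ≤ k ∧ k < y then ((y - x : ℕ) : ℝ≥0∞) else 0) ∂π ∂π) * D k := by
        have e : ∀ x, ∫⁻ y, ∑' k, (if x ≤ k ∧ k < y then ((y - x : ℕ) : ℝ≥0∞) else 0) * D k ∂π =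
            ∑' k, (∫⁻ y, (if x ≤ k ∧ k < y then ((y - x : ℕ) : ℝ≥0∞) else 0) ∂π) * D k := by
          intro x
          rw [lintegral_tsum fun _ => Measurable.aemeasurable .of_discrete]
          exact tsum_congr fun k => lintegral_mul_const _ .of_discrete
        simp only [e]
        rw [lintegral_tsum fun _ => Measurable.aemeasurable .of_discrete]
        exact tsum_congr fun k => lintegral_mul_const _ .of_discrete
    _ = r * ∫⁻ n, D n ∂π := by
        rw [lintegral_countable', ← ENNReal.tsum_mul_left]
        refine tsum_congr fun k => ?_
        rw [lintegral_poisson_pairs]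
        ring

theorem lintegral_sub_sq_eq_variance {Ω : Type*} [MeasurableSpace Ω] {P : Measure Ω}
    [IsProbabilityMeasure P] {f : Ω → ℝ} (hL : MemLp f 2 P) :
    ∫⁻ x, ∫⁻ y, ENNReal.ofReal ((f x - f y) ^ 2) ∂P ∂P = ENNReal.ofReal (2 * variance f P) := by
  have hi1 : Integrable f P := hL.integrable one_le_two
  have hi2 : Integrable (fun y => f y ^ 2) P := hL.integrable_sq
  set m := ∫ y, f y ∂P with hm
  have hv : variance f P = (∫ y, f y ^ 2 ∂P) - m ^ 2 := variance_eq_sub hL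
  have hreal : ∀ x, ∫⁻ y, ENNReal.ofReal ((f x - f y) ^ 2) ∂P =
      ENNReal.ofReal ((f x - m) ^ 2 + variance f P) := by
    intro x
    have hi : Integrable (fun y => (f x - f y) ^ 2) P :=
      ((memLp_const (f x)).sub hL).integrable_sq
    rw [← ofReal_integral_eq_lintegral_ofReal hi (Eventually.of_forall fun _ => sq_nonneg _)]
    congr 1
    have e : ∀ y, (f x - f y) ^ 2 = (f x ^ 2 - 2 * f x * f y) + f y ^ 2 := fun y => by ring
    simp only [e]
    rw [integral_add (f := fun y => f x ^ 2 - 2 * f x * f y)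
      ((integrable_const _).sub (hi1.const_mul _)) hi2,
      integral_sub (integrable_const _) (hi1.const_mul _), integral_const_mul, ← hm, hv]
    simp
    ring
  have hi : Integrable (fun x => (f x - m) ^ 2) P := (hL.sub (memLp_const m)).integrable_sq
  simp only [hreal]
  rw [← ofReal_integral_eq_lintegral_ofReal (f := fun x => (f x - m) ^ 2 + variance f P)
    (hi.add (integrable_const _))
    (Eventually.of_forall fun _ => add_nonneg (sq_nonneg _) (variance_nonneg f P)),
    integral_add hi (integrable_const _), ← variance_eq_integral hL.aemeasurable,
    integral_const, probReal_univ, one_smul, two_mul]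

/-- For independent copies, Var f is half of E(f(X) - f(Y))², that is, the part on X < Y. -/
theorem poisson_poincare (r : ℝ≥0) (f : ℕ → ℝ) {V : ℝ} (hV : 0 ≤ V)
    (h : ∫⁻ n, ENNReal.ofReal ((f (n + 1) - f n) ^ 2) ∂(poissonMeasure r) ≤ ENNReal.ofReal V) :
    MemLp f 2 (poissonMeasure r) ∧ variance f (poissonMeasure r) ≤ r * V := by
  set π := poissonMeasure r with hπ
  have hP := lintegral_poisson_poincare r f
  rw [← hπ] at hP
  set T := ∫⁻ x, ∫⁻ y, (if x < y then ENNReal.ofReal ((f y - f x) ^ 2) else 0) ∂π ∂π with hT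
  have hT1 : T ≤ ENNReal.ofReal (r * V) := by
    refine hP.trans ?_
    rw [ENNReal.ofReal_mul (by positivity), ENNReal.ofReal_coe_nnreal]
    gcongr
  have hL : MemLp f 2 π := by
    have h0 : MemLp (fun y => f y - f 0) 2 π := by
      rw [memLp_two_iff_integrable_sq (Measurable.aestronglyMeasurable .of_discrete)]
      refine ⟨Measurable.aestronglyMeasurable .of_discrete, ?_⟩
      rw [hasFiniteIntegral_iff_ofReal (Filter.Eventually.of_forall fun _ => sq_nonneg _)]
      -- The atom at x = 0 has positive mass, so finiteness of the double integral already forces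
      -- square integrability.
      have h1 : (∫⁻ y, (if 0 < y then ENNReal.ofReal ((f y - f 0) ^ 2) else 0) ∂π) * π {0} ≤ T := by
        rw [hT, lintegral_countable' (fun x => ∫⁻ y, _ ∂π)]
        exact ENNReal.le_tsum 0
      have h2 : π {0} ≠ 0 := by
        rw [hπ, poissonMeasure_singleton]
        simp [Real.exp_pos]
      have h3 : ∫⁻ y, ENNReal.ofReal ((f y - f 0) ^ 2) ∂π =
          ∫⁻ y, (if 0 < y then ENNReal.ofReal ((f y - f 0) ^ 2) else 0) ∂π := by
        refine lintegral_congr fun y => ?_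
        rcases y.eq_zero_or_pos with rfl | hy
        · simp
        · rw [if_pos hy]
      rw [h3]
      by_contra hcon
      rw [not_lt, top_le_iff] at hcon
      rw [hcon, ENNReal.top_mul h2, top_le_iff] at h1
      rw [h1] at hT1
      exact absurd (top_le_iff.1 hT1) ENNReal.ofReal_ne_top
    have := h0.add (memLp_const (f 0))
    refine this.ae_eq (Filter.Eventually.of_forall fun y => ?_)
    simp
  refine ⟨hL, ?_⟩
  have hsym : ∫⁻ x, ∫⁻ y, ENNReal.ofReal ((f x - f y) ^ 2) ∂π ∂π = 2 * T := by
    have e : ∀ x y, ENNReal.ofReal ((f x - f y) ^ 2) =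
        (if x < y then ENNReal.ofReal ((f y - f x) ^ 2) else 0) +
        (if y < x then ENNReal.ofReal ((f x - f y) ^ 2) else 0) := by
      intro x y
      rcases lt_trichotomy x y with h | h | h
      · rw [if_pos h, if_neg h.le.not_gt, add_zero, ← neg_sub (f y), neg_sq]
      · simp [h]
      · rw [if_pos h, if_neg h.le.not_gt, zero_add]
    rw [two_mul]
    calc _ = ∫⁻ x, ∫⁻ y, ((if x < y then ENNReal.ofReal ((f y - f x) ^ 2) else 0) +
          (if y < x then ENNReal.ofReal ((f x - f y) ^ 2) else 0)) ∂π ∂π :=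
          lintegral_congr fun x => lintegral_congr fun y => e x y
      _ = ∫⁻ x, ((∫⁻ y, (if x < y then ENNReal.ofReal ((f y - f x) ^ 2) else 0) ∂π) +
          ∫⁻ y, (if y < x then ENNReal.ofReal ((f x - f y) ^ 2) else 0) ∂π) ∂π :=
          lintegral_congr fun x => lintegral_add_left .of_discrete _
      _ = T + ∫⁻ x, ∫⁻ y, (if y < x then ENNReal.ofReal ((f x - f y) ^ 2) else 0) ∂π ∂π :=
          lintegral_add_left .of_discrete _
      _ = T + T := by
          congr 1
          rw [lintegral_lintegral_swap (Measurable.aemeasurable .of_discrete)]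
  rw [lintegral_sub_sq_eq_variance hL] at hsym
  have h8 : ENNReal.ofReal (2 * variance f π) ≤ ENNReal.ofReal (2 * (r * V)) := by
    rw [hsym, ENNReal.ofReal_mul zero_le_two (q := r * V), ENNReal.ofReal_ofNat]
    gcongr
  have := (ENNReal.ofReal_le_ofReal_iff (by positivity)).1 h8
  linarith

theorem poisson_keyMean (r : ℝ≥0) {ε C : ℝ} (hε : 0 ≤ ε) (hC : 0 ≤ C)
    (h : ∀ n : ℕ, (harm (n + 1) - 1) ^ 2 ≤ ε * n + C) :
    MemLp keyMean 2 (poissonMeasure r) ∧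
      variance keyMean (poissonMeasure r) ≤ r * (4 * (ε * r + C)) := by
  refine poisson_poincare r keyMean (by positivity) ?_
  calc ∫⁻ n, ENNReal.ofReal ((keyMean (n + 1) - keyMean n) ^ 2) ∂(poissonMeasure r)
      ≤ ∫⁻ n, (ENNReal.ofReal (4 * ε) * (n : ℝ≥0∞) + ENNReal.ofReal (4 * C))
          ∂(poissonMeasure r) := by
        refine lintegral_mono fun n => ?_
        rw [← ENNReal.ofReal_natCast, ← ENNReal.ofReal_mul (by positivity),
          ← ENNReal.ofReal_add (by positivity) (by positivity)]
        apply ENNReal.ofReal_le_ofReal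
        have := h n
        rw [keyMean_succ]
        linarith
    _ = ENNReal.ofReal (4 * (ε * r + C)) := by
        rw [lintegral_add_right _ measurable_const, lintegral_const_mul _ .of_discrete,
          lintegral_poisson_id, lintegral_const, measure_univ, mul_one,
          ← ENNReal.ofReal_coe_nnreal, ← ENNReal.ofReal_mul (by positivity),
          ← ENNReal.ofReal_add (by positivity) (by positivity)]
        congr 1
        ring

end Poisson

/-! ### The marked Poisson process. -/

section PoissonKeys

/-- I.i.d. keys drawn from the source `μ` together with an independent unit rate Poisson
process. -/
structure PoissonKeys {A : Type*} [MeasurableSpace A] (μ : Measure (ℕ → A)) {Ω : Type*}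
    [MeasurableSpace Ω] (P : Measure Ω) (X : ℕ → Ω → ℕ → A) (N : ℝ≥0 → Ω → ℕ) : Prop where
  measurable : ∀ i, Measurable (X i)
  law : ∀ i, P.map (X i) = μ
  indep : iIndepFun X P
  process : IsUnitPoissonProcess N P
  indepFun : IndepFun (fun ω i => X i ω) (fun ω t => N t ω) P

namespace PoissonKeys

variable {A : Type*} [MeasurableSpace A] {μ : Measure (ℕ → A)} {Ω : Type*}
  [MeasurableSpace Ω] {P : Measure Ω} {X : ℕ → Ω → ℕ → A} {N : ℝ≥0 → Ω → ℕ}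

theorem measurable_keys (h : PoissonKeys μ P X N) : Measurable fun ω i => X i ω :=
  measurable_pi_iff.2 h.measurable

theorem map_count (h : PoissonKeys μ P X N) (t : ℝ≥0) : P.map (N t) = poissonMeasure t := by
  have h1 := h.process.law 0 t zero_le
  rw [tsub_zero] at h1
  rw [← h1]
  refine Measure.map_congr ?_
  filter_upwards [h.process.zero] with ω hω
  rw [hω, Nat.sub_zero]

theorem indepFun_counts (h : PoissonKeys μ P X N) (s t : ℝ≥0) :
    IndepFun (fun ω i => X i ω) (fun ω => (N s ω, N t ω)) P :=
  h.indepFun.comp (φ := id) (ψ := fun f : ℝ≥0 → ℕ => (f s, f t)) measurable_id (by fun_prop)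

variable [IsProbabilityMeasure μ]

theorem map_keys (h : PoissonKeys μ P X N) : P.map (fun ω i => X i ω) = keyLaw μ := by
  rw [h.indep.map_fun_eq_infinitePi_map h.measurable, keyLaw]
  simp only [h.law]

theorem integral_keyLaw_prod (g : (ℕ → A) → ℂ) (n : ℕ) (hg : Measurable g) :
    ∫ x, ∏ i ∈ Finset.range n, g (x i) ∂(keyLaw μ) = (∫ y, g y ∂μ) ^ n := by
  have h1 : (keyLaw μ).map (fun x (i : Fin n) => x i) = Measure.pi fun _ : Fin n => μ := by
    rw [← Measure.infinitePi_eq_pi]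
    exact Measure.map_infinitePi_infinitePi_of_inj Fin.val_injective
  have h2 := integral_fintype_prod_eq_pow (ι := Fin n) (μ := μ) g
  have h3 : Measurable fun (x : ℕ → ℕ → A) (i : Fin n) => x i := by fun_prop
  rw [← h1, integral_map h3.aemeasurable
    (Measurable.aestronglyMeasurable (by fun_prop)), Fintype.card_fin] at h2
  rw [← h2]
  refine integral_congr_ae (Eventually.of_forall fun x => ?_)
  exact Finset.prod_range _

variable [IsProbabilityMeasure P]

/-- The keys may be integrated out independently of the Poisson process. -/
theorem lintegral_eq (h : PoissonKeys μ P X N) (F : (ℕ → ℕ → A) → ℕ → ℕ → ℝ≥0∞)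
    (hF : ∀ m n, Measurable fun x => F x m n) (s t : ℝ≥0) :
    ∫⁻ ω, F (fun i => X i ω) (N s ω) (N t ω) ∂P =
      ∫⁻ ω, ∫⁻ x, F x (N s ω) (N t ω) ∂(keyLaw μ) ∂P := by
  have hN : Measurable fun ω => (N s ω, N t ω) :=
    (h.process.measurable s).prodMk (h.process.measurable t)
  have hG : Measurable fun z : (ℕ → ℕ → A) × (ℕ × ℕ) => F z.1 z.2.1 z.2.2 :=
    measurable_from_prod_countable_left fun q => hF q.1 q.2
  have hmap := (h.indepFun_counts s t).map_prod_eq_prod_map_map h.measurable_keys.aemeasurable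
    hN.aemeasurable
  rw [h.map_keys] at hmap
  calc ∫⁻ ω, F (fun i => X i ω) (N s ω) (N t ω) ∂P
      = ∫⁻ z, F z.1 z.2.1 z.2.2 ∂(P.map fun ω => ((fun i => X i ω), (N s ω, N t ω))) := by
        rw [lintegral_map hG (h.measurable_keys.prodMk hN)]
    _ = ∫⁻ q, ∫⁻ x, F x q.1 q.2 ∂(keyLaw μ) ∂(P.map fun ω => (N s ω, N t ω)) := by
        rw [hmap, lintegral_prod_symm' _ hG]
    _ = _ := by rw [lintegral_map hG.lintegral_prod_left' hN]

/-- Given N(t) = n the expectation is φⁿ with φ = ∫ g dμ; the Poisson weights sum these powers to an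
exponential. -/
theorem integral_prod_keys (h : PoissonKeys μ P X N) (t : ℝ≥0) (g : (ℕ → A) → ℂ)
    (hg : Measurable g) (hg1 : ∀ y, ‖g y‖ ≤ 1) :
    ∫ ω, ∏ i ∈ Finset.range (N t ω), g (X i ω) ∂P =
      Complex.exp (t * ((∫ y, g y ∂μ) - 1)) := by
  have hNt := h.process.measurable t
  let G : (ℕ → ℕ → A) × ℕ → ℂ := fun z => ∏ i ∈ Finset.range z.2, g (z.1 i)
  have hG : Measurable G := measurable_from_prod_countable_left fun q => by
    simp only [G]; fun_prop
  have hGb : ∀ z, ‖G z‖ ≤ 1 := fun z => by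
    simp only [G]
    rw [norm_prod]
    exact Finset.prod_le_one (fun _ _ => norm_nonneg _) fun _ _ => hg1 _
  have hind : IndepFun (fun ω i => X i ω) (N t) P :=
    h.indepFun.comp (φ := id) (ψ := fun f : ℝ≥0 → ℕ => f t) measurable_id (by fun_prop)
  have hmap := hind.map_prod_eq_prod_map_map h.measurable_keys.aemeasurable hNt.aemeasurable
  rw [h.map_keys, h.map_count] at hmap
  set φ := ∫ y, g y ∂μ with hφ
  have h3 : HasSum (fun n : ℕ => (Real.exp (-t) * t ^ n / n.factorial) • φ ^ n)
      (Complex.exp (t * (φ - 1))) := by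
    have h4 := NormedSpace.expSeries_div_hasSum_exp ((t : ℂ) * φ)
    rw [← Complex.exp_eq_exp_ℂ] at h4
    have h5 := h4.mul_left (Complex.exp (-t))
    rw [← Complex.exp_add] at h5
    rw [show (t : ℂ) * (φ - 1) = -(t : ℂ) + t * φ by ring]
    refine h5.congr_fun fun n => ?_
    rw [Complex.real_smul]
    push_cast
    rw [mul_pow]
    ring
  calc ∫ ω, ∏ i ∈ Finset.range (N t ω), g (X i ω) ∂P
      = ∫ z, G z ∂(P.map fun ω => ((fun i => X i ω), N t ω)) := by
        rw [integral_map (h.measurable_keys.prodMk hNt).aemeasurable hG.aestronglyMeasurable]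
    _ = ∫ n, ∫ x, G (x, n) ∂(keyLaw μ) ∂(poissonMeasure t) := by
        rw [hmap, integral_prod_symm]
        exact Integrable.of_bound hG.aestronglyMeasurable 1 (Eventually.of_forall hGb)
    _ = ∫ n, φ ^ n ∂(poissonMeasure t) := by
        refine integral_congr_ae (Eventually.of_forall fun n => ?_)
        exact integral_keyLaw_prod g n hg
    _ = _ := by rw [integral_poissonMeasure, h3.tsum_eq]

/-- The joint characteristic function of the numbers of keys in two disjoint sets. -/
theorem integral_exp_counts (h : PoissonKeys μ P X N) (t : ℝ≥0) {B B' : Set (ℕ → A)}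
    (hB : MeasurableSet B) (hB' : MeasurableSet B') (hd : Disjoint B B') (a b : ℝ) :
    ∫ ω, Complex.exp ((a * (∑ i ∈ Finset.range (N t ω), B.indicator 1 (X i ω) : ℝ) +
        b * (∑ i ∈ Finset.range (N t ω), B'.indicator 1 (X i ω) : ℝ) : ℝ) * Complex.I) ∂P =
      Complex.exp (((μ.real B).toNNReal * t : ℝ≥0) * (Complex.exp (a * Complex.I) - 1)) *
      Complex.exp (((μ.real B').toNNReal * t : ℝ≥0) * (Complex.exp (b * Complex.I) - 1)) := by
  let g : (ℕ → A) → ℂ := fun y => Complex.exp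
    ((a * B.indicator 1 y + b * B'.indicator 1 y : ℝ) * Complex.I)
  have hg : Measurable g := by
    have h1 : Measurable (B.indicator (1 : (ℕ → A) → ℝ)) := measurable_one.indicator hB
    have h2 : Measurable (B'.indicator (1 : (ℕ → A) → ℝ)) := measurable_one.indicator hB'
    simp only [g]
    fun_prop
  have hg1 : ∀ y, ‖g y‖ ≤ 1 := fun y => (Complex.norm_exp_ofReal_mul_I _).le
  have h1 := h.integral_prod_keys t g hg hg1
  have h2 : ∫ y, g y ∂μ = 1 + μ.real B * (Complex.exp (a * Complex.I) - 1) +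
      μ.real B' * (Complex.exp (b * Complex.I) - 1) := by
    -- Disjointness makes g - 1 a sum of two multiples of indicators, so the exponential factorizes.
    have e : ∀ y, g y = 1 + B.indicator (fun _ => Complex.exp (a * Complex.I) - 1) y +
        B'.indicator (fun _ => Complex.exp (b * Complex.I) - 1) y := by
      intro y
      simp only [g]
      by_cases hy : y ∈ B
      · have hy' : y ∉ B' := Set.disjoint_left.1 hd hy
        simp [hy, hy']
      · by_cases hy' : y ∈ B' <;> simp [hy, hy']
    simp only [e]
    have i1 : Integrable (B.indicator fun _ => Complex.exp (a * Complex.I) - 1) μ :=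
      (integrable_const _).indicator hB
    have i2 : Integrable (B'.indicator fun _ => Complex.exp (b * Complex.I) - 1) μ :=
      (integrable_const _).indicator hB'
    rw [integral_add (f := fun y => 1 + B.indicator (fun _ => Complex.exp (a * Complex.I) - 1) y)
      ((integrable_const _).add i1) i2, integral_add (integrable_const _) i1,
      integral_indicator_const _ hB, integral_indicator_const _ hB']
    simp
  rw [h2] at h1
  rw [← Complex.exp_add]
  calc _ = ∫ ω, ∏ i ∈ Finset.range (N t ω), g (X i ω) ∂P := by
        refine integral_congr_ae (Eventually.of_forall fun ω => ?_)
        simp only [g]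
        rw [← Complex.exp_sum, ← Finset.sum_mul]
        congr 2
        push_cast
        rw [Finset.sum_add_distrib, Finset.mul_sum, Finset.mul_sum]
    _ = _ := by
        rw [h1]
        congr 1
        have e1 : (((μ.real B).toNNReal : ℝ≥0) : ℂ) = (μ.real B : ℂ) :=
          congrArg Complex.ofReal (Real.coe_toNNReal _ measureReal_nonneg)
        have e2 : (((μ.real B').toNNReal : ℝ≥0) : ℂ) = (μ.real B' : ℂ) :=
          congrArg Complex.ofReal (Real.coe_toNNReal _ measureReal_nonneg)
        push_cast
        rw [e1, e2]
        ring

end PoissonKeys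

end PoissonKeys

/-! ### Functionals of the keys that have arrived. -/

section Counts

variable {A Ω : Type*}

/-- The keys that have arrived by time `t`. -/
def arrived (X : ℕ → Ω → ℕ → A) (N : ℝ≥0 → Ω → ℕ) (t : ℝ≥0) (ω : Ω) : List (Lex (ℕ → A)) :=
  wordList (fun i => X i ω) (N t ω)

variable [MeasurableSpace A] [MeasurableSpace Ω] {μ : Measure (ℕ → A)} {P : Measure Ω}
  {X : ℕ → Ω → ℕ → A} {N : ℝ≥0 → Ω → ℕ}

theorem PoissonKeys.measurable_of_wordList (h : PoissonKeys μ P X N) {E : Type*} [MeasurableSpace E]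
    (Φ : List (Lex (ℕ → A)) → E) (hΦ : ∀ n, Measurable fun x : ℕ → ℕ → A => Φ (wordList x n))
    (t : ℝ≥0) : Measurable fun ω => Φ (arrived X N t ω) := by
  have hG : Measurable fun z : (ℕ → ℕ → A) × ℕ => Φ (wordList z.1 z.2) :=
    measurable_from_prod_countable_left fun n => hΦ n
  exact hG.comp (h.measurable_keys.prodMk (h.process.measurable t))

theorem PoissonKeys.lintegral_arrived_le [IsProbabilityMeasure μ]
    [IsProbabilityMeasure P] (h : PoissonKeys μ P X N) (t : ℝ≥0)
    {Φ Ψ : List (Lex (ℕ → A)) → ℝ}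
    (hΦ : ∀ n, Measurable fun x : ℕ → ℕ → A => Φ (wordList x n))
    (hΨ : ∀ n, Measurable fun x : ℕ → ℕ → A => Ψ (wordList x n))
    (hle : ∀ n, ∫⁻ x, ENNReal.ofReal (Φ (wordList x n)) ∂(keyLaw μ) ≤
      ∫⁻ x, ENNReal.ofReal (Ψ (wordList x n)) ∂(keyLaw μ)) :
    ∫⁻ ω, ENNReal.ofReal (Φ (arrived X N t ω)) ∂P ≤
      ∫⁻ ω, ENNReal.ofReal (Ψ (arrived X N t ω)) ∂P := by
  have h1 := h.lintegral_eq (fun x _ n => ENNReal.ofReal (Φ (wordList x n)))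
    (fun _ n => (hΦ n).ennreal_ofReal) t t
  have h2 := h.lintegral_eq (fun x _ n => ENNReal.ofReal (Ψ (wordList x n)))
    (fun _ n => (hΨ n).ennreal_ofReal) t t
  simp only [arrived]
  rw [h1, h2]
  exact lintegral_mono fun ω => hle _

end Counts

/-! ### Thinning by prefixes and second moments at one level. -/

section PrefixCounts

variable {A Ω : Type*} [LinearOrder A] {X : ℕ → Ω → ℕ → A} {N : ℝ≥0 → Ω → ℕ}

/-- The number of keys with prefix `w` that have arrived by time `t`. -/
def arrivedCount (X : ℕ → Ω → ℕ → A) (N : ℝ≥0 → Ω → ℕ) {k : ℕ} (w : Fin k → A) (t : ℝ≥0) (ω : Ω) :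
    ℕ := prefixCount w (fun i => X i ω) (N t ω)

theorem cast_arrivedCount {k : ℕ} (w : Fin k → A) (t : ℝ≥0) (ω : Ω) :
    (arrivedCount X N w t ω : ℝ) = ∑ i ∈ Finset.range (N t ω),
      {y : ℕ → A | HasPrefix w (toLex y)}.indicator 1 (X i ω) := by
  rw [arrivedCount, prefixCount_eq_sum]
  push_cast
  exact Finset.sum_congr rfl fun i _ => by simp [Set.indicator]

/-- Different words of one length select disjoint sets of keys, so the cross terms factor into
means, which are zero. -/
theorem orderAvg_sum_keyDev_sq [Fintype A] (s : Finset (Lex (ℕ → A))) (k : ℕ) :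
    orderAvg s (fun l => (∑ w : Fin k → A, keyDev (l.filter (HasPrefix w))) ^ 2) =
      orderAvg s fun l => ∑ w : Fin k → A, keyVar (l.filter (HasPrefix w)).length := by
  have e1 : orderAvg s (fun l => (∑ w : Fin k → A, keyDev (l.filter (HasPrefix w))) ^ 2) =
      ∑ w : Fin k → A, ∑ w' : Fin k → A, orderAvg s (fun l =>
        keyDev (l.filter (HasPrefix w)) * keyDev (l.filter (HasPrefix w'))) := by
    simp only [← orderAvg_sum]
    refine orderAvg_congr fun l _ => ?_
    rw [sq, Finset.sum_mul_sum]
  rw [e1, orderAvg_sum]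
  refine Finset.sum_congr rfl fun w _ => ?_
  rw [Finset.sum_eq_single w]
  · have := orderAvg_mul_keyDev_filter_sq s (HasPrefix w) fun _ => 1
    simp only [one_mul] at this
    rw [← this]
    exact orderAvg_congr fun l _ => by rw [sq]
  · intro w' _ hw
    rw [orderAvg_filter_mul_filter s (HasPrefix w) (HasPrefix w')
      (fun x hx hx' => hw (hx'.unique hx)) keyDev keyDev, orderAvg_keyDev, zero_mul]
  · simp

variable [MeasurableSpace A] [DiscreteMeasurableSpace A] [MeasurableSpace Ω]
  {μ : Measure (ℕ → A)} {P : Measure Ω}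

theorem PoissonKeys.measurable_arrivedCount (h : PoissonKeys μ P X N) {k : ℕ} (w : Fin k → A)
    (t : ℝ≥0) :
    Measurable (arrivedCount X N w t) :=
  have hG : Measurable fun z : (ℕ → ℕ → A) × ℕ => prefixCount w z.1 z.2 :=
    measurable_from_prod_countable_left fun n => measurable_prefixCount w n
  hG.comp (h.measurable_keys.prodMk (h.process.measurable t))

theorem measurable_comp_prefixCount {k : ℕ} (w : Fin k → A) (n : ℕ) (g : ℕ → ℝ) :
    Measurable fun x : ℕ → ℕ → A => g ((wordList x n).filter (HasPrefix w)).length :=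
  (Measurable.of_discrete (f := g)).comp (measurable_prefixCount w n)

theorem measurable_keyDev_filter [Fintype A] {k : ℕ} (w : Fin k → A) (n : ℕ) :
    Measurable fun x : ℕ → ℕ → A => keyDev ((wordList x n).filter (HasPrefix w)) := by
  have h1 : Measurable fun x : ℕ → ℕ → A =>
      (keyCount ((wordList x n).filter (HasPrefix w)) : ℝ) :=
    measurable_from_nat.comp (measurable_keyCount_filter w n)
  have h2 : Measurable fun x : ℕ → ℕ → A => keyMean (prefixCount w x n) :=
    (Measurable.of_discrete (f := keyMean)).comp (measurable_prefixCount w n)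
  exact h1.sub h2

theorem measurable_keyRatio [Fintype A] {k : ℕ} (w : Fin k → A) (n : ℕ) :
    Measurable fun x : ℕ → ℕ → A => keyRatio (HasPrefix w) (wordList x n) := by
  have h2 : Measurable fun x : ℕ → ℕ → A => ((prefixCount w x n : ℕ) : ℝ) :=
    measurable_from_nat.comp (measurable_prefixCount w n)
  exact (measurable_keyDev_filter w n).div (h2.add_const 1)

theorem PoissonKeys.measurable_keyDev [Fintype A] (h : PoissonKeys μ P X N) {k : ℕ}
    (w : Fin k → A) (t : ℝ≥0) :
    Measurable fun ω => keyDev ((arrived X N t ω).filter (HasPrefix w)) :=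
  h.measurable_of_wordList (fun l => keyDev (l.filter fun y => decide (HasPrefix w y)))
    (measurable_keyDev_filter w) t

theorem PoissonKeys.measurable_keyRatio_arrived [Fintype A] (h : PoissonKeys μ P X N) {k : ℕ}
    (w : Fin k → A) (t : ℝ≥0) :
    Measurable fun ω => keyRatio (HasPrefix w) (arrived X N t ω) :=
  h.measurable_of_wordList (keyRatio (HasPrefix w)) (measurable_keyRatio w) t

variable [IsProbabilityMeasure μ] [IsProbabilityMeasure P]

namespace PoissonKeys

theorem charFun_arrivedCount (h : PoissonKeys μ P X N) {k : ℕ} (w : Fin k → A) (t : ℝ≥0) (a : ℝ) :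
    charFun (P.map fun ω => (arrivedCount X N w t ω : ℝ)) a =
      Complex.exp (((prefixProb μ w).toNNReal * t : ℝ≥0) * (Complex.exp (a * Complex.I) - 1)) := by
  have h1 := h.integral_exp_counts t (measurableSet_hasPrefix w) MeasurableSet.empty
    (Set.disjoint_empty _) a 0
  have hm : Measurable fun ω => (arrivedCount X N w t ω : ℝ) :=
    measurable_from_nat.comp (h.measurable_arrivedCount w t)
  rw [charFun_apply_real, integral_map hm.aemeasurable
    (Measurable.aestronglyMeasurable (by fun_prop))]
  simp only [cast_arrivedCount]
  simp only [zero_mul, add_zero, Complex.ofReal_zero, Complex.exp_zero, sub_self, mul_zero,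
    mul_one] at h1
  refine Eq.trans (integral_congr_ae (Eventually.of_forall fun ω => ?_)) h1
  push_cast
  rfl

/-- Poisson thinning, read off from the characteristic function. -/
theorem map_arrivedCount (h : PoissonKeys μ P X N) {k : ℕ} (w : Fin k → A) (t : ℝ≥0) :
    P.map (arrivedCount X N w t) = poissonMeasure ((prefixProb μ w).toNNReal * t) := by
  have hm := h.measurable_arrivedCount w t
  apply (MeasurableEmbedding.natCast (α := ℝ)).map_injective
  have : IsProbabilityMeasure (P.map fun ω => (arrivedCount X N w t ω : ℝ)) :=
    Measure.isProbabilityMeasure_map (measurable_from_nat.comp hm).aemeasurable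
  rw [Measure.map_map measurable_from_nat hm]
  apply Measure.ext_of_charFun
  ext a
  rw [charFun_map_cast_poissonMeasure]
  exact h.charFun_arrivedCount w t a

/-- Keys with different prefixes of the same length lie in disjoint sets, so the joint
characteristic function is a product. -/
theorem indepFun_arrivedCount (h : PoissonKeys μ P X N) {k : ℕ} {w w' : Fin k → A} (hw : w ≠ w')
    (t : ℝ≥0) : IndepFun (arrivedCount X N w t) (arrivedCount X N w' t) P := by
  have hm : ∀ v : Fin k → A, Measurable fun ω => (arrivedCount X N v t ω : ℝ) := fun v =>
    measurable_from_nat.comp (h.measurable_arrivedCount v t)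
  have h1 : IndepFun (fun ω => (arrivedCount X N w t ω : ℝ))
      (fun ω => (arrivedCount X N w' t ω : ℝ)) P := by
    rw [indepFun_iff_charFun_prod (hm w).aemeasurable (hm w').aemeasurable]
    intro s
    have hd : Disjoint {y : ℕ → A | HasPrefix w (toLex y)} {y | HasPrefix w' (toLex y)} :=
      Set.disjoint_left.2 fun y hy hy' => hw (HasPrefix.unique hy hy')
    have h2 := h.integral_exp_counts t (measurableSet_hasPrefix w) (measurableSet_hasPrefix w') hd
      s.ofLp.1 s.ofLp.2
    rw [h.charFun_arrivedCount, h.charFun_arrivedCount]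
    refine Eq.trans ?_ h2
    rw [charFun_apply, integral_map (by fun_prop) (by fun_prop)]
    refine integral_congr_ae (Eventually.of_forall fun ω => ?_)
    simp only [← cast_arrivedCount]
    simp [WithLp.prod_inner_apply]
  -- The floor recovers the integer counts from their real copies.
  have h3 := h1.comp (φ := Nat.floor) (ψ := Nat.floor) Nat.measurable_floor Nat.measurable_floor
  simpa [Function.comp_def] using h3

theorem lintegral_arrivedCount (h : PoissonKeys μ P X N) {k : ℕ} (w : Fin k → A) (t : ℝ≥0)
    (f : ℕ → ℝ≥0∞) : ∫⁻ ω, f (arrivedCount X N w t ω) ∂P =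
      ∫⁻ n, f n ∂(poissonMeasure ((prefixProb μ w).toNNReal * t)) := by
  rw [← h.map_arrivedCount, lintegral_map .of_discrete (h.measurable_arrivedCount w t)]

end PoissonKeys

variable [Fintype A]

namespace PoissonKeys

/-- Moments of functionals of the keys that have arrived by time `t` may be averaged over all
orders of arrival. -/
theorem lintegral_arrived_orderAvg_le (h : PoissonKeys μ P X N) (hμ : SummableSource μ) (t : ℝ≥0)
    {Φ Ψ : List (Lex (ℕ → A)) → ℝ} (hΦ0 : ∀ l, 0 ≤ Φ l) (hΨ0 : ∀ l, 0 ≤ Ψ l)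
    (hΦ : ∀ n, Measurable fun x : ℕ → ℕ → A => Φ (wordList x n))
    (hΨ : ∀ n, Measurable fun x : ℕ → ℕ → A => Ψ (wordList x n))
    (hle : ∀ s : Finset (Lex (ℕ → A)), orderAvg s Φ ≤ orderAvg s Ψ) :
    ∫⁻ ω, ENNReal.ofReal (Φ (arrived X N t ω)) ∂P ≤
      ∫⁻ ω, ENNReal.ofReal (Ψ (arrived X N t ω)) ∂P :=
  h.lintegral_arrived_le t hΦ hΨ fun n =>
    lintegral_wordList_le μ hμ n hΦ0 hΨ0 (hΦ n) (hΨ n) fun s _ => hle s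

theorem lintegral_mul_keyDev_sq_le (h : PoissonKeys μ P X N) (hμ : SummableSource μ) {k : ℕ}
    (w : Fin k → A) (t : ℝ≥0) {g : ℕ → ℝ} (hg : ∀ n, 0 ≤ g n) :
    ∫⁻ ω, ENNReal.ofReal (g (arrivedCount X N w t ω) *
        keyDev ((arrived X N t ω).filter (HasPrefix w)) ^ 2) ∂P ≤
      ∫⁻ n, ENNReal.ofReal (g n * keyVar n)
        ∂(poissonMeasure ((prefixProb μ w).toNNReal * t)) := by
  rw [← h.lintegral_arrivedCount w t fun n => ENNReal.ofReal (g n * keyVar n)]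
  have hle : ∀ s : Finset (Lex (ℕ → A)),
      orderAvg s (fun l => g (l.filter (HasPrefix w)).length *
        keyDev (l.filter (HasPrefix w)) ^ 2) ≤
      orderAvg s (fun l => g (l.filter (HasPrefix w)).length *
        keyVar (l.filter (HasPrefix w)).length) := fun s =>
    (orderAvg_mul_keyDev_filter_sq s (HasPrefix w) g).le
  exact h.lintegral_arrived_orderAvg_le hμ t
    (Φ := fun l => g (l.filter (HasPrefix w)).length * keyDev (l.filter (HasPrefix w)) ^ 2)
    (Ψ := fun l => g (l.filter (HasPrefix w)).length * keyVar (l.filter (HasPrefix w)).length)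
    (fun l => mul_nonneg (hg _) (sq_nonneg _)) (fun l => mul_nonneg (hg _) (keyVar_nonneg _))
    (fun n => (measurable_comp_prefixCount w n g).mul ((measurable_keyDev_filter w n).pow_const 2))
    (fun n => (measurable_comp_prefixCount w n g).mul (measurable_comp_prefixCount w n keyVar))
    hle

theorem lintegral_poisson_keyVar_le (r : ℝ≥0) :
    ∫⁻ n, ENNReal.ofReal (keyVar n) ∂(poissonMeasure r) ≤ ENNReal.ofReal (40 * r ^ 2) :=
  calc ∫⁻ n, ENNReal.ofReal (keyVar n) ∂(poissonMeasure r)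
      ≤ ∫⁻ n, ENNReal.ofReal 40 * ((n * (n - 1) : ℕ) : ℝ≥0∞) ∂(poissonMeasure r) := by
        refine lintegral_mono fun n => ?_
        rw [← ENNReal.ofReal_natCast, ← ENNReal.ofReal_mul (by norm_num)]
        apply ENNReal.ofReal_le_ofReal
        refine (keyVar_le n).trans_eq ?_
        rcases n with _ | n <;> simp
    _ = ENNReal.ofReal (40 * r ^ 2) := by
        rw [lintegral_const_mul _ .of_discrete, lintegral_poisson_mul_sub_one,
          ← ENNReal.coe_pow, ← ENNReal.ofReal_coe_nnreal, ← ENNReal.ofReal_mul (by norm_num)]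
        push_cast
        rfl

theorem lintegral_sum_keyDev_sq_le (h : PoissonKeys μ P X N) (hμ : SummableSource μ) (k : ℕ)
    (t : ℝ≥0) :
    ∫⁻ ω, ENNReal.ofReal ((∑ w : Fin k → A,
        keyDev ((arrived X N t ω).filter (HasPrefix w))) ^ 2) ∂P ≤
      ENNReal.ofReal (40 * t ^ 2 * ∑ w : Fin k → A, prefixProb μ w ^ 2) := by
  have hΦ : ∀ n, Measurable fun x : ℕ → ℕ → A =>
      (∑ w : Fin k → A, keyDev ((wordList x n).filter (HasPrefix w))) ^ 2 := fun n =>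
    (Finset.measurable_sum _ fun w _ => measurable_keyDev_filter w n).pow_const 2
  have hΨ : ∀ n, Measurable fun x : ℕ → ℕ → A =>
      ∑ w : Fin k → A, keyVar ((wordList x n).filter (HasPrefix w)).length := fun n =>
    Finset.measurable_sum _ fun w _ => measurable_comp_prefixCount w n keyVar
  have hΨ0 : ∀ l : List (Lex (ℕ → A)),
      0 ≤ ∑ w : Fin k → A, keyVar (l.filter (HasPrefix w)).length := fun l =>
    Finset.sum_nonneg fun w _ => keyVar_nonneg _
  refine (h.lintegral_arrived_orderAvg_le hμ t (fun l => sq_nonneg _) hΨ0 hΦ hΨ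
    fun s => (orderAvg_sum_keyDev_sq s k).le).trans ?_
  have hsum : ∀ ω, ENNReal.ofReal (∑ w : Fin k → A,
      keyVar ((arrived X N t ω).filter (HasPrefix w)).length) =
      ∑ w : Fin k → A, ENNReal.ofReal (keyVar (arrivedCount X N w t ω)) := fun ω =>
    ENNReal.ofReal_sum_of_nonneg fun w _ => keyVar_nonneg _
  have hm : ∀ w : Fin k → A,
      Measurable fun ω => ENNReal.ofReal (keyVar (arrivedCount X N w t ω)) := fun w =>
    (Measurable.of_discrete (f := fun n => ENNReal.ofReal (keyVar n))).comp
      (h.measurable_arrivedCount w t)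
  simp only [hsum]
  rw [lintegral_finsetSum _ fun w _ => hm w, Finset.mul_sum,
    ENNReal.ofReal_sum_of_nonneg fun w _ => by positivity]
  refine Finset.sum_le_sum fun w _ => ?_
  refine (h.lintegral_arrivedCount w t fun n => ENNReal.ofReal (keyVar n)).trans_le ?_
  refine (lintegral_poisson_keyVar_le _).trans_eq ?_
  congr 1
  push_cast
  rw [Real.coe_toNNReal (prefixProb μ w) measureReal_nonneg]
  ring

/-- Independence of keys and process lets N(s) ≤ N(t) be treated as fixed numbers m ≤ n, to which
the martingale identity applies. -/
theorem lintegral_keyRatio_sub_sq (h : PoissonKeys μ P X N) (hμ : SummableSource μ) {k : ℕ}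
    (w : Fin k → A) {s t : ℝ≥0} (hst : s ≤ t) :
    ∫⁻ ω, ENNReal.ofReal ((keyRatio (HasPrefix w) (arrived X N t ω) -
        keyRatio (HasPrefix w) (arrived X N s ω)) ^ 2) ∂P =
      ∫⁻ ω, ENNReal.ofReal (ratioVar (arrivedCount X N w t ω) -
        ratioVar (arrivedCount X N w s ω)) ∂P := by
  have h1 := h.lintegral_eq (fun x m n => ENNReal.ofReal ((keyRatio (HasPrefix w) (wordList x n) -
        keyRatio (HasPrefix w) (wordList x m)) ^ 2))
    (fun m n => (((measurable_keyRatio w n).sub (measurable_keyRatio w m)).pow_const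
      2).ennreal_ofReal) s t
  have h2 := h.lintegral_eq (fun x m n => ENNReal.ofReal (ratioVar (prefixCount w x n) -
        ratioVar (prefixCount w x m)))
    (fun m n => ((measurable_comp_prefixCount w n ratioVar).sub
      (measurable_comp_prefixCount w m ratioVar)).ennreal_ofReal) s t
  refine h1.trans (Eq.trans ?_ h2.symm)
  refine lintegral_congr_ae ?_
  filter_upwards [h.process.mono] with ω hω
  have hmn : N s ω ≤ N t ω := hω hst
  generalize N s ω = m at hmn
  generalize N t ω = n at hmn
  -- Symmetrization needs functionals that are nonnegative on all lists. The maximum with 0 is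
  -- inactive here because `ratioVar` is monotone.
  have h3 := lintegral_wordList_congr μ hμ n
    (Φ := fun l => (keyRatio (HasPrefix w) l - keyRatio (HasPrefix w) (l.take m)) ^ 2)
    (Ψ := fun l => max 0 (ratioVar (l.filter (HasPrefix w)).length -
      ratioVar ((l.take m).filter (HasPrefix w)).length))
    (fun _ => sq_nonneg _) (fun _ => le_max_left _ _) ?_ ?_ ?_
  · simp only [take_wordList _ hmn] at h3
    rw [h3]
    refine lintegral_congr fun x => ?_
    rw [max_eq_right]
    · rfl
    · exact sub_nonneg.2 (ratioVar_mono (prefixCount_mono w x hmn))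
  · simp only [take_wordList _ hmn]
    exact ((measurable_keyRatio w n).sub (measurable_keyRatio w m)).pow_const 2
  · simp only [take_wordList _ hmn]
    exact measurable_const.max ((measurable_comp_prefixCount w n ratioVar).sub
      (measurable_comp_prefixCount w m ratioVar))
  · intro s hs
    rw [orderAvg_keyRatio_sub_sq s _ m (by omega)]
    refine orderAvg_congr fun l _ => (max_eq_right (sub_nonneg.2 (ratioVar_mono ?_))).symm
    exact ((List.take_sublist m l).filter _).length_le

theorem lintegral_keyVar_le (h : PoissonKeys μ P X N) (hμ : SummableSource μ) (L : ℕ) (c : ℝ)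
    (t : ℝ≥0) :
    ∫⁻ n, ENNReal.ofReal (keyVar n) ∂(poissonMeasure t) ≤ ∫⁻ ω, ENNReal.ofReal
      (((∑ k ∈ Finset.range (L + 1), (levelCount k (arrived X N t ω) : ℝ)) - c) ^ 2) ∂P := by
  have hlevel : ∀ k n, Measurable fun x : ℕ → ℕ → A => (levelCount k (wordList x n) : ℝ) := by
    intro k n
    refine measurable_from_nat.comp ?_
    exact Finset.measurable_sum _ fun w _ => measurable_keyCount_filter w n
  have h1 := h.lintegral_arrived_orderAvg_le hμ t (Φ := fun l => keyVar l.length)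
    (Ψ := fun l => ((∑ k ∈ Finset.range (L + 1), (levelCount k l : ℝ)) - c) ^ 2)
    (fun _ => keyVar_nonneg _) (fun _ => sq_nonneg _) (fun n => by
      simp only [length_wordList]; exact measurable_const)
    (fun n => ((Finset.measurable_sum _ fun k _ => hlevel k n).sub_const c).pow_const 2) ?_
  · refine le_trans (le_of_eq ?_) h1
    simp only [arrived, length_wordList]
    rw [← h.map_count t, lintegral_map .of_discrete (h.process.measurable t)]
  · intro s
    have e : orderAvg s (fun l => keyVar l.length) = keyVar s.card := by
      rw [orderAvg_congr (Ψ := fun _ => keyVar s.card), orderAvg_const]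
      exact fun l hl => by rw [hl.length]
    rw [e]
    -- Level 0 is the count over all keys, so the intervals are given by the prefixes of lengths 1
    -- to L.
    refine (keyVar_le_orderAvg s ((Finset.range L).sigma fun k => (Finset.univ :
      Finset (Fin (k + 1) → A))) (fun i => HasPrefix i.2)
      (fun i _ => convexPred_hasPrefix _) c).trans_eq ?_
    refine orderAvg_congr fun l _ => ?_
    rw [Finset.sum_range_succ', levelCount_zero, Finset.sum_sigma, add_comm]
    simp only [levelCount]
    push_cast
    rfl

end PoissonKeys

end PrefixCounts

/-! ### Square integrable variables, centering and convergence criteria. -/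

section SquareIntegrable

variable {Ω : Type*} [MeasurableSpace Ω] {P : Measure Ω}

theorem eLpNorm_two_sq (f : Ω → ℝ) (P : Measure Ω) :
    eLpNorm f 2 P ^ 2 = ∫⁻ ω, ENNReal.ofReal (f ω ^ 2) ∂P := by
  have h := eLpNorm_nnreal_pow_eq_lintegral (f := f) (μ := P) (p := 2) two_ne_zero
  simp only [NNReal.coe_ofNat, ENNReal.rpow_ofNat, ENNReal.coe_ofNat] at h
  rw [h]
  refine lintegral_congr fun ω => ?_
  rw [← ofReal_norm, ← ENNReal.ofReal_pow (norm_nonneg _), Real.norm_eq_abs, sq_abs]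

theorem memLp_two_of_lintegral_le {f : Ω → ℝ} (hf : AEStronglyMeasurable f P) {C : ℝ}
    (h : ∫⁻ ω, ENNReal.ofReal (f ω ^ 2) ∂P ≤ ENNReal.ofReal C) : MemLp f 2 P := by
  refine ⟨hf, ?_⟩
  rw [← eLpNorm_two_sq] at h
  by_contra hc
  rw [not_lt_top_iff.1 hc] at h
  simp at h

theorem norm_toLp_sq {f : Ω → ℝ} (hf : MemLp f 2 P) :
    ENNReal.ofReal (‖hf.toLp f‖ ^ 2) = ∫⁻ ω, ENNReal.ofReal (f ω ^ 2) ∂P := by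
  rw [Lp.norm_toLp, ← eLpNorm_two_sq, ENNReal.ofReal_pow ENNReal.toReal_nonneg,
    ENNReal.ofReal_toReal hf.2.ne]

theorem norm_toLp_sq_le {f : Ω → ℝ} (hf : MemLp f 2 P) {C : ℝ} (hC : 0 ≤ C)
    (h : ∫⁻ ω, ENNReal.ofReal (f ω ^ 2) ∂P ≤ ENNReal.ofReal C) : ‖hf.toLp f‖ ^ 2 ≤ C := by
  rwa [← norm_toLp_sq hf, ENNReal.ofReal_le_ofReal_iff hC] at h

/-- Convergence of L²-bounded martingales in abstract form: the monotone bounded function `e`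
converges, which makes `f` Cauchy. -/
theorem exists_tendsto_of_dist_sq_le {E : Type*} [MetricSpace E] [CompleteSpace E] {f : ℝ≥0 → E}
    {e : ℝ≥0 → ℝ} {B : ℝ} (hB : ∀ t, e t ≤ B)
    (h : ∀ s t, s ≤ t → dist (f s) (f t) ^ 2 ≤ e t - e s) :
    ∃ y, Tendsto f atTop (𝓝 y) := by
  have hmono : Monotone e := fun s t hst => sub_nonneg.1 ((sq_nonneg _).trans (h s t hst))
  have hbdd : BddAbove (Set.range e) := ⟨B, by rintro _ ⟨t, rfl⟩; exact hB t⟩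
  have htend := tendsto_atTop_ciSup hmono hbdd
  set S := ⨆ t, e t
  have hlim : Tendsto (fun t => 2 * √(S - e t)) atTop (𝓝 0) := by
    simpa using ((tendsto_const_nhds (x := S)).sub htend).sqrt.const_mul 2
  refine cauchySeq_tendsto_of_complete (cauchySeq_of_le_tendsto_0 _ (fun s t u hs ht => ?_) hlim)
  have key : ∀ v, u ≤ v → dist (f u) (f v) ≤ √(S - e u) := fun v hv => by
    apply Real.le_sqrt_of_sq_le
    have h1 := le_ciSup hbdd v
    have h2 := h u v hv
    linarith
  have h1 := dist_triangle_left (f s) (f t) (f u)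
  have h2 := key s hs
  have h3 := key t ht
  linarith

theorem integral_toLp {f : Ω → ℝ} (hf : MemLp f 2 P) : ∫ ω, hf.toLp f ω ∂P = ∫ ω, f ω ∂P :=
  integral_congr_ae hf.coeFn_toLp

/-- A series of square integrable random variables that is absolutely convergent in norm and
almost surely eventually constant converges in norm to its pointwise sum. -/
theorem hasSum_toLp_of_eventually {s : ℕ → Ω → ℝ} (hs : ∀ k, MemLp (s k) 2 P)
    (hsum : Summable fun k => ‖(hs k).toLp (s k)‖) {S : Ω → ℝ}
    (h : ∀ᵐ ω ∂P, ∀ᶠ L in atTop, ∑ k ∈ Finset.range L, s k ω = S ω) :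
    ∃ hS : MemLp S 2 P, HasSum (fun k => (hs k).toLp (s k)) (hS.toLp S) := by
  obtain ⟨F, hF⟩ := hsum.of_norm
  -- Norm convergence yields an almost surely convergent subsequence, which identifies the limit
  -- with the pointwise sum.
  have h1 := tendstoInMeasure_of_tendsto_Lp hF.tendsto_sum_nat
  obtain ⟨ns, hns, hlim⟩ := h1.exists_seq_tendsto_ae
  have hpart : ∀ᵐ ω ∂P, ∀ L, (∑ k ∈ Finset.range L, (hs k).toLp (s k) : Lp ℝ 2 P) ω =
      ∑ k ∈ Finset.range L, s k ω := by
    rw [ae_all_iff]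
    intro L
    filter_upwards [Lp.coeFn_finsetSum (Finset.range L) fun k => (hs k).toLp (s k),
      ae_all_iff.2 fun k => (hs k).coeFn_toLp] with ω h2 h3
    rw [h2, Finset.sum_apply]
    exact Finset.sum_congr rfl fun k _ => h3 k
  have hFS : F =ᵐ[P] S := by
    filter_upwards [hlim, hpart, h] with ω h2 h3 h4
    refine tendsto_nhds_unique h2 (tendsto_const_nhds.congr' ?_)
    filter_upwards [hns.tendsto_atTop.eventually h4] with i hi
    rw [h3, hi]
  have hS : MemLp S 2 P := (memLp_congr_ae hFS).1 (Lp.memLp F)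
  refine ⟨hS, ?_⟩
  have : hS.toLp S = F := by
    rw [← Lp.toLp_coeFn F (Lp.memLp F)]
    exact MemLp.toLp_congr _ _ hFS.symm
  rwa [this]

variable [IsProbabilityMeasure P]

/-- Subtraction of the mean, as an operator on square integrable random variables. -/
noncomputable def centering (P : Measure Ω) [IsProbabilityMeasure P] :
    Lp ℝ 2 P →L[ℝ] Lp ℝ 2 P :=
  ContinuousLinearMap.id ℝ _ -
    (innerSL ℝ (Lp.const 2 P (1 : ℝ))).smulRight (Lp.const 2 P (1 : ℝ))

theorem norm_const_one : ‖Lp.const 2 P (1 : ℝ)‖ = 1 := by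
  rw [Lp.norm_const 2 P (1 : ℝ) two_ne_zero]
  simp

theorem inner_one (f : Lp ℝ 2 P) : inner ℝ (Lp.const 2 P (1 : ℝ)) f = ∫ ω, f ω ∂P := by
  rw [L2.inner_def]
  refine integral_congr_ae ?_
  filter_upwards [Lp.coeFn_const (p := 2) (μ := P) (1 : ℝ)] with ω hω
  simp

theorem centering_apply (f : Lp ℝ 2 P) :
    centering P f = f - (∫ ω, f ω ∂P) • Lp.const 2 P (1 : ℝ) := by
  simp [centering, inner_one]

theorem norm_centering_sq_eq (f : Lp ℝ 2 P) :
    ‖centering P f‖ ^ 2 = ‖f‖ ^ 2 - (∫ ω, f ω ∂P) ^ 2 := by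
  rw [centering_apply, norm_sub_sq_real, inner_smul_right, real_inner_comm, inner_one, norm_smul,
    norm_const_one, Real.norm_eq_abs, mul_one, sq_abs]
  ring

theorem norm_centering_le (f : Lp ℝ 2 P) : ‖centering P f‖ ≤ ‖f‖ := by
  refine le_of_sq_le_sq ?_ (norm_nonneg _)
  rw [norm_centering_sq_eq]
  nlinarith [sq_nonneg (∫ ω, f ω ∂P)]

theorem centering_centering (f : Lp ℝ 2 P) : centering P (centering P f) = centering P f := by
  have h : ∫ ω, centering P f ω ∂P = 0 := by
    rw [← inner_one, centering_apply, inner_sub_right, inner_smul_right,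
      real_inner_self_eq_norm_sq, norm_const_one, inner_one]
    ring
  rw [centering_apply (centering P f), h]
  simp

theorem centering_toLp {f : Ω → ℝ} (hf : MemLp f 2 P) :
    centering P (hf.toLp f) = (hf.sub (memLp_const (∫ ω, f ω ∂P))).toLp _ := by
  rw [centering_apply, integral_toLp]
  apply Lp.ext
  filter_upwards [Lp.coeFn_sub (hf.toLp f) ((∫ ω, f ω ∂P) • Lp.const 2 P (1 : ℝ)),
    Lp.coeFn_smul (∫ ω, f ω ∂P) (Lp.const 2 P (1 : ℝ)), hf.coeFn_toLp,
    Lp.coeFn_const (p := 2) (μ := P) (1 : ℝ),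
    (hf.sub (memLp_const (∫ ω, f ω ∂P))).coeFn_toLp] with ω h1 h2 h3 h4 h5
  rw [h1, h5, Pi.sub_apply, h2, Pi.smul_apply, h3, h4]
  simp

theorem norm_centering_toLp_sq {f : Ω → ℝ} (hf : MemLp f 2 P) :
    ‖centering P (hf.toLp f)‖ ^ 2 = variance f P := by
  have h : ‖hf.toLp f‖ ^ 2 = ∫ ω, f ω ^ 2 ∂P := by
    rw [← real_inner_self_eq_norm_sq, L2.inner_def]
    refine integral_congr_ae ?_
    filter_upwards [hf.coeFn_toLp] with ω hω
    simp [hω, sq]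
  rw [norm_centering_sq_eq, integral_toLp, variance_eq_sub hf, h]
  rfl

theorem norm_le_norm_centering_add (f : Lp ℝ 2 P) : ‖f‖ ≤ ‖centering P f‖ + |∫ ω, f ω ∂P| := by
  have h := norm_add_le (centering P f) ((∫ ω, f ω ∂P) • Lp.const 2 P (1 : ℝ))
  rwa [norm_smul, norm_const_one, mul_one, centering_apply, sub_add_cancel, ← centering_apply] at h

end SquareIntegrable

theorem coe_toNNReal_prefixProb {A : Type*} [MeasurableSpace A] (μ : Measure (ℕ → A)) {k : ℕ}
    (w : Fin k → A) : ((prefixProb μ w).toNNReal : ℝ) = prefixProb μ w :=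
  Real.coe_toNNReal _ measureReal_nonneg

/-! ### Deviations at one prefix. -/

section Levels

variable {A : Type*} [LinearOrder A] [Fintype A] {Ω : Type*}

/-- The total deviation of the key comparison counts at level `k` from their conditional means. -/
noncomputable def levelDev (X : ℕ → Ω → ℕ → A) (N : ℝ≥0 → Ω → ℕ) (k : ℕ) (t : ℝ≥0) (ω : Ω) : ℝ :=
  ∑ w : Fin k → A, keyDev ((arrived X N t ω).filter (HasPrefix w))

/-- The total conditional mean of the key comparison counts at level `k`. -/
noncomputable def levelMean (X : ℕ → Ω → ℕ → A) (N : ℝ≥0 → Ω → ℕ) (k : ℕ) (t : ℝ≥0) (ω : Ω) :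
    ℝ := ∑ w : Fin k → A, keyMean (arrivedCount X N w t ω)

theorem levelCount_eq_add (X : ℕ → Ω → ℕ → A) (N : ℝ≥0 → Ω → ℕ) (k : ℕ) (t : ℝ≥0) (ω : Ω) :
    (levelCount k (arrived X N t ω) : ℝ) = levelDev X N k t ω + levelMean X N k t ω := by
  rw [levelCount, levelDev, levelMean, ← Finset.sum_add_distrib, Nat.cast_sum]
  refine Finset.sum_congr rfl fun w _ => ?_
  change _ = (_ - keyMean (arrivedCount X N w t ω)) + _
  rw [sub_add_cancel]

theorem lintegral_poisson_add_one_sub_sq (r : ℝ≥0) :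
    ∫⁻ n, ENNReal.ofReal (((n : ℝ) + 1 - r) ^ 2) ∂(poissonMeasure r) = ENNReal.ofReal (r + 1) := by
  -- To avoid subtraction in `ℝ≥0∞` the cross term 2rn is added on the left, and n² + 2n is written
  -- as n(n - 1) + 3n.
  have h1 : ∀ n : ℕ, ENNReal.ofReal (((n : ℝ) + 1 - r) ^ 2) + ENNReal.ofReal (2 * r) * (n : ℝ≥0∞) =
      ((n * (n - 1) : ℕ) : ℝ≥0∞) + ENNReal.ofReal 3 * (n : ℝ≥0∞) +
        ENNReal.ofReal ((1 - r) ^ 2) := fun n => by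
    rw [← ENNReal.ofReal_natCast n, ← ENNReal.ofReal_natCast (n * (n - 1)),
      ← ENNReal.ofReal_mul (by positivity), ← ENNReal.ofReal_mul (by positivity),
      ← ENNReal.ofReal_add (by positivity) (by positivity),
      ← ENNReal.ofReal_add (by positivity) (by positivity),
      ← ENNReal.ofReal_add (by positivity) (by positivity)]
    congr 1
    rcases n with _ | n
    · simp
    · push_cast [Nat.add_sub_cancel]; ring
  have h2 := lintegral_congr (μ := poissonMeasure r) h1
  rw [lintegral_add_right _ (by fun_prop), lintegral_add_right _ (by fun_prop),
    lintegral_add_right _ (by fun_prop), lintegral_const_mul _ (by fun_prop),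
    lintegral_const_mul _ (by fun_prop), lintegral_poisson_id, lintegral_poisson_mul_sub_one,
    lintegral_const, measure_univ, mul_one] at h2
  have h3 : ENNReal.ofReal (2 * r) * (r : ℝ≥0∞) = ENNReal.ofReal (2 * r ^ 2) := by
    rw [← ENNReal.ofReal_coe_nnreal, ← ENNReal.ofReal_mul (by positivity)]
    ring_nf
  have h4 : (r : ℝ≥0∞) ^ 2 + ENNReal.ofReal 3 * (r : ℝ≥0∞) + ENNReal.ofReal ((1 - r) ^ 2) =
      ENNReal.ofReal (r + 1) + ENNReal.ofReal (2 * r ^ 2) := by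
    rw [← ENNReal.ofReal_coe_nnreal, ← ENNReal.ofReal_pow (by positivity),
      ← ENNReal.ofReal_mul (by positivity),
      ← ENNReal.ofReal_add (by positivity) (by positivity),
      ← ENNReal.ofReal_add (by positivity) (by positivity),
      ← ENNReal.ofReal_add (by positivity) (by positivity)]
    ring_nf
  rw [h3, h4] at h2
  exact (ENNReal.add_left_inj ENNReal.ofReal_ne_top).1 h2

variable [MeasurableSpace A] [DiscreteMeasurableSpace A] [MeasurableSpace Ω]
  {μ : Measure (ℕ → A)} [IsProbabilityMeasure μ] {P : Measure Ω}
  [IsProbabilityMeasure P] {X : ℕ → Ω → ℕ → A} {N : ℝ≥0 → Ω → ℕ}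

namespace PoissonKeys

theorem memLp_keyDev (h : PoissonKeys μ P X N) (hμ : SummableSource μ) {k : ℕ}
    (w : Fin k → A) (t : ℝ≥0) :
    MemLp (fun ω => keyDev ((arrived X N t ω).filter (HasPrefix w))) 2 P := by
  have h1 := h.lintegral_mul_keyDev_sq_le hμ w t (g := fun _ => 1) fun _ => zero_le_one
  simp only [one_mul] at h1
  exact memLp_two_of_lintegral_le (h.measurable_keyDev w t).aestronglyMeasurable
    (h1.trans (lintegral_poisson_keyVar_le _))

theorem memLp_keyRatio (h : PoissonKeys μ P X N) (hμ : SummableSource μ) {k : ℕ}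
    (w : Fin k → A) (t : ℝ≥0) :
    MemLp (fun ω => keyRatio (HasPrefix w) (arrived X N t ω)) 2 P := by
  refine memLp_two_of_lintegral_le (C := 40)
    (h.measurable_keyRatio_arrived w t).aestronglyMeasurable ?_
  have h1 := h.lintegral_mul_keyDev_sq_le hμ w t (g := fun n => (((n : ℝ) + 1) ^ 2)⁻¹)
    fun n => by positivity
  calc ∫⁻ ω, ENNReal.ofReal (keyRatio (HasPrefix w) (arrived X N t ω) ^ 2) ∂P
      = _ := lintegral_congr fun ω => by
        rw [keyRatio, div_pow, div_eq_inv_mul]; rfl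
    _ ≤ _ := h1
    _ ≤ ∫⁻ n, ENNReal.ofReal 40 ∂(poissonMeasure ((prefixProb μ w).toNNReal * t)) := by
        refine lintegral_mono fun n => ENNReal.ofReal_le_ofReal ?_
        rw [← div_eq_inv_mul]
        exact ratioVar_le n
    _ = ENNReal.ofReal 40 := by simp

/-- Squared L² increments equal increments of E `ratioVar` (N_w(t)), which is monotone in t and at
most 40. -/
theorem exists_tendsto_keyRatio (h : PoissonKeys μ P X N) (hμ : SummableSource μ) {k : ℕ}
    (w : Fin k → A) :
    ∃ R, Tendsto (fun t => (h.memLp_keyRatio hμ w t).toLp _) atTop (𝓝 R) := by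
  have hint : ∀ t, Integrable (fun ω => ratioVar (arrivedCount X N w t ω)) P := fun t =>
    Integrable.of_bound ((Measurable.of_discrete (f := ratioVar)).comp
      (h.measurable_arrivedCount w t)).aestronglyMeasurable 40 (Eventually.of_forall fun ω => by
        rw [Real.norm_of_nonneg (ratioVar_nonneg _)]; exact ratioVar_le _)
  refine exists_tendsto_of_dist_sq_le (e := fun t => ∫ ω, ratioVar (arrivedCount X N w t ω) ∂P)
    (B := 40) (fun t => ?_) fun s t hst => ?_
  · calc ∫ ω, ratioVar (arrivedCount X N w t ω) ∂P ≤ ∫ _, (40 : ℝ) ∂P :=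
        integral_mono (hint t) (integrable_const _) fun ω => ratioVar_le _
      _ = 40 := by simp
  · have hmono : 0 ≤ᵐ[P] fun ω => ratioVar (arrivedCount X N w t ω) -
        ratioVar (arrivedCount X N w s ω) := by
      filter_upwards [h.process.mono] with ω hω
      exact sub_nonneg.2 (ratioVar_mono (prefixCount_mono w _ (hω hst)))
    rw [← integral_sub (hint t) (hint s), dist_comm, dist_eq_norm, ← MemLp.toLp_sub]
    refine norm_toLp_sq_le _ (integral_nonneg_of_ae hmono) ?_
    refine le_trans ?_ (ofReal_integral_eq_lintegral_ofReal ((hint t).sub (hint s)) hmono).ge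
    exact (h.lintegral_keyRatio_sub_sq hμ w hst).le

/-- The difference is `keyRatio` times (N_w + 1)/t - p_w. Given N_w the ratio has second moment at
most 40, and E(N_w + 1 - p_w t)² = p_w t + 1. -/
theorem norm_keyDev_sub_sq_le (h : PoissonKeys μ P X N) (hμ : SummableSource μ) {k : ℕ}
    (w : Fin k → A) {t : ℝ≥0} (ht : 0 < t) :
    ‖(t : ℝ)⁻¹ • (h.memLp_keyDev hμ w t).toLp _ -
      prefixProb μ w • (h.memLp_keyRatio hμ w t).toLp _‖ ^ 2 ≤
      40 * (prefixProb μ w / t + (1 / t) ^ 2) := by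
  have ht' : (0 : ℝ) < t := ht
  have hp : 0 ≤ prefixProb μ w := measureReal_nonneg
  rw [← MemLp.toLp_const_smul, ← MemLp.toLp_const_smul, ← MemLp.toLp_sub]
  refine norm_toLp_sq_le _ (by positivity) ?_
  have h1 := h.lintegral_mul_keyDev_sq_le hμ w t
    (g := fun n => ((n + 1) / t - prefixProb μ w) ^ 2 * (((n : ℝ) + 1) ^ 2)⁻¹)
    fun n => by positivity
  set r := (prefixProb μ w).toNNReal * t with hr
  have hr' : (r : ℝ) = prefixProb μ w * t := by
    rw [hr, NNReal.coe_mul, coe_toNNReal_prefixProb]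
  refine le_trans (le_of_eq ?_) (h1.trans ?_)
  · refine lintegral_congr fun ω => ?_
    congr 1
    simp only [Pi.sub_apply, Pi.smul_apply, smul_eq_mul, keyRatio]
    change _ = ((((List.filter (fun b => decide (HasPrefix w b))
      (arrived X N t ω)).length : ℝ) + 1) / t -
      prefixProb μ w) ^ 2 * ((((List.filter (fun b => decide (HasPrefix w b))
        (arrived X N t ω)).length : ℝ) + 1) ^ 2)⁻¹ * _
    have : ((List.filter (fun b => decide (HasPrefix w b)) (arrived X N t ω)).length : ℝ) + 1 ≠ 0 :=
      by positivity
    field_simp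
  · calc _ ≤ ∫⁻ n, ENNReal.ofReal (40 / t ^ 2) * ENNReal.ofReal (((n : ℝ) + 1 - r) ^ 2)
          ∂(poissonMeasure r) := by
          refine lintegral_mono fun n => ?_
          rw [← ENNReal.ofReal_mul (by positivity)]
          apply ENNReal.ofReal_le_ofReal
          have e : ((n + 1) / t - prefixProb μ w) ^ 2 * (((n : ℝ) + 1) ^ 2)⁻¹ * keyVar n =
              (((n : ℝ) + 1 - r) ^ 2 / t ^ 2) * ratioVar n := by
            rw [hr', ratioVar]
            field_simp
          rw [e]
          calc _ ≤ (((n : ℝ) + 1 - r) ^ 2 / t ^ 2) * 40 := by gcongr; exact ratioVar_le n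
            _ = _ := by ring
      _ = ENNReal.ofReal (40 * (prefixProb μ w / t + (1 / t) ^ 2)) := by
          rw [lintegral_const_mul _ (by fun_prop), lintegral_poisson_add_one_sub_sq,
            ← ENNReal.ofReal_mul (by positivity), hr']
          congr 1
          field_simp

end PoissonKeys

end Levels

theorem tendsto_zero_of_le_add_div {f : ℝ≥0 → ℝ} {K : ℝ} (hf : ∀ t, 0 ≤ f t) (hK : 0 ≤ K)
    (h : ∀ ε, 0 < ε → ∃ C, ∀ t, 0 < t → f t ≤ ε * K + C / t) : Tendsto f atTop (𝓝 0) := by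
  refine tendsto_order.2 ⟨fun a ha => Eventually.of_forall fun t => ha.trans_le (hf t),
    fun δ hδ => ?_⟩
  obtain ⟨C, hC⟩ := h (δ / (2 * (K + 1))) (by positivity)
  have h1 : Tendsto (fun t : ℝ≥0 => C / (t : ℝ)) atTop (𝓝 0) :=
    tendsto_const_nhds.div_atTop (NNReal.tendsto_coe_atTop.2 tendsto_id)
  filter_upwards [h1.eventually (gt_mem_nhds (half_pos hδ)), eventually_gt_atTop 0] with t h2 h3
  have h4 : δ / (2 * (K + 1)) * K ≤ δ / 2 := by
    rw [div_mul_eq_mul_div, div_le_div_iff₀ (by positivity) (by positivity)]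
    nlinarith
  linarith [hC t h3]

/-! ### The summable sequence in the hypothesis. -/

section LevelNorm

variable {A : Type*} [Fintype A] [MeasurableSpace A]

/-- The norm of the vector of probabilities of the prefixes of length `k`. -/
noncomputable def levelNorm (μ : Measure (ℕ → A)) (k : ℕ) : ℝ :=
  √(∑ w : Fin k → A, prefixProb μ w ^ 2)

theorem levelNorm_sq (μ : Measure (ℕ → A)) (k : ℕ) :
    levelNorm μ k ^ 2 = ∑ w : Fin k → A, prefixProb μ w ^ 2 :=
  Real.sq_sqrt (by positivity)

theorem levelNorm_nonneg (μ : Measure (ℕ → A)) (k : ℕ) : 0 ≤ levelNorm μ k := Real.sqrt_nonneg _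

end LevelNorm

/-! ### Bounds and convergence at one level. -/

section Levels

variable {A : Type*} [LinearOrder A] {Ω : Type*}
  [MeasurableSpace A] [DiscreteMeasurableSpace A] [MeasurableSpace Ω]
  {μ : Measure (ℕ → A)} [IsProbabilityMeasure μ] {P : Measure Ω}
  [IsProbabilityMeasure P] {X : ℕ → Ω → ℕ → A} {N : ℝ≥0 → Ω → ℕ}

namespace PoissonKeys

theorem memLp_keyMean (h : PoissonKeys μ P X N) {k : ℕ} (w : Fin k → A) (t : ℝ≥0) :
    MemLp (fun ω => keyMean (arrivedCount X N w t ω)) 2 P := by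
  have h1 := (poisson_keyMean ((prefixProb μ w).toNNReal * t) zero_le_one le_rfl fun n => by
    simpa using harm_succ_sub_one_sq_le n).1
  rw [← h.map_arrivedCount] at h1
  exact h1.comp_of_map (h.measurable_arrivedCount w t).aemeasurable

theorem variance_keyMean_le (h : PoissonKeys μ P X N) {k : ℕ} (w : Fin k → A) (t : ℝ≥0) {ε C : ℝ}
    (hε : 0 ≤ ε) (hC : 0 ≤ C) (hh : ∀ n : ℕ, (harm (n + 1) - 1) ^ 2 ≤ ε * n + C) :
    variance (fun ω => keyMean (arrivedCount X N w t ω)) P ≤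
      4 * ε * t ^ 2 * prefixProb μ w ^ 2 + 4 * C * t * prefixProb μ w := by
  have h1 := (poisson_keyMean ((prefixProb μ w).toNNReal * t) hε hC hh).2
  rw [← h.map_arrivedCount, variance_map Measurable.of_discrete.aemeasurable
    (h.measurable_arrivedCount w t).aemeasurable] at h1
  refine h1.trans_eq ?_
  rw [NNReal.coe_mul, coe_toNNReal_prefixProb]
  ring

theorem integral_keyMean_le (h : PoissonKeys μ P X N) {k : ℕ} (w : Fin k → A) (t : ℝ≥0) :
    ∫ ω, keyMean (arrivedCount X N w t ω) ∂P ≤ t ^ 2 * prefixProb μ w ^ 2 := by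
  rw [integral_eq_lintegral_of_nonneg_ae (Eventually.of_forall fun ω => keyMean_nonneg _)
    (h.memLp_keyMean w t).1]
  refine ENNReal.toReal_le_of_le_ofReal (by positivity) ?_
  refine (h.lintegral_arrivedCount w t fun n => ENNReal.ofReal (keyMean n)).trans_le ?_
  calc ∫⁻ n, ENNReal.ofReal (keyMean n) ∂(poissonMeasure ((prefixProb μ w).toNNReal * t))
      ≤ ∫⁻ n, ((n * (n - 1) : ℕ) : ℝ≥0∞) ∂(poissonMeasure ((prefixProb μ w).toNNReal * t)) := by
        refine lintegral_mono fun n => ?_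
        rw [← ENNReal.ofReal_natCast]
        apply ENNReal.ofReal_le_ofReal
        refine (keyMean_le n).trans_eq ?_
        rcases n with _ | n <;> simp
    _ = ENNReal.ofReal (t ^ 2 * prefixProb μ w ^ 2) := by
        rw [lintegral_poisson_mul_sub_one, ← ENNReal.ofReal_coe_nnreal,
          ← ENNReal.ofReal_pow NNReal.zero_le_coe, NNReal.coe_mul, coe_toNNReal_prefixProb]
        ring_nf

end PoissonKeys

variable [Fintype A]

namespace PoissonKeys

theorem memLp_levelMean (h : PoissonKeys μ P X N) (k : ℕ) (t : ℝ≥0) :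
    MemLp (levelMean X N k t) 2 P :=
  memLp_finsetSum _ fun w _ => h.memLp_keyMean w t

theorem memLp_levelDev (h : PoissonKeys μ P X N) (hμ : SummableSource μ) (k : ℕ) (t : ℝ≥0) :
    MemLp (levelDev X N k t) 2 P :=
  memLp_finsetSum _ fun w _ => h.memLp_keyDev hμ w t

theorem memLp_levelCount (h : PoissonKeys μ P X N) (hμ : SummableSource μ) (k : ℕ) (t : ℝ≥0) :
    MemLp (fun ω => (levelCount k (arrived X N t ω) : ℝ)) 2 P := by
  simp only [levelCount_eq_add]
  exact (h.memLp_levelDev hμ k t).add (h.memLp_levelMean k t)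

theorem toLp_levelCount (h : PoissonKeys μ P X N) (hμ : SummableSource μ) (k : ℕ) (t : ℝ≥0) :
    (h.memLp_levelCount hμ k t).toLp _ =
      (h.memLp_levelDev hμ k t).toLp _ + (h.memLp_levelMean k t).toLp _ := by
  rw [← MemLp.toLp_add]
  exact MemLp.toLp_congr _ _ (Eventually.of_forall fun ω => levelCount_eq_add X N k t ω)

theorem variance_levelMean_le (h : PoissonKeys μ P X N) (k : ℕ) (t : ℝ≥0) {ε C : ℝ}
    (hε : 0 ≤ ε) (hC : 0 ≤ C) (hh : ∀ n : ℕ, (harm (n + 1) - 1) ^ 2 ≤ ε * n + C) :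
    variance (levelMean X N k t) P ≤
      4 * ε * t ^ 2 * ∑ w : Fin k → A, prefixProb μ w ^ 2 +
        4 * C * t * ∑ w : Fin k → A, prefixProb μ w := by
  have h1 : levelMean X N k t = ∑ w : Fin k → A, fun ω => keyMean (arrivedCount X N w t ω) := by
    ext ω
    rw [Finset.sum_apply]
    rfl
  rw [h1, IndepFun.variance_sum (fun w _ => h.memLp_keyMean w t)
    fun w _ w' _ hw => (h.indepFun_arrivedCount hw t).comp (φ := keyMean) (ψ := keyMean)
      .of_discrete .of_discrete, Finset.mul_sum, Finset.mul_sum, ← Finset.sum_add_distrib]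
  exact Finset.sum_le_sum fun w _ => h.variance_keyMean_le w t hε hC hh

/-- The constant 7 rounds up the square root of 40. -/
theorem norm_levelDev_le (h : PoissonKeys μ P X N) (hμ : SummableSource μ) (k : ℕ) (t : ℝ≥0) :
    ‖(h.memLp_levelDev hμ k t).toLp _‖ ≤ 7 * t * levelNorm μ k := by
  have h0 := levelNorm_nonneg μ k
  refine le_of_sq_le_sq ?_ (by positivity)
  refine (norm_toLp_sq_le _ (by positivity) (h.lintegral_sum_keyDev_sq_le hμ k t)).trans ?_
  rw [← levelNorm_sq]
  nlinarith [sq_nonneg (t * levelNorm μ k)]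

/-- Poincaré with slope 1 and no constant, and additivity of variance over independent counts. -/
theorem norm_centering_levelMean_le (h : PoissonKeys μ P X N) (k : ℕ) (t : ℝ≥0) :
    ‖centering P ((h.memLp_levelMean k t).toLp _)‖ ≤ 2 * t * levelNorm μ k := by
  have h0 := levelNorm_nonneg μ k
  refine le_of_sq_le_sq ?_ (by positivity)
  rw [norm_centering_toLp_sq]
  refine (h.variance_levelMean_le k t zero_le_one le_rfl fun n => by
    simpa using harm_succ_sub_one_sq_le n).trans_eq ?_
  rw [← levelNorm_sq]
  ring

theorem integral_levelMean_le (h : PoissonKeys μ P X N) (k : ℕ) (t : ℝ≥0) :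
    |∫ ω, levelMean X N k t ω ∂P| ≤ t ^ 2 * levelNorm μ k ^ 2 := by
  rw [abs_of_nonneg (integral_nonneg fun ω => Finset.sum_nonneg fun w _ => keyMean_nonneg _)]
  simp only [levelMean]
  rw [integral_finsetSum _ fun w _ => (h.memLp_keyMean w t).integrable one_le_two, levelNorm_sq,
    Finset.mul_sum]
  exact Finset.sum_le_sum fun w _ => h.integral_keyMean_le w t

/-- The t² term comes from the mean. It is harmless, since this bound serves only to sum the
uncentred levels at fixed t. -/
theorem norm_levelCount_le (h : PoissonKeys μ P X N) (hμ : SummableSource μ) (k : ℕ) (t : ℝ≥0) :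
    ‖(h.memLp_levelCount hμ k t).toLp _‖ ≤
      9 * t * levelNorm μ k + t ^ 2 * levelNorm μ k ^ 2 := by
  rw [h.toLp_levelCount hμ]
  have h1 := h.norm_levelDev_le hμ k t
  have h2 := norm_le_norm_centering_add ((h.memLp_levelMean k t).toLp _)
  rw [integral_toLp] at h2
  have h3 := h.norm_centering_levelMean_le k t
  have h4 := h.integral_levelMean_le k t
  refine (norm_add_le _ _).trans ?_
  linarith

/-- The centered and normalized cost at level `k` of the prefix tree. -/
noncomputable def normalizedLevel (h : PoissonKeys μ P X N) (hμ : SummableSource μ) (k : ℕ)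
    (t : ℝ≥0) : Lp ℝ 2 P :=
  (t : ℝ)⁻¹ • centering P ((h.memLp_levelCount hμ k t).toLp _)

/-- Here 9 = 7 + 2. The bound is uniform in t and dominates the series over levels. -/
theorem norm_normalizedLevel_le (h : PoissonKeys μ P X N) (hμ : SummableSource μ) (k : ℕ)
    (t : ℝ≥0) : ‖h.normalizedLevel hμ k t‖ ≤ 9 * levelNorm μ k := by
  have h0 := levelNorm_nonneg μ k
  have h1 : ‖centering P ((h.memLp_levelCount hμ k t).toLp _)‖ ≤ t * (9 * levelNorm μ k) := by
    rw [h.toLp_levelCount hμ, map_add]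
    refine (norm_add_le _ _).trans ?_
    have h2 := (norm_centering_le _).trans (h.norm_levelDev_le hμ k t)
    have h3 := h.norm_centering_levelMean_le k t
    linarith
  rw [normalizedLevel, norm_smul, norm_inv, NNReal.norm_eq]
  exact inv_mul_le_of_le_mul₀ t.coe_nonneg (by positivity) h1

theorem tendsto_levelMean (h : PoissonKeys μ P X N) (k : ℕ) :
    Tendsto (fun t : ℝ≥0 => (t : ℝ)⁻¹ • centering P ((h.memLp_levelMean k t).toLp _)) atTop
      (𝓝 0) := by
  have h1 : Tendsto (fun t : ℝ≥0 =>
      ‖(t : ℝ)⁻¹ • centering P ((h.memLp_levelMean k t).toLp _)‖ ^ 2) atTop (𝓝 0) := by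
    refine tendsto_zero_of_le_add_div (K := 4 * levelNorm μ k ^ 2) (fun t => sq_nonneg _)
      (by positivity) fun ε hε => ?_
    obtain ⟨C, hC, hh⟩ := exists_harm_sq_le hε
    refine ⟨4 * C * ∑ w : Fin k → A, prefixProb μ w, fun t ht => ?_⟩
    have ht' : (0 : ℝ) < t := ht
    rw [norm_smul, mul_pow, norm_centering_toLp_sq, norm_inv, NNReal.norm_eq, inv_pow,
      inv_mul_le_iff₀ (by positivity)]
    refine (h.variance_levelMean_le k t hε.le hC hh).trans_eq ?_
    rw [levelNorm_sq]
    field_simp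
  rw [tendsto_zero_iff_norm_tendsto_zero]
  simpa using h1.sqrt

/-- The limit comes from the deviations alone: for each of the finitely many w, `keyDev` / t follows
p_w `keyRatio`, while the conditional means vanish. -/
theorem exists_tendsto_normalizedLevel (h : PoissonKeys μ P X N) (hμ : SummableSource μ) (k : ℕ) :
    ∃ y, Tendsto (h.normalizedLevel hμ k) atTop (𝓝 y) := by
  choose R hR using fun w : Fin k → A => h.exists_tendsto_keyRatio hμ w
  have h1 : ∀ w : Fin k → A, Tendsto (fun t : ℝ≥0 => (t : ℝ)⁻¹ • (h.memLp_keyDev hμ w t).toLp _)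
      atTop (𝓝 (prefixProb μ w • R w)) := by
    intro w
    have h2 : Tendsto (fun t : ℝ≥0 => ‖(t : ℝ)⁻¹ • (h.memLp_keyDev hμ w t).toLp _ -
        prefixProb μ w • (h.memLp_keyRatio hμ w t).toLp _‖ ^ 2) atTop (𝓝 0) := by
      have h3 : Tendsto (fun t : ℝ≥0 => 40 * (prefixProb μ w / (t : ℝ) + (1 / (t : ℝ)) ^ 2)) atTop
          (𝓝 0) := by
        have ht : Tendsto (fun t : ℝ≥0 => (t : ℝ)) atTop atTop :=
          NNReal.tendsto_coe_atTop.2 tendsto_id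
        have h4 := ((tendsto_const_nhds (x := prefixProb μ w)).div_atTop ht).add
          (((tendsto_const_nhds (x := (1 : ℝ))).div_atTop ht).pow 2)
        simpa only [zero_pow two_ne_zero, add_zero, mul_zero] using h4.const_mul 40
      refine tendsto_of_tendsto_of_tendsto_of_le_of_le' tendsto_const_nhds h3
        (Eventually.of_forall fun t => sq_nonneg _) ?_
      filter_upwards [eventually_gt_atTop 0] with t ht
      exact h.norm_keyDev_sub_sq_le hμ w ht
    have h4 := tendsto_zero_iff_norm_tendsto_zero.2 (by simpa using h2.sqrt)
    simpa using h4.add ((hR w).const_smul (prefixProb μ w))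
  have h5 := ((centering P).continuous.tendsto _).comp
    (tendsto_finsetSum Finset.univ fun w _ => h1 w)
  refine ⟨_, (h5.add (h.tendsto_levelMean k)).congr fun t => ?_⟩
  have h6 : (h.memLp_levelDev hμ k t).toLp _ =
      ∑ w : Fin k → A, (h.memLp_keyDev hμ w t).toLp _ := by
    apply Lp.ext
    filter_upwards [(h.memLp_levelDev hμ k t).coeFn_toLp,
      Lp.coeFn_finsetSum Finset.univ fun w : Fin k → A => (h.memLp_keyDev hμ w t).toLp _,
      ae_all_iff.2 fun w : Fin k → A => (h.memLp_keyDev hμ w t).coeFn_toLp] with ω e1 e2 e3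
    rw [e1, e2, Finset.sum_apply]
    exact Finset.sum_congr rfl fun w _ => (e3 w).symm
  rw [normalizedLevel, h.toLp_levelCount hμ, map_add, smul_add, h6, Function.comp_apply,
    ← Finset.smul_sum, map_smul]

end PoissonKeys

end Levels

/-! ### Summation over levels and the variance of the limit. -/

section Limit

variable {A : Type*} [LinearOrder A] [Fintype A] {Ω : Type*}
  [MeasurableSpace A] [DiscreteMeasurableSpace A] [MeasurableSpace Ω]
  {μ : Measure (ℕ → A)} [IsProbabilityMeasure μ] {P : Measure Ω}
  {X : ℕ → Ω → ℕ → A} {N : ℝ≥0 → Ω → ℕ}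

theorem PoissonKeys.ae_eventually_sum_levelCount (h : PoissonKeys μ P X N)
    (hμ : SummableSource μ) (t : ℝ≥0) :
    ∀ᵐ ω ∂P, ∀ᶠ L in atTop, ∑ k ∈ Finset.range L, (levelCount k (arrived X N t ω) : ℝ) =
      symbolCountAt X N t ω := by
  have h1 := ae_injective_keyLaw μ hμ
  rw [← h.map_keys] at h1
  filter_upwards [ae_of_ae_map h.measurable_keys.aemeasurable h1] with ω hω
  filter_upwards [eventually_sum_levelCount (nodup_wordList hω (N t ω))] with L hL
  rw [← Nat.cast_sum]
  exact congrArg Nat.cast hL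

variable [IsProbabilityMeasure P]

/-- For n ≥ m use monotonicity of `ratioVar`, for n ≤ m the additive constant; n(n - 1) is chosen
for its exact mean t². -/
theorem ofReal_ratioVar_mul_sq_le (m : ℕ) (t : ℝ≥0) :
    ENNReal.ofReal (ratioVar m * t ^ 2) ≤
      ∫⁻ n, ENNReal.ofReal (keyVar n) ∂(poissonMeasure t) +
        ENNReal.ofReal (ratioVar m * (m + 1) ^ 2) := by
  have h0 := ratioVar_nonneg m
  calc ENNReal.ofReal (ratioVar m * t ^ 2)
      = ∫⁻ n, ENNReal.ofReal (ratioVar m) * ((n * (n - 1) : ℕ) : ℝ≥0∞) ∂(poissonMeasure t) := by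
        rw [lintegral_const_mul _ (by fun_prop), lintegral_poisson_mul_sub_one,
          ENNReal.ofReal_mul h0, ENNReal.ofReal_pow t.coe_nonneg, ENNReal.ofReal_coe_nnreal]
    _ ≤ ∫⁻ n, (ENNReal.ofReal (keyVar n) + ENNReal.ofReal (ratioVar m * (m + 1) ^ 2))
          ∂(poissonMeasure t) := by
        refine lintegral_mono fun n => ?_
        have hv := keyVar_nonneg n
        rw [← ENNReal.ofReal_natCast, ← ENNReal.ofReal_mul h0,
          ← ENNReal.ofReal_add hv (by positivity)]
        apply ENNReal.ofReal_le_ofReal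
        have hn : ((n * (n - 1) : ℕ) : ℝ) ≤ ((n : ℝ) + 1) ^ 2 := by
          have : n * (n - 1) ≤ (n + 1) ^ 2 := by
            rw [sq]; exact Nat.mul_le_mul (by omega) (by omega)
          exact_mod_cast this
        rcases le_total m n with hmn | hmn
        · have h1 : ratioVar m * ((n : ℝ) + 1) ^ 2 ≤ keyVar n := by
            rw [← le_div_iff₀ (by positivity)]
            exact ratioVar_mono hmn
          have h2 := mul_le_mul_of_nonneg_left hn h0
          have h3 : 0 ≤ ratioVar m * ((m : ℝ) + 1) ^ 2 := by positivity
          linarith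
        · have h2 : ((n * (n - 1) : ℕ) : ℝ) ≤ ((m : ℝ) + 1) ^ 2 := hn.trans (by gcongr)
          have h3 := mul_le_mul_of_nonneg_left h2 h0
          linarith
    _ = _ := by rw [lintegral_add_right _ (by fun_prop), lintegral_const, measure_univ, mul_one]

namespace PoissonKeys

theorem summable_norm_levelCount (h : PoissonKeys μ P X N) (hμ : SummableSource μ) (t : ℝ≥0) :
    Summable fun k => ‖(h.memLp_levelCount hμ k t).toLp _‖ := by
  have ha : Summable (levelNorm μ) := hμ
  refine Summable.of_nonneg_of_le (fun k => norm_nonneg _) (fun k => ?_)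
    (ha.mul_left (9 * t + t ^ 2 * ∑' j, levelNorm μ j))
  refine (h.norm_levelCount_le hμ k t).trans ?_
  have h1 := ha.le_tsum k fun j _ => levelNorm_nonneg μ j
  have h2 := mul_le_mul_of_nonneg_right h1 (levelNorm_nonneg μ k)
  have h3 := mul_le_mul_of_nonneg_left h2 (sq_nonneg (t : ℝ))
  linarith

theorem exists_hasSum_symbolCountAt (h : PoissonKeys μ P X N) (hμ : SummableSource μ) (t : ℝ≥0) :
    ∃ hS : MemLp (symbolCountAt X N t) 2 P,
      HasSum (fun k => (h.memLp_levelCount hμ k t).toLp _) (hS.toLp _) :=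
  hasSum_toLp_of_eventually (fun k => h.memLp_levelCount hμ k t)
    (h.summable_norm_levelCount hμ t) (h.ae_eventually_sum_levelCount hμ t)

theorem memLp_symbolCountAt (h : PoissonKeys μ P X N) (hμ : SummableSource μ) (t : ℝ≥0) :
    MemLp (symbolCountAt X N t) 2 P :=
  (h.exists_hasSum_symbolCountAt hμ t).1

theorem hasSum_levelCount (h : PoissonKeys μ P X N) (hμ : SummableSource μ) (t : ℝ≥0) :
    HasSum (fun k => (h.memLp_levelCount hμ k t).toLp _)
      ((h.memLp_symbolCountAt hμ t).toLp _) :=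
  (h.exists_hasSum_symbolCountAt hμ t).2

/-- Dominated convergence for series: each level converges and the norms are dominated by a summable
sequence. -/
theorem exists_tendsto_symbolCountAt (h : PoissonKeys μ P X N) (hμ : SummableSource μ) :
    ∃ y, Tendsto (fun t : ℝ≥0 =>
      (t : ℝ)⁻¹ • centering P ((h.memLp_symbolCountAt hμ t).toLp _)) atTop (𝓝 y) := by
  choose y hy using h.exists_tendsto_normalizedLevel hμ
  have ha : Summable (levelNorm μ) := hμ
  refine ⟨∑' k, y k, (tendsto_tsum_of_dominated_convergence (ha.mul_left 9) hy
    (Eventually.of_forall fun t k => h.norm_normalizedLevel_le hμ k t)).congr fun t => ?_⟩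
  exact (((h.hasSum_levelCount hμ t).mapL (centering P)).const_smul (t : ℝ)⁻¹).tsum_eq

/-- The lower bound for finitely many levels, with `c` the mean of their sum, passes to the limit in
L. -/
theorem ratioVar_mul_sq_le (h : PoissonKeys μ P X N) (hμ : SummableSource μ) (m : ℕ) (t : ℝ≥0) :
    ratioVar m * t ^ 2 ≤ ‖centering P ((h.memLp_symbolCountAt hμ t).toLp _)‖ ^ 2 +
      ratioVar m * (m + 1) ^ 2 := by
  have h0 := ratioVar_nonneg m
  have h1 : Tendsto (fun L => ‖centering P (∑ k ∈ Finset.range (L + 1),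
      (h.memLp_levelCount hμ k t).toLp _)‖ ^ 2) atTop
      (𝓝 (‖centering P ((h.memLp_symbolCountAt hμ t).toLp _)‖ ^ 2)) :=
    ((((centering P).continuous.tendsto _).comp
      ((h.hasSum_levelCount hμ t).tendsto_sum_nat.comp (tendsto_add_atTop_nat 1))).norm).pow 2
  refine ge_of_tendsto' (h1.add_const _) fun L => ?_
  have hsum : MemLp (fun ω => ∑ k ∈ Finset.range (L + 1), (levelCount k (arrived X N t ω) : ℝ))
      2 P := memLp_finsetSum _ fun k _ => h.memLp_levelCount hμ k t
  have h2 : ∑ k ∈ Finset.range (L + 1), (h.memLp_levelCount hμ k t).toLp _ = hsum.toLp _ := by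
    apply Lp.ext
    filter_upwards [hsum.coeFn_toLp, Lp.coeFn_finsetSum (Finset.range (L + 1))
      fun k => (h.memLp_levelCount hμ k t).toLp _,
      ae_all_iff.2 fun k => (h.memLp_levelCount hμ k t).coeFn_toLp] with ω e1 e2 e3
    rw [e1, e2, Finset.sum_apply]
    exact Finset.sum_congr rfl fun k _ => e3 k
  rw [h2, centering_toLp, ← ENNReal.ofReal_le_ofReal_iff (by positivity),
    ENNReal.ofReal_add (by positivity) (by positivity), norm_toLp_sq]
  refine (ofReal_ratioVar_mul_sq_le m t).trans ?_
  gcongr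
  exact h.lintegral_keyVar_le hμ L _ t

/-- Divide by t² and let t → ∞ for fixed m, then m → ∞. -/
theorem limit_le_norm_sq (h : PoissonKeys μ P X N) (hμ : SummableSource μ) {y : Lp ℝ 2 P}
    (hy : Tendsto (fun t : ℝ≥0 =>
      (t : ℝ)⁻¹ • centering P ((h.memLp_symbolCountAt hμ t).toLp _)) atTop (𝓝 y)) :
    7 - (2 / 3) * Real.pi ^ 2 ≤ ‖y‖ ^ 2 := by
  refine le_of_tendsto' tendsto_ratioVar fun m => ?_
  have ht : Tendsto (fun t : ℝ≥0 => (t : ℝ) ^ 2) atTop atTop :=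
    (tendsto_pow_atTop two_ne_zero).comp (NNReal.tendsto_coe_atTop.2 tendsto_id)
  have h1 := (hy.norm.pow 2).add
    ((tendsto_const_nhds (x := ratioVar m * ((m : ℝ) + 1) ^ 2)).div_atTop ht)
  rw [add_zero] at h1
  refine ge_of_tendsto h1 ?_
  filter_upwards [eventually_gt_atTop 0] with t ht
  have ht' : (0 : ℝ) < t := ht
  rw [norm_smul, mul_pow, norm_inv, NNReal.norm_eq, inv_pow, ← div_eq_inv_mul, ← add_div,
    le_div_iff₀ (by positivity)]
  exact h.ratioVar_mul_sq_le hμ m t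

theorem normalizedCount_ae_eq (h : PoissonKeys μ P X N) (hμ : SummableSource μ) (t : ℝ≥0) :
    normalizedCount P X N t =ᵐ[P]
      ((t : ℝ)⁻¹ • centering P ((h.memLp_symbolCountAt hμ t).toLp _) : Lp ℝ 2 P) := by
  rw [centering_toLp]
  filter_upwards [Lp.coeFn_smul (t : ℝ)⁻¹ (((h.memLp_symbolCountAt hμ t).sub
    (memLp_const (∫ ω, symbolCountAt X N t ω ∂P))).toLp _),
    ((h.memLp_symbolCountAt hμ t).sub
      (memLp_const (∫ ω, symbolCountAt X N t ω ∂P))).coeFn_toLp] with ω h1 h2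
  rw [h1, Pi.smul_apply, h2, normalizedCount, div_eq_inv_mul]
  rfl

/-- A limit of centred variables is centred, so its variance is its squared norm. -/
theorem variance_limit (h : PoissonKeys μ P X N) (hμ : SummableSource μ) {y : Lp ℝ 2 P}
    (hy : Tendsto (fun t : ℝ≥0 =>
      (t : ℝ)⁻¹ • centering P ((h.memLp_symbolCountAt hμ t).toLp _)) atTop (𝓝 y)) :
    variance y P = ‖y‖ ^ 2 := by
  have h1 : centering P y = y := by
    refine tendsto_nhds_unique (((centering P).continuous.tendsto _).comp hy)
      (hy.congr fun t => ?_)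
    rw [Function.comp_apply, map_smul, centering_centering]
  have h2 := norm_centering_toLp_sq (Lp.memLp y)
  rw [Lp.toLp_coeFn, h1] at h2
  exact h2.symm

theorem isTheta_variance (h : PoissonKeys μ P X N) (hμ : SummableSource μ) {y : Lp ℝ 2 P}
    (hy : Tendsto (fun t : ℝ≥0 =>
      (t : ℝ)⁻¹ • centering P ((h.memLp_symbolCountAt hμ t).toLp _)) atTop (𝓝 y)) (hy0 : y ≠ 0) :
    (fun t : ℝ≥0 => variance (symbolCountAt X N t) P) =Θ[atTop] fun t : ℝ≥0 => (t : ℝ) ^ 2 := by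
  have h1 : Tendsto (fun t : ℝ≥0 => variance (symbolCountAt X N t) P / (t : ℝ) ^ 2) atTop
      (𝓝 (‖y‖ ^ 2)) := by
    refine (hy.norm.pow 2).congr fun t => ?_
    rw [norm_smul, mul_pow, norm_centering_toLp_sq, norm_inv, NNReal.norm_eq, inv_pow,
      ← div_eq_inv_mul]
  exact (isTheta_of_div_tendsto_nhds_ne_zero h1 (pow_ne_zero 2 (norm_ne_zero_iff.2 hy0))).symm

end PoissonKeys

end Limit

end QuickSymb

theorem theorem2p1 {A : Type*} [Fintype A] [LinearOrder A] [MeasurableSpace A]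
    [DiscreteMeasurableSpace A]
    (μ : Measure (ℕ → A)) [IsProbabilityMeasure μ] (hμ : QuickSymb.SummableSource μ)
    {Ω : Type*} [MeasurableSpace Ω] (P : Measure Ω) [IsProbabilityMeasure P]
    (X : ℕ → Ω → ℕ → A) (hXmeas : ∀ i, Measurable (X i)) (hXlaw : ∀ i, P.map (X i) = μ)
    (hXindep : iIndepFun X P)
    (N : ℝ≥0 → Ω → ℕ) (hN : QuickSymb.IsUnitPoissonProcess N P)
    (hXN : IndepFun (fun ω i => X i ω) (fun ω t => N t ω) P) :
    (∀ t : ℝ≥0, MemLp (QuickSymb.symbolCountAt X N t) 2 P) ∧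
    (∃ Y : Ω → ℝ, MemLp Y 2 P ∧
      Tendsto (fun t : ℝ≥0 => eLpNorm (QuickSymb.normalizedCount P X N t - Y) 2 P)
        atTop (𝓝 0) ∧
      ¬ (Y =ᵐ[P] 0) ∧
      0 < 7 - (2 / 3) * Real.pi ^ 2 ∧
      7 - (2 / 3) * Real.pi ^ 2 ≤ variance Y P) ∧
    (fun t : ℝ≥0 => variance (QuickSymb.symbolCountAt X N t) P) =Θ[atTop]
      (fun t : ℝ≥0 => (t : ℝ) ^ 2) := by
  have h : QuickSymb.PoissonKeys μ P X N := ⟨hXmeas, hXlaw, hXindep, hN, hXN⟩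
  obtain ⟨y, hy⟩ := h.exists_tendsto_symbolCountAt hμ
  have hpos := QuickSymb.limit_pos
  have hle := h.limit_le_norm_sq hμ hy
  have hy0 : y ≠ 0 := by
    rintro rfl
    rw [norm_zero] at hle
    linarith
  refine ⟨h.memLp_symbolCountAt hμ, ⟨y, Lp.memLp y, ?_, fun h0 => hy0 ?_, hpos, ?_⟩,
    h.isTheta_variance hμ hy hy0⟩
  · refine ((Lp.tendsto_Lp_iff_tendsto_eLpNorm' _ _).1 hy).congr fun t => ?_
    exact eLpNorm_congr_ae ((h.normalizedCount_ae_eq hμ t).symm.sub (ae_eq_refl _))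
  · exact Lp.eq_zero_iff_ae_eq_zero.2 h0
  · rwa [h.variance_limit hμ hy]
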